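/- **Setting.** Let $\gamma=\mathcal N(0,1)$, let $Z,Z_1,Z_2$ be i.i.d. with law $\gamma$, and let $H_q$ be the monic Hermite polynomials, so $\mathbb E[H_p(Z)H_q(Z)]=q!\,\delta_{pq}$. Let $\sigma\in L^2(\gamma)$ be not a.e. zero with $\sum_{q} q!\,q\,a_q(\sigma)^2<\infty$, where $a_q(\sigma)=\frac1{q!}\mathbb E[\sigma(Z)H_q(Z)]$, and put $$\kappa(u)=\frac{\mathbb E\big[\sigma(Z_1)\,\sigma(uZ_1+\sqrt{1-u^2}\,Z_2)\big]}{\mathbb E[\sigma(Z)^2]},\qquad u\in[-1,1],$$ with $L$-fold iterates $\kappa_L=\kappa\circ\cdots\circ\kappa$; derivatives of $\kappa$ at the end points are one-sided. Assume one of the following. * **High disorder.** $\kappa'(1)>1$; there are $\gamma_0>1$ and $c\in\mathbb R$ with $1-\kappa(u)=\kappa'(1)(1-u)-c(1-u)^{\gamma_0}+o((1-u)^{\gamma_0})$ as $u\to1^-$; and $\kappa'(b)\ne0$ at the fixed point $b\in(-1,1)$ of $\kappa$. Put $v_L=\kappa'(b)^L$, $\nu=-\log\kappa'(b)/\log\kappa'(1)$,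 $\beta_0=1-b$, $b_L=b$, $w_L=\kappa'(b)^L$. * **Sparse.** $\kappa'(1)=1$ and, as $u\to1^-$, with $\gamma_1>1$ and $c_1\neq0$, either (A) $1-\kappa(u)=(1-u)-c_1(1-u)^{\gamma_1}-c_2(1-u)^{\gamma_2}+o((1-u)^{\gamma_2})$ with $\gamma_2>2\gamma_1-1$, or (B) $1-\kappa(u)=(1-u)-c_1(1-u)^{\gamma_1}-c_2(1-u)^{\gamma_2}-c_3(1-u)^{\gamma_3}+o((1-u)^{\gamma_3})$ with $\gamma_3>\gamma_2=2\gamma_1-1$. Put $v_L=1/L$, $\nu=\gamma_1-1$, $\rho=1/\nu$, $\beta_0=((\gamma_1-1)c_1)^{-\rho}$, $\beta_1=\dfrac{\beta_0\,\rho\,A_1}{(\gamma_1-1)c_1}$, where $A_1=\frac{\gamma_1c_1}2$ in case (A) and $A_1=\frac{\gamma_1c_1}2+\frac{c_2}{c_1}$ in case (B), and $b_L=1-\beta_0L^{-\rho}+\beta_1L^{-(\rho+1)}\log L$, $w_L=L^{-(\rho+1)}$. For $d\ge1$ let $\omega_d$ be the area of the unit sphere $\mathbb S^d\subset\mathbb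 R^{d+1}$, let $dx$ be its surface measure, and let $d\mu(u)=\frac{\omega_{d-1}}{\omega_d}(1-u^2)^{d/2-1}\mathbf 1_{[-1,1]}(u)\,du$. For each $L$ let $T_L$ be a jointly measurable centred Gaussian field on $\mathbb S^d$ with $\mathbb E[T_L(x)T_L(y)]=\kappa_L(\langle x,y\rangle)$. Put $C_0(L)=\int\kappa_L\,d\mu$ and $$\widehat T_L(x)=\frac{T_L(x)-\omega_d^{-1}\int_{\mathbb S^d}T_L(y)\,dy}{\sqrt{1-C_0(L)}}.$$ For $\varphi\in L^2(\gamma)$ with Hermite coefficients $\varphi_q=\frac1{q!}\mathbb E[\varphi(Z)H_q(Z)]$, the $q$-th chaotic component of $F_L=\int_{\mathbb S^d}\varphi(\widehat T_L(x))\,dx$ is $F_L[q]=\varphi_q\int_{\mathbb S^d}H_q(\widehat T_L(x))\,dx$. **Statement.** There is a function $\beta$, depending only on $\kappa$, such that $(\kappa_L(u)-b_L)/w_L\to\beta(u)$ as $L\to\infty$ for every $u\in(-1,1)$, and for all $d\ge1$, all such fields $T_L$ and functions $\varphi$, and every integer $q\ge2$, the variables $F_L[q]$ are square integrable and the following hold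 as $L\to\infty$. 1. If $q<d/(2\nu)$, then $\beta\in L^q(\mu)$ and $$\operatorname{Var}(F_L[q])=v_L^{\,q}\big(\beth_q\,\omega_d^2\,q!\,\varphi_q^2+o(1)\big),\qquad \beth_q=\frac1{\beta_0^q}\int_{-1}^1\Big(\beta-\int_{-1}^1\beta\,d\mu\Big)^q d\mu .$$ 2. If $\varphi_q\ne0$, and if $q$ is even in case $\kappa$ is odd, then $$\operatorname{Var}(F_L[q])\asymp\begin{cases}v_L^{\,q}\log(1/v_L)&\text{if }q=d/(2\nu),\\ v_L^{\,d/(2\nu)}&\text{if }q>d/(2\nu),\end{cases}$$ where $f_L\asymp g_L$ means that for some constants $c,C>0$ one has $c\,g_L\le f_L\le C\,g_L$ for all large $L$. -/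

import Mathlib

open MeasureTheory ProbabilityTheory Filter Topology Asymptotics Set

noncomputable section

namespace NNGF

/-- The standard Gaussian law `𝒩(0,1)` on `ℝ`. -/
abbrev stdGaussian : Measure ℝ := gaussianReal 0 1

/-- The (monic, probabilists') Hermite polynomial `H_q`. -/
def H (q : ℕ) (x : ℝ) : ℝ := Polynomial.aeval x (Polynomial.hermite q)

/-- The Hermite coefficient `(1 / q!) 𝔼[f(Z) H_q(Z)]`, `Z ∼ 𝒩(0,1)`. -/
def hermiteCoeff (f : ℝ → ℝ) (q : ℕ) : ℝ :=
  (q.factorial : ℝ)⁻¹ * ∫ z, f z * H q z ∂stdGaussian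

/-- Activation functions: `σ ∈ 𝔻^{1,2}`, not almost everywhere zero. -/
structure IsActivation (σ : ℝ → ℝ) : Prop where
  memLp : MemLp σ 2 stdGaussian
  ne_zero : ∫ z, σ z ^ 2 ∂stdGaussian ≠ 0
  summable : Summable fun q : ℕ => (q.factorial : ℝ) * q * hermiteCoeff σ q ^ 2

/-- The kernel `κ(u) = C 𝔼[σ(Z₁) σ(u Z₁ + √(1 - u²) Z₂)]`, where `Z₁, Z₂` are i.i.d. standard
Gaussian and `C = 1 / 𝔼[σ(Z)²]`, so that `κ(1) = 1`. Only its values on `[-1, 1]` matter. -/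
def kernel (σ : ℝ → ℝ) (u : ℝ) : ℝ :=
  (∫ z, σ z ^ 2 ∂stdGaussian)⁻¹ *
    ∫ p : ℝ × ℝ, σ p.1 * σ (u * p.1 + √(1 - u ^ 2) * p.2) ∂(stdGaussian.prod stdGaussian)

/-- The derivative of a function on `[-1, 1]` (one-sided at the end points). -/
def D (κ : ℝ → ℝ) (u : ℝ) : ℝ := derivWithin κ (Icc (-1) 1) u

/-- As `u → 1⁻`, `1 - κ(u) = κ'(1) (1 - u) - c (1 - u)^γ + o((1 - u)^γ)`
for some `γ > 1` and some constant `c`. -/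
def RegularAtOne (κ : ℝ → ℝ) : Prop :=
  ∃ γ c : ℝ, 1 < γ ∧
    (fun u : ℝ => 1 - κ u - (D κ 1 * (1 - u) - c * (1 - u) ^ γ))
      =o[𝓝[<] 1] fun u : ℝ => (1 - u) ^ γ

/-- The high-disorder and the sparse regime, in a unified notation. `Regime κ ν β₀ v b w` says that
`κ` belongs to one of the regimes, with exponent `ν`, constant `β₀`, speed `v_L`, and with
centring `b_L` and scale `w_L` of the renormalized iterates `(κ_L - b_L) / w_L`. -/
inductive Regime (κ : ℝ → ℝ) : (ν β₀ : ℝ) → (v b w : ℕ → ℝ) → Prop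
  /-- High disorder: `κ'(1) > 1`, and `κ'(b) ≠ 0` at the fixed point `b ∈ (-1, 1)`. -/
  | high (b : ℝ) (reg : RegularAtOne κ) (one_lt : 1 < D κ 1)
      (mem : b ∈ Ioo (-1 : ℝ) 1) (fixed : κ b = b) (ne_zero : D κ b ≠ 0) :
      Regime κ (-(Real.log (D κ b) / Real.log (D κ 1))) (1 - b)
        (fun L => D κ b ^ L) (fun _ => b) (fun L => D κ b ^ L)
  /-- Sparse, `γ₂ > 2 γ₁ - 1`. Here `ρ = 1 / (γ₁ - 1)`, `β₀ = ((γ₁ - 1) c₁)^{-ρ}` and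
  `β₁ = β₀ ρ A₁ / ((γ₁ - 1) c₁)` with `A₁ = γ₁ c₁ / 2`. -/
  | sparseA (γ₁ γ₂ c₁ c₂ ρ β₀ β₁ : ℝ) (crit : D κ 1 = 1)
      (hγ₁ : 1 < γ₁) (hγ₂ : 2 * γ₁ - 1 < γ₂) (hc₁ : c₁ ≠ 0)
      (expansion : (fun u : ℝ => 1 - κ u -
          ((1 - u) - c₁ * (1 - u) ^ γ₁ - c₂ * (1 - u) ^ γ₂))
        =o[𝓝[<] 1] fun u : ℝ => (1 - u) ^ γ₂)
      (hρ : ρ = (γ₁ - 1)⁻¹) (hβ₀ : β₀ = ((γ₁ - 1) * c₁) ^ (-ρ))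
      (hβ₁ : β₁ = β₀ * ρ * (γ₁ * c₁ / 2) / ((γ₁ - 1) * c₁)) :
      Regime κ (γ₁ - 1) β₀ (fun L => (L : ℝ)⁻¹)
        (fun L => 1 - β₀ * (L : ℝ) ^ (-ρ) + β₁ * (L : ℝ) ^ (-(ρ + 1)) * Real.log L)
        (fun L => (L : ℝ) ^ (-(ρ + 1)))
  /-- Sparse, `γ₂ = 2 γ₁ - 1`. The same, with `A₁ = γ₁ c₁ / 2 + c₂ / c₁`. -/
  | sparseB (γ₁ γ₂ γ₃ c₁ c₂ c₃ ρ β₀ β₁ : ℝ) (crit : D κ 1 = 1)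
      (hγ₁ : 1 < γ₁) (hγ₂ : γ₂ = 2 * γ₁ - 1) (hγ₃ : γ₂ < γ₃) (hc₁ : c₁ ≠ 0)
      (expansion : (fun u : ℝ => 1 - κ u -
          ((1 - u) - c₁ * (1 - u) ^ γ₁ - c₂ * (1 - u) ^ γ₂ - c₃ * (1 - u) ^ γ₃))
        =o[𝓝[<] 1] fun u : ℝ => (1 - u) ^ γ₃)
      (hρ : ρ = (γ₁ - 1)⁻¹) (hβ₀ : β₀ = ((γ₁ - 1) * c₁) ^ (-ρ))
      (hβ₁ : β₁ = β₀ * ρ * (γ₁ * c₁ / 2 + c₂ / c₁) / ((γ₁ - 1) * c₁)) :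
      Regime κ (γ₁ - 1) β₀ (fun L => (L : ℝ)⁻¹)
        (fun L => 1 - β₀ * (L : ℝ) ^ (-ρ) + β₁ * (L : ℝ) ^ (-(ρ + 1)) * Real.log L)
        (fun L => (L : ℝ) ^ (-(ρ + 1)))

/-- The unit sphere `𝕊^{n-1}` of `ℝⁿ`; thus `𝕊^d` is `Sphere (d + 1)`. -/
abbrev Sphere (n : ℕ) : Type := Metric.sphere (0 : EuclideanSpace ℝ (Fin n)) 1

/-- The surface (Lebesgue) measure of the unit sphere of `ℝⁿ`. -/
abbrev surface (n : ℕ) : Measure (Sphere n) :=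
  (volume : Measure (EuclideanSpace ℝ (Fin n))).toSphere

/-- The area `ω_d` of `𝕊^d` is `area (d + 1)`. -/
def area (n : ℕ) : ℝ := (surface n).real univ

/-- The probability measure
`dμ_d(u) = (ω_{d-1} / ω_d) 1_{[-1,1]}(u) (1 - u²)^{d/2 - 1} du` (for `d ≥ 1`). -/
def gegenbauerMeasure (d : ℕ) : Measure ℝ :=
  ((volume : Measure ℝ).restrict (Icc (-1) 1)).withDensity fun u =>
    ENNReal.ofReal (area d / area (d + 1) * (1 - u ^ 2) ^ ((d : ℝ) / 2 - 1))

/-- `β̂ = β - ∫ β dμ_d`. -/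
def centered (d : ℕ) (β : ℝ → ℝ) (u : ℝ) : ℝ := β u - ∫ s, β s ∂(gegenbauerMeasure d)

/-- `ℶ_q = β₀^{-q} ∫ β̂^q dμ_d`. -/
def beth (d : ℕ) (β₀ : ℝ) (β : ℝ → ℝ) (q : ℕ) : ℝ :=
  (1 / β₀ ^ q) * ∫ u, centered d β u ^ q ∂(gegenbauerMeasure d)

/-- `C₀(L) = ∫ κ_L dμ_d`, where `κ_L` is the `L`-fold iterate of `κ`. -/
def C₀ (d : ℕ) (κ : ℝ → ℝ) (L : ℕ) : ℝ := ∫ u, κ^[L] u ∂(gegenbauerMeasure d)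

/-- `T` is a neural network Gaussian field of depth `L` on `𝕊^d`: a jointly measurable centred
Gaussian field with covariance `𝔼[T(x) T(y)] = κ_L(⟨x, y⟩)`. -/
structure IsNNGF {Ω : Type*} [MeasurableSpace Ω] (P : Measure Ω) (κ : ℝ → ℝ) (d L : ℕ)
    (T : Sphere (d + 1) → Ω → ℝ) : Prop where
  measurable : Measurable (Function.uncurry T)
  gaussian : IsGaussianProcess T P
  mean : ∀ x, ∫ ω, T x ω ∂P = 0
  cov : ∀ x y, ∫ ω, T x ω * T y ω ∂P =
    κ^[L] (inner ℝ (x : EuclideanSpace ℝ (Fin (d + 1))) (y : EuclideanSpace ℝ (Fin (d + 1))))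

/-- `T̂_L(x) = (T_L(x) - √C₀(L) ζ₀₀) / √(1 - C₀(L))`, where the zeroth mode `√C₀(L) ζ₀₀` is the
average of `T_L` over the sphere. -/
def normalizedField {Ω : Type*} (κ : ℝ → ℝ) (d L : ℕ) (T : Sphere (d + 1) → Ω → ℝ)
    (x : Sphere (d + 1)) (ω : Ω) : ℝ :=
  (T x ω - (area (d + 1))⁻¹ * ∫ y, T y ω ∂(surface (d + 1))) / √(1 - C₀ d κ L)

/-- The `q`-th chaotic component `F_L[q] = φ_q ∫ H_q(T̂_L(x)) dx` of the functional
`F_L = ∫ φ(T̂_L(x)) dx`, where `φ_q` is the `q`-th Hermite coefficient of `φ`. -/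
def chaosComponent {Ω : Type*} (κ : ℝ → ℝ) (d L : ℕ) (T : Sphere (d + 1) → Ω → ℝ)
    (φ : ℝ → ℝ) (q : ℕ) (ω : Ω) : ℝ :=
  hermiteCoeff φ q * ∫ x, H q (normalizedField κ d L T x ω) ∂(surface (d + 1))

end NNGF

end

/-! The variance is a moment of the iterated kernel. The spherical average of `T_L` lies in the
closed linear span of the field, so any two values of the normalized field are jointly Gaussian, and
orthogonality of the Hermite polynomials gives `E[H_q(X) H_q(Y)] = q! ρ^q` for correlation `ρ`.
Under the surface measure `⟨x, y⟩` has law `ω_d μ` for each fixed `y`. Hence `Var F_L[q]` equals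
`φ_q² q! ω_d² ∫ ((κ_L - C₀) / (1 - C₀))^q dμ`. The integrand does not change under affine
renormalization of `κ_L`, so `κ_L` may be replaced by the profile `h_L = (κ_L - κ_L(0)) / (1 -
κ_L(0))`.

Three facts about `h_L` suffice (`IsProfile`): `h_L / v_L` converges pointwise to `(β - β(0)) / β₀`;
`|h_L(u)| ≤ C min(1, v_L (1-|u|)^{-ν})`; and near `1` a lower bound of the same form holds. At
distance `t` from `±1` the density of `μ` is of order `t^{d/2-1}`. If `νq < d/2`, the `q`-th power
of the upper bound, divided by `v_L^q`, is dominated by an integrable function, and dominated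
convergence gives the limit. Otherwise the mass sits near the truncation point `τ = v_L^{1/ν}`: the
moment has order `τ^{d/2} = v_L^{d/(2ν)}`, with an additional logarithm at the critical exponent.
The mean of `h_L` is negligible there because `q ≥ 2`. Negative values do no harm: either `q` is
even, or `κ` is not odd, and then the negative part of `h_L` is `O(v_L)`.

The facts about `h_L` come from the dynamics of `κ`. By Mehler's formula `κ` is a probability
generating function. It is therefore increasing and convex on `[0, 1]`, and `|κ(a) - κ(b)| ≤ κ(c) -
κ(b)` whenever `b ≥ 0` and `|a - b| ≤ c - b`, which reduces negative arguments to positive ones.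

In high disorder an orbit leaves `1` at rate `κ'(1)` and approaches `b` at rate `λ = κ'(b)`. As `ν
log κ'(1) = -log λ`, the quantity `log ((u - b)(1 - u)^{-ν})` changes by `log λ` in each step, up to
an error that is small at both ends and is absorbed by a bounded Lyapunov function. This gives the
two-sided bounds; the pointwise limit is Koenigs' linearization at `b`.

In the sparse regime the coordinate `s = (1 - u)^{-ν}` grows by `νc` plus a correction of order
`1/s` per step, and `s - A log s` solves Abel's equation up to errors that are summable along
orbits, uniformly in the starting point. Thus `s(κ_L(u)) = νcL + A log L + S(u) + o(1)`, and taking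
the power `-1/ν` yields `b_L`, `w_L` and `β`, while the uniform version yields the bounds. -/

noncomputable section

namespace NNGF

/-! ### Hermite polynomials and Gaussian integration by parts. -/

open Polynomial in
theorem integrable_polynomial_stdGaussian (p : ℝ[X]) :
    Integrable (fun z => p.eval z) stdGaussian := by
  have hpow : ∀ n : ℕ, Integrable (fun z : ℝ => z ^ n) stdGaussian := fun n =>
    integrable_pow_of_mem_interior_integrableExpSet (X := fun z : ℝ => z)
      (by rw [integrableExpSet_fun_id_gaussianReal]; simp) n
  induction p using Polynomial.induction_on' with
  | add p q hp hq =>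
    simp only [Polynomial.eval_add]
    exact hp.add hq
  | monomial n a => simpa using (hpow n).const_mul a

open Polynomial in
theorem memLp_polynomial_stdGaussian (p : ℝ[X]) :
    MemLp (fun z => p.eval z) 2 stdGaussian := by
  rw [memLp_two_iff_integrable_sq (by fun_prop)]
  exact (integrable_polynomial_stdGaussian (p ^ 2)).congr (ae_of_all _ fun z => by simp)

open Polynomial in
/-- Gaussian integration by parts for polynomials. -/
theorem stein_polynomial (p : ℝ[X]) :
    ∫ z, z * p.eval z ∂stdGaussian = ∫ z, p.derivative.eval z ∂stdGaussian := by
  have hI : ∀ r : ℝ[X], Integrable (fun z => r.eval z * gaussianPDFReal 0 1 z) := by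
    intro r
    have := integrable_polynomial_stdGaussian r
    rw [stdGaussian, gaussianReal_of_var_ne_zero _ one_ne_zero,
      integrable_withDensity_iff (measurable_gaussianPDF 0 1)
        (ae_of_all _ fun _ => gaussianPDF_lt_top)] at this
    simpa using this
  -- The Gaussian density `g` satisfies `(-g)' = x g`; the factor `x` is what the integration by
  -- parts removes.
  have hd : ∀ x, HasDerivAt (fun z => -gaussianPDFReal 0 1 z) (x * gaussianPDFReal 0 1 x) x := by
    intro x
    have h1 : HasDerivAt (fun z : ℝ => -(z - 0) ^ 2 / (2 * ((1 : NNReal) : ℝ))) (-x) x := by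
      have := ((hasDerivAt_id x).sub_const 0).pow 2 |>.neg.div_const (2 * ((1 : NNReal) : ℝ))
      refine this.congr_deriv ?_
      simp
      ring
    have := (h1.exp.const_mul ((√(2 * Real.pi * ((1 : NNReal) : ℝ)))⁻¹)).neg
    refine this.congr_deriv ?_
    simp only [gaussianPDFReal]
    ring
  have key := integral_mul_deriv_eq_deriv_mul_of_integrable
    (u := fun z => p.eval z) (u' := fun z => p.derivative.eval z)
    (v := fun z => -gaussianPDFReal 0 1 z) (v' := fun z => z * gaussianPDFReal 0 1 z)
    (fun x _ => p.hasDerivAt x) (fun x _ => hd x)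
    (by
      refine (hI (X * p)).congr (ae_of_all _ fun x => ?_)
      simp; ring)
    (by
      refine (hI p.derivative).neg.congr (ae_of_all _ fun x => ?_)
      simp)
    (by
      refine (hI p).neg.congr (ae_of_all _ fun x => ?_)
      simp)
  rw [stdGaussian, integral_gaussianReal_eq_integral_smul one_ne_zero,
    integral_gaussianReal_eq_integral_smul one_ne_zero]
  calc _ = ∫ x, p.eval x * (x * gaussianPDFReal 0 1 x) := by
        congr 1; ext x; simp; ring
    _ = _ := by
        rw [key, ← integral_neg]; congr 1; ext x; simp; ring

open Polynomial in
theorem derivative_hermite_succ (n : ℕ) :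
    derivative (hermite (n + 1)) = (n + 1 : ℤ[X]) * hermite n := by
  induction n with
  | zero => simp
  | succ n ih =>
    rw [hermite_succ (n + 1), derivative_sub, derivative_mul, derivative_X, ih, derivative_mul]
    have : derivative ((n : ℤ[X]) + 1) = 0 := by simp
    rw [this, hermite_succ n]
    push_cast
    ring

open Polynomial in
/-- The Hermite polynomial with real coefficients. -/
def hermiteReal (q : ℕ) : ℝ[X] := (hermite q).map (Int.castRingHom ℝ)

theorem H_eq_eval (q : ℕ) (x : ℝ) : H q x = (hermiteReal q).eval x := by
  rw [H, hermiteReal, Polynomial.aeval_def, Polynomial.eval_map]; rfl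

theorem hermiteReal_zero : hermiteReal 0 = 1 := by simp [hermiteReal]

theorem hermiteReal_succ (q : ℕ) : hermiteReal (q + 1) =
    Polynomial.X * hermiteReal q - (hermiteReal q).derivative := by
  simp [hermiteReal, Polynomial.derivative_map]

theorem derivative_hermiteReal_succ (q : ℕ) : (hermiteReal (q + 1)).derivative =
    Polynomial.C ((q : ℝ) + 1) * hermiteReal q := by
  rw [hermiteReal, Polynomial.derivative_map, derivative_hermite_succ]
  simp [hermiteReal]

theorem H_zero (x : ℝ) : H 0 x = 1 := by simp [H]

theorem H_one (x : ℝ) : H 1 x = x := by simp [H]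

theorem H_add_two (q : ℕ) (x : ℝ) : H (q + 2) x = x * H (q + 1) x - (q + 1) * H q x := by
  simp only [H_eq_eval]
  rw [hermiteReal_succ (q + 1), derivative_hermiteReal_succ]
  simp

@[fun_prop]
theorem continuous_H (q : ℕ) : Continuous (H q) := by
  have : H q = fun x => (hermiteReal q).eval x := funext (H_eq_eval q)
  rw [this]; fun_prop

theorem memLp_H (q : ℕ) : MemLp (H q) 2 stdGaussian := by
  have : H q = fun x => (hermiteReal q).eval x := funext (H_eq_eval q)
  rw [this]; exact memLp_polynomial_stdGaussian _

/-- Gaussian integration by parts for polynomials of an affine function. -/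
theorem stein_affine (p : Polynomial ℝ) (a s : ℝ) :
    ∫ z, z * p.eval (a + s * z) ∂stdGaussian
      = s * ∫ z, p.derivative.eval (a + s * z) ∂stdGaussian := by
  have := stein_polynomial (p.comp (Polynomial.C a + Polynomial.C s * Polynomial.X))
  simp only [Polynomial.eval_comp, Polynomial.derivative_comp, Polynomial.eval_mul,
    Polynomial.eval_add, Polynomial.eval_C, Polynomial.eval_X, Polynomial.derivative_add,
    Polynomial.derivative_C, Polynomial.derivative_mul, Polynomial.derivative_X] at this
  rw [this, ← integral_const_mul]
  congr 1; ext z; simp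

theorem integrable_polynomial_affine (p : Polynomial ℝ) (a s : ℝ) :
    Integrable (fun z => p.eval (a + s * z)) stdGaussian := by
  exact (integrable_polynomial_stdGaussian
    (p.comp (Polynomial.C a + Polynomial.C s * Polynomial.X))).congr
      (ae_of_all _ fun z => by simp)

theorem integrable_mul_polynomial_affine (p : Polynomial ℝ) (a s : ℝ) :
    Integrable (fun z => z * p.eval (a + s * z)) stdGaussian := by
  exact (integrable_polynomial_stdGaussian
    (Polynomial.X * p.comp (Polynomial.C a + Polynomial.C s * Polynomial.X))).congr
      (ae_of_all _ fun z => by simp)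

/-- The Hermite polynomials are eigenfunctions of the Ornstein–Uhlenbeck semigroup. -/
theorem integral_H_affine {ρ s : ℝ} (h : ρ ^ 2 + s ^ 2 = 1) (x : ℝ) (q : ℕ) :
    ∫ z, H q (ρ * x + s * z) ∂stdGaussian = ρ ^ q * H q x := by
  induction q using Nat.twoStepInduction with
  | zero => simp [H_zero]
  | one =>
    simp only [H_one, pow_one]
    have h1 := stein_affine 1 (ρ * x) s
    have h2 := integrable_mul_polynomial_affine 1 (ρ * x) s
    simp only [Polynomial.eval_one, mul_one, Polynomial.derivative_one, Polynomial.eval_zero,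
      integral_zero, mul_zero] at h1 h2
    rw [integral_add (integrable_const _) (h2.const_mul s), integral_const_mul s, h1]
    simp
  | more q ih ih' =>
    have e : ∀ z, H (q + 2) (ρ * x + s * z) = ρ * x * H (q + 1) (ρ * x + s * z)
        + s * (z * H (q + 1) (ρ * x + s * z)) - (q + 1) * H q (ρ * x + s * z) := fun z => by
      rw [H_add_two]; ring
    have i1 : Integrable (fun z => H (q + 1) (ρ * x + s * z)) stdGaussian := by
      simpa only [H_eq_eval] using integrable_polynomial_affine _ _ _
    have i2 : Integrable (fun z => z * H (q + 1) (ρ * x + s * z)) stdGaussian := by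
      simpa only [H_eq_eval] using integrable_mul_polynomial_affine _ _ _
    have i3 : Integrable (fun z => H q (ρ * x + s * z)) stdGaussian := by
      simpa only [H_eq_eval] using integrable_polynomial_affine _ _ _
    have hs : ∫ z, z * H (q + 1) (ρ * x + s * z) ∂stdGaussian = s * ((q + 1) * (ρ ^ q * H q x)) := by
      rw [← ih]
      simp only [H_eq_eval]
      rw [stein_affine, derivative_hermiteReal_succ, ← integral_const_mul ((q : ℝ) + 1)]
      simp
    simp_rw [e]
    have i12 : Integrable (fun z => ρ * x * H (q + 1) (ρ * x + s * z)
        + s * (z * H (q + 1) (ρ * x + s * z))) stdGaussian := (i1.const_mul _).add (i2.const_mul _)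
    rw [integral_sub i12 (i3.const_mul _),
      integral_add (i1.const_mul _) (i2.const_mul _), integral_const_mul, integral_const_mul,
      integral_const_mul, ih, ih', hs, H_add_two]
    -- The two terms in `H q` carry `s² - 1 = -ρ²`, which restores the three-term recursion with the
    -- factor `ρ ^ (q + 2)`.
    linear_combination ((q : ℝ) + 1) * ρ ^ q * H q x * h

/-- Orthogonality of the Hermite polynomials. -/
theorem integral_H_mul_H (p q : ℕ) :
    ∫ z, H p z * H q z ∂stdGaussian = if p = q then (q.factorial : ℝ) else 0 := by
  -- `H_{p+1} = (x - D) H_p`, and `x - D` is the adjoint of `D` in `L²(γ)`.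
  have step : ∀ p q : ℕ, ∫ z, H (p + 1) z * H q z ∂stdGaussian
      = ∫ z, H p z * (hermiteReal q).derivative.eval z ∂stdGaussian := by
    intro p q
    have h1 := stein_polynomial (hermiteReal p * hermiteReal q)
    have i1 := integrable_polynomial_stdGaussian
      (Polynomial.X * (hermiteReal p * hermiteReal q))
    have i2 := integrable_polynomial_stdGaussian
      ((hermiteReal p).derivative * hermiteReal q)
    have i3 := integrable_polynomial_stdGaussian
      (hermiteReal p * (hermiteReal q).derivative)
    simp only [Polynomial.eval_mul, Polynomial.eval_X, Polynomial.derivative_mul,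
      Polynomial.eval_add] at h1 i1 i2 i3
    rw [integral_add i2 i3] at h1
    simp only [H_eq_eval, hermiteReal_succ, Polynomial.eval_sub, Polynomial.eval_mul,
      Polynomial.eval_X]
    simp_rw [sub_mul, mul_assoc]
    rw [integral_sub i1 i2, h1]
    ring
  induction p generalizing q with
  | zero =>
    cases q with
    | zero => simp [H_zero]
    | succ q =>
      have := step q 0
      simp_rw [mul_comm (H (q + 1) _)] at this
      rw [this, hermiteReal_zero]
      simp
  | succ p ih =>
    rw [step]
    cases q with
    | zero => rw [hermiteReal_zero]; simp
    | succ q =>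
      rw [derivative_hermiteReal_succ]
      have : ∀ z, H p z * (Polynomial.C ((q : ℝ) + 1) * hermiteReal q).eval z
          = (q + 1) * (H p z * H q z) := fun z => by
        rw [H_eq_eval q]; simp; ring
      simp_rw [this]
      rw [integral_const_mul, ih]
      by_cases h : p = q
      · simp [h, Nat.factorial_succ]
      · simp [h]

/-! ### Completeness of the Hermite polynomials in `L²(γ)`. -/

theorem integrable_exp_abs_stdGaussian (t : ℝ) :
    Integrable (fun z => Real.exp |t * z|) stdGaussian := by
  have h1 := integrable_exp_mul_gaussianReal (μ := 0) (v := 1) t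
  have h2 := integrable_exp_mul_gaussianReal (μ := 0) (v := 1) (-t)
  refine (h1.add h2).mono' (by fun_prop) (ae_of_all _ fun z => ?_)
  simp only [Real.norm_eq_abs, Real.abs_exp, Pi.add_apply]
  rcases abs_cases (t * z) with ⟨h, -⟩ | ⟨h, -⟩ <;> rw [h]
  · have := Real.exp_pos (-t * z); linarith
  · rw [neg_mul]; have := Real.exp_pos (t * z); linarith

theorem memLp_exp_abs_stdGaussian (t : ℝ) :
    MemLp (fun z => Real.exp |t * z|) 2 stdGaussian := by
  rw [memLp_two_iff_integrable_sq (by fun_prop)]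
  refine (integrable_exp_abs_stdGaussian (2 * t)).congr (ae_of_all _ fun z => ?_)
  simp only
  rw [← Real.exp_nat_mul, mul_assoc, abs_mul]
  simp

/-- The Fourier transform of `f γ` vanishes if all the moments of `f γ` vanish. -/
theorem fourier_eq_zero_of_moments {f : ℝ → ℝ} (hf : MemLp f 2 stdGaussian)
    (h0 : ∀ n : ℕ, ∫ z, f z * z ^ n ∂stdGaussian = 0) (t : ℝ) :
    ∫ z, (f z : ℂ) * Complex.exp (t * z * Complex.I) ∂stdGaussian = 0 := by
  have hbs : ∀ z : ℝ, HasSum (fun n : ℕ => |f z| * (|t * z| ^ n / n.factorial))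
      (|f z| * Real.exp |t * z|) := fun z => by
    have := (NormedSpace.expSeries_div_hasSum_exp (𝔸 := ℝ) |t * z|).mul_left |f z|
    rwa [← Real.exp_eq_exp_ℝ] at this
  -- Termwise integration of the exponential series: the absolute series sums to `|f| exp |tz|`, a
  -- product of two functions in `L²(γ)`.
  have key := hasSum_integral_of_dominated_convergence (μ := stdGaussian)
    (F := fun (n : ℕ) (z : ℝ) => (f z : ℂ) * ((t * z * Complex.I) ^ n / n.factorial))
    (f := fun z : ℝ => (f z : ℂ) * Complex.exp (t * z * Complex.I))
    (fun (n : ℕ) (z : ℝ) => |f z| * (|t * z| ^ n / n.factorial))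
    (fun n => by
      have := hf.aestronglyMeasurable
      have h1 := Complex.continuous_ofReal.comp_aestronglyMeasurable this
      exact h1.mul (by fun_prop))
    (fun n => ae_of_all _ fun z => by simp [abs_mul])
    (ae_of_all _ fun z => (hbs z).summable)
    (by
      simp_rw [fun z => (hbs z).tsum_eq]
      exact hf.abs.integrable_mul (memLp_exp_abs_stdGaussian t))
    (ae_of_all _ fun z => by
      have := (NormedSpace.expSeries_div_hasSum_exp (𝔸 := ℂ) (t * z * Complex.I)).mul_left (f z : ℂ)
      rwa [← Complex.exp_eq_exp_ℂ] at this)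
  have hz : ∀ n : ℕ, ∫ z, (f z : ℂ) * ((t * z * Complex.I) ^ n / n.factorial) ∂stdGaussian = 0 := by
    intro n
    have : ∀ z : ℝ, (f z : ℂ) * ((t * z * Complex.I) ^ n / n.factorial)
        = ((t * Complex.I) ^ n / n.factorial) * ((f z * z ^ n : ℝ) : ℂ) := fun z => by
      push_cast; ring
    simp_rw [this]
    rw [integral_const_mul, integral_complex_ofReal, h0]
    simp
  simp_rw [hz] at key
  exact key.unique hasSum_zero

theorem charFun_withDensity_ofReal {f : ℝ → ℝ} (hf : Measurable f) (h0 : ∀ z, 0 ≤ f z) (t : ℝ) :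
    charFun (stdGaussian.withDensity fun z => ENNReal.ofReal (f z)) t
      = ∫ z, (f z : ℂ) * Complex.exp (t * z * Complex.I) ∂stdGaussian := by
  rw [charFun_apply_real, integral_withDensity_eq_integral_toReal_smul (by fun_prop)
    (ae_of_all _ fun _ => by simp)]
  congr 1; ext z
  rw [ENNReal.toReal_ofReal (h0 z)]
  simp

/-- The polynomials are total in `L²(γ)`. -/
theorem ae_eq_zero_of_moments {f : ℝ → ℝ} (hm : Measurable f) (hf : MemLp f 2 stdGaussian)
    (h0 : ∀ n : ℕ, ∫ z, f z * z ^ n ∂stdGaussian = 0) : f =ᵐ[stdGaussian] 0 := by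
  have hi : Integrable f stdGaussian := hf.integrable (by norm_num)
  have hp : Integrable (fun z => max (f z) 0) stdGaussian := hi.pos_part
  have hn : Integrable (fun z => max (-f z) 0) stdGaussian := hi.neg_part
  have hfin : ∀ {g : ℝ → ℝ}, Integrable g stdGaussian →
      ∫⁻ z, ENNReal.ofReal (g z) ∂stdGaussian ≠ ⊤ := fun hg => hg.lintegral_lt_top.ne
  have : IsFiniteMeasure (stdGaussian.withDensity fun z => ENNReal.ofReal (max (f z) 0)) :=
    isFiniteMeasure_withDensity (hfin hp)
  have : IsFiniteMeasure (stdGaussian.withDensity fun z => ENNReal.ofReal (max (-f z) 0)) :=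
    isFiniteMeasure_withDensity (hfin hn)
  have hexp : ∀ {g : ℝ → ℝ} (t : ℝ), Integrable g stdGaussian →
      Integrable (fun z : ℝ => (g z : ℂ) * Complex.exp (t * z * Complex.I)) stdGaussian := by
    intro g t hg
    refine hg.ofReal.mul_bdd (c := 1) (by fun_prop) (ae_of_all _ fun z => ?_)
    rw [show (t : ℂ) * z * Complex.I = ((t * z : ℝ) : ℂ) * Complex.I by push_cast; ring,
      Complex.norm_exp_ofReal_mul_I]
  -- The positive and the negative part of `f` define finite measures whose characteristic functions
  -- differ by the Fourier transform of `f γ`, hence agree.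
  have heq : stdGaussian.withDensity (fun z => ENNReal.ofReal (max (f z) 0))
      = stdGaussian.withDensity fun z => ENNReal.ofReal (max (-f z) 0) := by
    refine Measure.ext_of_charFun (funext fun t => ?_)
    rw [charFun_withDensity_ofReal (by fun_prop) (fun _ => le_max_right _ _),
      charFun_withDensity_ofReal (by fun_prop) (fun _ => le_max_right _ _), ← sub_eq_zero,
      ← integral_sub (hexp t hp) (hexp t hn), ← fourier_eq_zero_of_moments hf h0 t]
    congr 1; ext z
    rw [← sub_mul, ← Complex.ofReal_sub]
    congr 2
    rcases le_total (f z) 0 with h | h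
    · rw [max_eq_right h, max_eq_left (by linarith)]; ring
    · rw [max_eq_left h, max_eq_right (by linarith)]; ring
  have := (withDensity_eq_iff (by fun_prop) (by fun_prop) (hfin hp)).1 heq
  filter_upwards [this] with z hz
  simp only [Pi.zero_apply]
  rw [ENNReal.ofReal_eq_ofReal_iff (le_max_right _ _) (le_max_right _ _)] at hz
  rcases le_total (f z) 0 with h | h
  · rw [max_eq_right h, max_eq_left (by linarith)] at hz; linarith
  · rw [max_eq_left h, max_eq_right (by linarith)] at hz; linarith

/-- The system is triangular: subtracting the leading coefficient times the monic `H_n` lowers the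
degree, so strong induction on the degree applies. -/
theorem moments_eq_zero_of_hermite {f : ℝ → ℝ} (hf : MemLp f 2 stdGaussian)
    (h0 : ∀ q : ℕ, ∫ z, f z * H q z ∂stdGaussian = 0) (n : ℕ) :
    ∫ z, f z * z ^ n ∂stdGaussian = 0 := by
  have hI : ∀ p : Polynomial ℝ, Integrable (fun z => f z * p.eval z) stdGaussian := fun p =>
    hf.integrable_mul (memLp_polynomial_stdGaussian p)
  have hdeg : ∀ n : ℕ, ∀ p : Polynomial ℝ, p.natDegree < n →
      ∫ z, f z * p.eval z ∂stdGaussian = 0 := by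
    intro n
    induction n with
    | zero => intro p hp; omega
    | succ n ih =>
      intro p hp
      set c := p.coeff n with hc
      set r := p - Polynomial.C c * hermiteReal n with hr
      have hmon : (hermiteReal n).Monic := (Polynomial.hermite_monic n).map _
      have hnd : (hermiteReal n).natDegree = n := by
        rw [hermiteReal, (Polynomial.hermite_monic n).natDegree_map, Polynomial.natDegree_hermite]
      have hpe : ∀ z, f z * p.eval z = f z * r.eval z + c * (f z * H n z) := fun z => by
        rw [hr, H_eq_eval]; simp; ring
      have hHi : Integrable (fun z => f z * H n z) stdGaussian := by
        simpa only [H_eq_eval] using hI (hermiteReal n)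
      simp_rw [hpe]
      rw [integral_add (hI r) (hHi.const_mul c), integral_const_mul, h0, mul_zero, add_zero]
      have hrc : ∀ m, n ≤ m → r.coeff m = 0 := by
        intro m hm
        rw [hr, Polynomial.coeff_sub, Polynomial.coeff_C_mul]
        rcases hm.eq_or_lt with rfl | hm
        · have : (hermiteReal n).coeff n = 1 := by
            have := hmon.coeff_natDegree
            rwa [hnd] at this
          rw [this, hc]; ring
        · rw [Polynomial.coeff_eq_zero_of_natDegree_lt (by omega),
            Polynomial.coeff_eq_zero_of_natDegree_lt (by omega)]
          ring
      by_cases hr0 : r = 0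
      · simp [hr0]
      · refine ih r ?_
        by_contra hlt
        exact hr0 (Polynomial.leadingCoeff_eq_zero.1 (hrc _ (not_lt.1 hlt)))
  have := hdeg (n + 1) (Polynomial.X ^ n) (by simp)
  simpa using this

/-- The normalized Hermite polynomials as elements of `L²(γ)`. -/
def hermiteLp (q : ℕ) : Lp ℝ 2 stdGaussian :=
  (√(q.factorial : ℝ))⁻¹ • (memLp_H q).toLp (H q)

theorem inner_hermiteLp_toLp (q : ℕ) {f : ℝ → ℝ} (hf : MemLp f 2 stdGaussian) :
    inner ℝ (hermiteLp q) (hf.toLp f) = (√(q.factorial : ℝ))⁻¹ * ∫ z, f z * H q z ∂stdGaussian := by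
  rw [hermiteLp, real_inner_smul_left, L2.inner_def]
  congr 1
  refine integral_congr_ae ?_
  filter_upwards [(memLp_H q).coeFn_toLp, hf.coeFn_toLp] with z h1 h2
  rw [h1, h2]; simp

theorem orthonormal_hermiteLp : Orthonormal ℝ hermiteLp := by
  rw [orthonormal_iff_ite]
  intro p q
  conv_lhs => rw [hermiteLp.eq_1 q]
  rw [real_inner_smul_right, inner_hermiteLp_toLp, integral_H_mul_H]
  by_cases h : p = q
  · subst h
    have : √(p.factorial : ℝ) ≠ 0 := by positivity
    simp only [if_true]
    field_simp
    rw [Real.sq_sqrt (by positivity)]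
  · simp [h, Ne.symm h]

theorem span_hermiteLp : (Submodule.span ℝ (Set.range hermiteLp))ᗮ = ⊥ := by
  rw [Submodule.eq_bot_iff]
  intro f hf
  have hfL := Lp.memLp f
  have h1 : ∀ q, ∫ z, f z * H q z ∂stdGaussian = 0 := by
    intro q
    have := (Submodule.mem_orthogonal _ f).1 hf (hermiteLp q)
      (Submodule.subset_span (Set.mem_range_self q))
    conv_lhs at this => rw [← Lp.toLp_coeFn f hfL]
    rw [inner_hermiteLp_toLp] at this
    rcases mul_eq_zero.1 this with h | h
    · exact absurd h (by positivity)
    · exact h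
  have := ae_eq_zero_of_moments (Lp.stronglyMeasurable f).measurable hfL
    (moments_eq_zero_of_hermite hfL h1)
  exact (Lp.eq_zero_iff_ae_eq_zero).2 this

/-- The Hermite basis of `L²(γ)`. -/
def hermiteBasis : HilbertBasis ℕ ℝ (Lp ℝ 2 stdGaussian) :=
  HilbertBasis.mkOfOrthogonalEqBot orthonormal_hermiteLp span_hermiteLp

/-! ### Mehler's formula. -/

/-- `u Z₁ + s Z₂` is standard Gaussian if `u² + s² = 1`. -/
theorem measurePreserving_rotation {u s : ℝ} (h : u ^ 2 + s ^ 2 = 1) :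
    MeasurePreserving (fun p : ℝ × ℝ => u * p.1 + s * p.2)
      (stdGaussian.prod stdGaussian) stdGaussian := by
  refine ⟨by fun_prop, ?_⟩
  have h1 := gaussianReal_conv_gaussianReal (m₁ := u * 0) (m₂ := s * 0)
    (v₁ := NNReal.mk (u ^ 2) (sq_nonneg _) * 1) (v₂ := NNReal.mk (s ^ 2) (sq_nonneg _) * 1)
  rw [← gaussianReal_map_const_mul, ← gaussianReal_map_const_mul, Measure.conv,
    Measure.map_prod_map _ _ (by fun_prop) (by fun_prop), Measure.map_map (by fun_prop)
    (by fun_prop)] at h1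
  refine Eq.trans (by rfl) (h1.trans ?_)
  congr 1
  · ring
  · ext; simpa using h

theorem rotation_sq {u : ℝ} (hu : u ∈ Icc (-1 : ℝ) 1) : u ^ 2 + √(1 - u ^ 2) ^ 2 = 1 := by
  rw [Real.sq_sqrt (by nlinarith [hu.1, hu.2])]; ring

/-- Mehler's formula: the Hermite expansion of the kernel. -/
theorem hasSum_mehler {f : ℝ → ℝ} (hf : MemLp f 2 stdGaussian) {u : ℝ} (hu : u ∈ Icc (-1 : ℝ) 1) :
    HasSum (fun q : ℕ => (q.factorial : ℝ) * hermiteCoeff f q ^ 2 * u ^ q)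
      (∫ p : ℝ × ℝ, f p.1 * f (u * p.1 + √(1 - u ^ 2) * p.2) ∂(stdGaussian.prod stdGaussian)) := by
  have hR := measurePreserving_rotation (rotation_sq hu)
  have hF : MeasurePreserving (Prod.fst : ℝ × ℝ → ℝ) (stdGaussian.prod stdGaussian) stdGaussian :=
    measurePreserving_fst
  set s := √(1 - u ^ 2) with hs
  let A := (Lp.compMeasurePreservingₗᵢ ℝ (E := ℝ) (p := 2) _ hF)
  let C := (Lp.compMeasurePreservingₗᵢ ℝ (E := ℝ) (p := 2) _ hR)
  have hA : ∀ {g : ℝ → ℝ} (hg : MemLp g 2 stdGaussian),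
      A (hg.toLp g) = (hg.comp_measurePreserving hF).toLp _ := fun hg =>
    Lp.toLp_compMeasurePreserving hg hF
  have hC : ∀ {g : ℝ → ℝ} (hg : MemLp g 2 stdGaussian),
      C (hg.toLp g) = (hg.comp_measurePreserving hR).toLp _ := fun hg =>
    Lp.toLp_compMeasurePreserving hg hR
  have hinner : ∀ {g k : ℝ → ℝ} (hg : MemLp g 2 stdGaussian) (hk : MemLp k 2 stdGaussian),
      inner ℝ (A (hg.toLp g)) (C (hk.toLp k))
        = ∫ p : ℝ × ℝ, g p.1 * k (u * p.1 + s * p.2) ∂(stdGaussian.prod stdGaussian) := by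
    intro g k hg hk
    rw [hA, hC, L2.inner_def]
    refine integral_congr_ae ?_
    filter_upwards [(hg.comp_measurePreserving hF).coeFn_toLp,
      (hk.comp_measurePreserving hR).coeFn_toLp] with z h1 h2
    rw [h1, h2]; simp [mul_comm]
  -- Only the second factor is expanded: the series of `f` is mapped by the continuous functional `g
  -- ↦ E[f(Z₁) g(u Z₁ + s Z₂)]`.
  have hsum := (hermiteBasis.hasSum_repr (hf.toLp f)).mapL
    ((innerSL ℝ (A (hf.toLp f))).comp C.toContinuousLinearMap)
  rw [← hinner hf hf]
  refine hsum.congr_fun fun q => ?_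
  have hfH : Integrable (fun p : ℝ × ℝ => f p.1 * H q (u * p.1 + s * p.2))
      (stdGaussian.prod stdGaussian) :=
    (hf.comp_measurePreserving hF).integrable_mul ((memLp_H q).comp_measurePreserving hR)
  have h1 : inner ℝ (A (hf.toLp f)) (C (hermiteLp q))
      = (√(q.factorial : ℝ))⁻¹ * (u ^ q * ∫ z, f z * H q z ∂stdGaussian) := by
    rw [hermiteLp, map_smul, real_inner_smul_right, hinner, integral_prod _ hfH]
    have h4 : ∀ x, ∫ y, f (x, y).1 * H q (u * (x, y).1 + s * (x, y).2) ∂stdGaussian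
        = f x * (u ^ q * H q x) := fun x => by
      rw [← integral_H_affine (rotation_sq hu), ← integral_const_mul]
    simp_rw [h4]
    rw [← integral_const_mul (u ^ q)]
    congr 2; ext z; ring
  have h2 : (hermiteBasis.repr (hf.toLp f)) q
      = (√(q.factorial : ℝ))⁻¹ * ∫ z, f z * H q z ∂stdGaussian := by
    rw [HilbertBasis.repr_apply_apply, hermiteBasis, HilbertBasis.coe_mkOfOrthogonalEqBot,
      inner_hermiteLp_toLp]
  have h3 : hermiteBasis q = hermiteLp q := by
    rw [hermiteBasis, HilbertBasis.coe_mkOfOrthogonalEqBot]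
  rw [map_smul, h2, h3]
  change _ = _ * inner ℝ (A (hf.toLp f)) (C (hermiteLp q))
  rw [h1, hermiteCoeff]
  have hpos : (0 : ℝ) < q.factorial := by positivity
  have : (√(q.factorial : ℝ))⁻¹ * (√(q.factorial : ℝ))⁻¹ = (q.factorial : ℝ)⁻¹ := by
    rw [← mul_inv, Real.mul_self_sqrt hpos.le]
  generalize ∫ z, f z * H q z ∂stdGaussian = I
  calc _ = ((q.factorial : ℝ) * (q.factorial : ℝ)⁻¹) * (q.factorial : ℝ)⁻¹ * I ^ 2 * u ^ q := by ring
    _ = (q.factorial : ℝ)⁻¹ * I ^ 2 * u ^ q := by rw [mul_inv_cancel₀ hpos.ne']; ring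
    _ = _ := by rw [← this]; ring

/-! ### Kernels as probability generating functions. -/

/-- `κ` is on `[-1, 1]` the generating function of the probability weights `p`,
which have a finite mean. -/
structure IsPGF (κ : ℝ → ℝ) (p : ℕ → ℝ) : Prop where
  nonneg : ∀ q, 0 ≤ p q
  hasSum_one : HasSum p 1
  summable_mean : Summable fun q : ℕ => (q : ℝ) * p q
  hasSum : ∀ u ∈ Icc (-1 : ℝ) 1, HasSum (fun q => p q * u ^ q) (κ u)

/-- Mehler's formula writes the kernel as a power series with nonnegative coefficients. Dividing by
`E[σ(Z)²]` gives total mass `1`, and the finite mean is the summability hypothesis on `σ`. -/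
theorem IsActivation.isPGF {σ : ℝ → ℝ} (hσ : IsActivation σ) :
    IsPGF (kernel σ)
      (fun q => (∫ z, σ z ^ 2 ∂stdGaussian)⁻¹ * ((q.factorial : ℝ) * hermiteCoeff σ q ^ 2)) := by
  have hnn : 0 ≤ ∫ z, σ z ^ 2 ∂stdGaussian := integral_nonneg fun z => sq_nonneg _
  have hsum : ∀ u ∈ Icc (-1 : ℝ) 1, HasSum (fun q : ℕ => (∫ z, σ z ^ 2 ∂stdGaussian)⁻¹ *
      ((q.factorial : ℝ) * hermiteCoeff σ q ^ 2) * u ^ q) (kernel σ u) := fun u hu => by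
    have := (hasSum_mehler hσ.memLp hu).mul_left (∫ z, σ z ^ 2 ∂stdGaussian)⁻¹
    exact this.congr_fun fun q => by ring
  refine ⟨fun q => by positivity, ?_, ?_, hsum⟩
  · have h1 := hsum 1 (by norm_num)
    have : kernel σ 1 = 1 := by
      have hF : MeasurePreserving (Prod.fst : ℝ × ℝ → ℝ) (stdGaussian.prod stdGaussian)
        stdGaussian := measurePreserving_fst
      have hsq := (hσ.memLp.integrable_sq).aestronglyMeasurable
      have e := integral_map (μ := stdGaussian.prod stdGaussian) (φ := Prod.fst)
        hF.measurable.aemeasurable (f := fun z => σ z ^ 2) (by rwa [hF.map_eq])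
      rw [hF.map_eq] at e
      have e2 : ∫ p : ℝ × ℝ, σ p.1 * σ (1 * p.1 + √(1 - 1 ^ 2) * p.2)
          ∂(stdGaussian.prod stdGaussian) = ∫ z, σ z ^ 2 ∂stdGaussian := by
        rw [e]
        congr 1; ext p; simp [sq]
      rw [kernel, e2, inv_mul_cancel₀ hσ.ne_zero]
    rw [this] at h1
    simpa using h1
  · refine (hσ.summable.mul_left (∫ z, σ z ^ 2 ∂stdGaussian)⁻¹).congr fun q => ?_
    ring

/-- The hypothesis forces `|a| ≤ c`, so `a^{q+1} - b^{q+1} = a (a^q - b^q) + b^q (a - b)` can be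
bounded term by term. Summed against nonnegative weights, this compares a kernel at arguments of
either sign with its values on `[0, 1]`. -/
theorem abs_pow_sub_pow_le {a b c : ℝ} (hb : 0 ≤ b) (h : |a - b| ≤ c - b) (q : ℕ) :
    |a ^ q - b ^ q| ≤ c ^ q - b ^ q := by
  have hbc : b ≤ c := by linarith [abs_nonneg (a - b)]
  have ha : |a| ≤ c := by
    rw [abs_le] at h ⊢; constructor <;> linarith
  have hc : 0 ≤ c := hb.trans hbc
  induction q with
  | zero => simp
  | succ q ih =>
    have e : a ^ (q + 1) - b ^ (q + 1) = a * (a ^ q - b ^ q) + b ^ q * (a - b) := by ring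
    rw [e]
    calc _ ≤ |a| * |a ^ q - b ^ q| + b ^ q * |a - b| := by
          refine (abs_add_le _ _).trans ?_
          rw [abs_mul, abs_mul, abs_of_nonneg (pow_nonneg hb q)]
      _ ≤ c * (c ^ q - b ^ q) + b ^ q * (c - b) := by
          gcongr
      _ = _ := by ring

/-- The second order Taylor remainder of `u ^ q` at `b`, cleared of denominators. -/
theorem pow_taylor_two_le {r b u : ℝ} (hr : 0 ≤ r) (hb : |b| ≤ r) (hu : |u| ≤ r) (q : ℕ) :
    |u ^ q - b ^ q - q * b ^ (q - 1) * (u - b)| * r ^ 2 ≤ q ^ 2 * r ^ q * (u - b) ^ 2 := by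
  induction q with
  | zero => simp
  | succ q ih =>
    have e : u ^ (q + 1) - b ^ (q + 1) - ((q + 1 : ℕ) : ℝ) * b ^ (q + 1 - 1) * (u - b)
        = u * (u ^ q - b ^ q - q * b ^ (q - 1) * (u - b)) + q * b ^ (q - 1) * (u - b) ^ 2 := by
      cases q with
      | zero => simp
      | succ q => simp only [Nat.add_sub_cancel]; push_cast; ring
    have h1 : (q : ℝ) * |b| ^ (q - 1) * r ^ 2 ≤ q * r ^ (q + 1) := by
      cases q with
      | zero => simp
      | succ q =>
        simp only [Nat.add_sub_cancel]
        rw [mul_assoc]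
        gcongr
        calc |b| ^ q * r ^ 2 ≤ r ^ q * r ^ 2 := by gcongr
          _ = r ^ (q + 1 + 1) := by ring
    rw [e]
    calc _ ≤ (|u| * |u ^ q - b ^ q - q * b ^ (q - 1) * (u - b)|
            + q * |b| ^ (q - 1) * (u - b) ^ 2) * r ^ 2 := by
          gcongr
          refine (abs_add_le _ _).trans (le_of_eq ?_)
          rw [abs_mul, abs_mul, abs_mul, abs_pow, abs_pow, sq_abs, Nat.abs_cast]
      _ = |u| * (|u ^ q - b ^ q - q * b ^ (q - 1) * (u - b)| * r ^ 2)
            + (q * |b| ^ (q - 1) * r ^ 2) * (u - b) ^ 2 := by ring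
      _ ≤ r * (q ^ 2 * r ^ q * (u - b) ^ 2) + q * r ^ (q + 1) * (u - b) ^ 2 := by
          gcongr
      _ = ((q : ℝ) ^ 2 + q) * (r ^ (q + 1) * (u - b) ^ 2) := by ring
      _ ≤ ((q + 1 : ℕ) : ℝ) ^ 2 * (r ^ (q + 1) * (u - b) ^ 2) := by
          gcongr
          push_cast; nlinarith [(Nat.cast_nonneg q : (0 : ℝ) ≤ q)]
      _ = _ := by ring

theorem tangent_le_pow {b u : ℝ} (hb : 0 ≤ b) (hu : 0 ≤ u) (q : ℕ) :
    q * b ^ (q - 1) * (u - b) ≤ u ^ q - b ^ q := by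
  induction q with
  | zero => simp
  | succ q ih =>
    have e : u ^ (q + 1) - b ^ (q + 1) - ((q + 1 : ℕ) : ℝ) * b ^ (q + 1 - 1) * (u - b)
        = u * (u ^ q - b ^ q - q * b ^ (q - 1) * (u - b)) + q * b ^ (q - 1) * (u - b) ^ 2 := by
      cases q with
      | zero => simp
      | succ q => simp only [Nat.add_sub_cancel]; push_cast; ring
    have h1 : 0 ≤ u * (u ^ q - b ^ q - q * b ^ (q - 1) * (u - b)) :=
      mul_nonneg hu (by linarith)
    have h2 : 0 ≤ (q : ℝ) * b ^ (q - 1) * (u - b) ^ 2 := by positivity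
    linarith

namespace IsPGF

variable {κ : ℝ → ℝ} {p : ℕ → ℝ}

theorem map_one (h : IsPGF κ p) : κ 1 = 1 := by
  have := h.hasSum 1 (by norm_num)
  simp only [one_pow, mul_one] at this
  exact this.unique h.hasSum_one

/-- The monomial inequality survives summation with nonnegative weights. As the conclusion has the
form of the hypothesis, the estimate can be iterated. -/
theorem increment (h : IsPGF κ p) {a b c : ℝ} (hb : 0 ≤ b) (hc : c ≤ 1) (hab : |a - b| ≤ c - b) :
    |κ a - κ b| ≤ κ c - κ b := by
  have hbc : b ≤ c := by linarith [abs_nonneg (a - b)]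
  have ha : a ∈ Icc (-1 : ℝ) 1 := by
    rw [abs_le] at hab; constructor <;> linarith
  have h1 := (h.hasSum a ha).sub (h.hasSum b ⟨by linarith, by linarith⟩)
  have h2 := (h.hasSum c ⟨by linarith, hc⟩).sub (h.hasSum b ⟨by linarith, by linarith⟩)
  have hq : ∀ q, |p q * a ^ q - p q * b ^ q| ≤ p q * c ^ q - p q * b ^ q := fun q => by
    rw [← mul_sub, ← mul_sub, abs_mul, abs_of_nonneg (h.nonneg q)]
    exact mul_le_mul_of_nonneg_left (abs_pow_sub_pow_le hb hab q) (h.nonneg q)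
  rw [abs_le]
  constructor
  · have := hasSum_le (fun q => (abs_le.1 (hq q)).1) h2.neg h1
    linarith
  · exact hasSum_le (fun q => (abs_le.1 (hq q)).2) h1 h2

theorem map_nonneg (h : IsPGF κ p) {u : ℝ} (hu : u ∈ Icc (0 : ℝ) 1) : 0 ≤ κ u :=
  (h.hasSum u ⟨by linarith [hu.1], hu.2⟩).nonneg fun q =>
    mul_nonneg (h.nonneg q) (pow_nonneg hu.1 q)

theorem monotoneOn (h : IsPGF κ p) : MonotoneOn κ (Icc 0 1) := fun x hx y hy hxy => by
  have := h.increment (a := y) (b := x) (c := y) hx.1 hy.2 (by rw [abs_of_nonneg (by linarith)])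
  linarith [abs_nonneg (κ y - κ x)]

theorem abs_map_le (h : IsPGF κ p) {u : ℝ} (hu : u ∈ Icc (-1 : ℝ) 1) : |κ u| ≤ κ |u| := by
  have habs : |u| ≤ 1 := abs_le.2 hu
  have h0 := h.map_nonneg (u := 0) (by norm_num)
  have := h.increment (a := u) (b := 0) (c := |u|) le_rfl habs (by simp)
  calc |κ u| = |(κ u - κ 0) + κ 0| := by ring_nf
    _ ≤ |κ u - κ 0| + |κ 0| := abs_add_le _ _
    _ ≤ _ := by rw [abs_of_nonneg h0]; linarith

theorem mapsTo_nonneg (h : IsPGF κ p) : MapsTo κ (Icc 0 1) (Icc 0 1) := fun u hu =>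
  ⟨h.map_nonneg hu, h.map_one ▸ h.monotoneOn hu (by norm_num) hu.2⟩

theorem mapsTo (h : IsPGF κ p) : MapsTo κ (Icc (-1) 1) (Icc (-1) 1) := fun u hu => by
  have := (h.abs_map_le hu).trans (h.mapsTo_nonneg ⟨abs_nonneg u, abs_le.2 hu⟩).2
  exact abs_le.1 this

theorem continuousOn (h : IsPGF κ p) : ContinuousOn κ (Icc (-1) 1) := by
  have : ContinuousOn (fun u => ∑' q, p q * u ^ q) (Icc (-1 : ℝ) 1) := by
    refine continuousOn_tsum (u := p) (fun q => by fun_prop) h.hasSum_one.summable ?_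
    intro q u hu
    rw [norm_mul, norm_pow, Real.norm_of_nonneg (h.nonneg q)]
    exact mul_le_of_le_one_right (h.nonneg q) (pow_le_one₀ (norm_nonneg _) (abs_le.2 hu))
  exact this.congr fun u hu => ((h.hasSum u hu).tsum_eq).symm

theorem iterate_mem (h : IsPGF κ p) {u : ℝ} (hu : u ∈ Icc (-1 : ℝ) 1) (L : ℕ) :
    κ^[L] u ∈ Icc (-1 : ℝ) 1 := h.mapsTo.iterate L hu

theorem iterate_mem_nonneg (h : IsPGF κ p) {u : ℝ} (hu : u ∈ Icc (0 : ℝ) 1) (L : ℕ) :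
    κ^[L] u ∈ Icc (0 : ℝ) 1 := h.mapsTo_nonneg.iterate L hu

theorem iterate_continuousOn (h : IsPGF κ p) (L : ℕ) : ContinuousOn κ^[L] (Icc (-1) 1) :=
  h.continuousOn.iterate h.mapsTo L

theorem iterate_monotoneOn (h : IsPGF κ p) (L : ℕ) : MonotoneOn κ^[L] (Icc 0 1) := by
  induction L with
  | zero => exact fun x _ y _ hxy => hxy
  | succ L ih =>
    intro x hx y hy hxy
    rw [Function.iterate_succ_apply', Function.iterate_succ_apply']
    exact h.monotoneOn (h.iterate_mem_nonneg hx L) (h.iterate_mem_nonneg hy L) (ih hx hy hxy)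

/-- The iterates inherit the domination of increments at `0`. -/
theorem iterate_increment (h : IsPGF κ p) {u : ℝ} (hu : u ∈ Icc (-1 : ℝ) 1) (L : ℕ) :
    |κ^[L] u - κ^[L] 0| ≤ κ^[L] |u| - κ^[L] 0 := by
  induction L with
  | zero => simp
  | succ L ih =>
    simp only [Function.iterate_succ_apply']
    exact h.increment (h.iterate_mem_nonneg (by norm_num) L).1
      (h.iterate_mem_nonneg ⟨abs_nonneg u, abs_le.2 hu⟩ L).2 ih

/-- The mean of the weights is the one-sided derivative at `1`. -/
theorem D_one (h : IsPGF κ p) : D κ 1 = ∑' q : ℕ, q * p q := by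
  -- The series is the difference quotient of `κ` at `1`. Its terms are bounded by `q p_q`, so the
  -- finite mean permits the limit inside the sum.
  have key : Tendsto (fun u => ∑' q, p q * ∑ i ∈ Finset.range q, u ^ i)
      (𝓝[Icc (-1 : ℝ) 1 \ {1}] 1) (𝓝 (∑' q : ℕ, p q * q)) := by
    refine tendsto_tsum_of_dominated_convergence (bound := fun q : ℕ => q * p q)
      h.summable_mean (fun q => ?_) ?_
    · refine Tendsto.mono_left ?_ nhdsWithin_le_nhds
      have : Continuous fun u : ℝ => p q * ∑ i ∈ Finset.range q, u ^ i := by fun_prop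
      simpa using this.tendsto 1
    · filter_upwards [self_mem_nhdsWithin] with u hu q
      rw [norm_mul, Real.norm_of_nonneg (h.nonneg q), mul_comm]
      refine mul_le_mul_of_nonneg_right ?_ (h.nonneg q)
      refine (norm_sum_le _ _).trans ?_
      refine (Finset.sum_le_card_nsmul _ _ 1 fun i _ => ?_).trans (by simp)
      rw [norm_pow]
      exact pow_le_one₀ (norm_nonneg _) (abs_le.2 hu.1)
  have hder : HasDerivWithinAt κ (∑' q : ℕ, p q * q) (Icc (-1) 1) 1 := by
    rw [hasDerivWithinAt_iff_tendsto_slope]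
    refine key.congr' ?_
    filter_upwards [self_mem_nhdsWithin] with u hu
    have hne : u - 1 ≠ 0 := sub_ne_zero.2 hu.2
    have h1 := ((h.hasSum u hu.1).sub (h.hasSum 1 (by norm_num))).div_const (u - 1)
    rw [slope_def_field, ← h1.tsum_eq]
    refine tsum_congr fun q => ?_
    rw [eq_div_iff hne, mul_assoc, geom_sum_mul]
    simp; ring
  rw [D, hder.derivWithin (uniqueDiffOn_Icc (by norm_num) 1 (by norm_num))]
  simp_rw [mul_comm]

/-- The second order Taylor remainder of `u ^ q` on `[-r, r]` is at most `q² r^{q-2} (u - b)²`,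
which is summable because `r < 1` and `p_q ≤ 1`. -/
theorem quadratic (h : IsPGF κ p) {r b : ℝ} (hr0 : 0 < r) (hr : r < 1) (hb : |b| ≤ r) :
    ∃ C, 0 ≤ C ∧ ∀ u, |u| ≤ r →
      |κ u - κ b - (∑' q : ℕ, p q * (q * b ^ (q - 1))) * (u - b)| ≤ C * (u - b) ^ 2 := by
  have hsq : Summable fun q : ℕ => (q : ℝ) ^ 2 * r ^ q :=
    summable_pow_mul_geometric_of_norm_lt_one 2 (by rwa [Real.norm_of_nonneg hr0.le])
  have hp1 : ∀ q, p q ≤ 1 := fun q => le_hasSum h.hasSum_one q fun j _ => h.nonneg j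
  have hsq' : Summable fun q : ℕ => p q * (q ^ 2 * r ^ q / r ^ 2) := by
    refine Summable.of_nonneg_of_le (fun q => ?_) (fun q => ?_) (hsq.div_const (r ^ 2))
    · have := h.nonneg q; positivity
    · exact mul_le_of_le_one_left (by positivity) (hp1 q)
  have hd : Summable fun q : ℕ => p q * (q * b ^ (q - 1)) := by
    refine Summable.of_norm_bounded h.summable_mean fun q => ?_
    rw [norm_mul, norm_mul, norm_pow, Real.norm_of_nonneg (h.nonneg q), Real.norm_natCast]
    have : ‖b‖ ^ (q - 1) ≤ 1 := pow_le_one₀ (norm_nonneg _) (hb.trans hr.le)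
    have h1 := mul_nonneg (h.nonneg q) (Nat.cast_nonneg (α := ℝ) q)
    nlinarith
  refine ⟨∑' q : ℕ, p q * (q ^ 2 * r ^ q / r ^ 2), tsum_nonneg fun q => ?_, fun u hu => ?_⟩
  · have := h.nonneg q; positivity
  have h1 := ((h.hasSum u (abs_le.1 (hu.trans hr.le))).sub
    (h.hasSum b (abs_le.1 (hb.trans hr.le)))).sub (hd.hasSum.mul_right (u - b))
  rw [← h1.tsum_eq, ← tsum_mul_right, ← Real.norm_eq_abs]
  refine tsum_of_norm_bounded (hsq'.mul_right _).hasSum fun q => ?_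
  have e : p q * u ^ q - p q * b ^ q - p q * (q * b ^ (q - 1)) * (u - b)
      = p q * (u ^ q - b ^ q - q * b ^ (q - 1) * (u - b)) := by ring
  rw [e, norm_mul, Real.norm_of_nonneg (h.nonneg q), mul_assoc (p q) _ ((u - b) ^ 2)]
  refine mul_le_mul_of_nonneg_left ?_ (h.nonneg q)
  rw [div_mul_eq_mul_div, le_div_iff₀ (by positivity)]
  exact pow_taylor_two_le hr0.le hb hu q

theorem D_eq (h : IsPGF κ p) {b : ℝ} (hb : |b| < 1) :
    D κ b = ∑' q : ℕ, p q * (q * b ^ (q - 1)) := by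
  obtain ⟨r, hbr, hr⟩ := exists_between hb
  obtain ⟨C, -, hC⟩ := h.quadratic ((abs_nonneg b).trans_lt hbr) hr hbr.le
  have hder : HasDerivAt κ (∑' q : ℕ, p q * (q * b ^ (q - 1))) b := by
    rw [hasDerivAt_iff_isLittleO]
    have hO : (fun u => κ u - κ b - (u - b) • ∑' q : ℕ, p q * (q * b ^ (q - 1)))
        =O[𝓝 b] fun u => (u - b) ^ 2 := by
      refine IsBigO.of_bound C ?_
      have : ∀ᶠ u in 𝓝 b, |u| < r := (continuous_abs.tendsto b).eventually_lt_const hbr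
      filter_upwards [this] with u hu
      rw [smul_eq_mul, mul_comm (u - b), Real.norm_eq_abs, Real.norm_of_nonneg (sq_nonneg _)]
      exact hC u hu.le
    refine hO.trans_isLittleO ?_
    have hs : (fun u : ℝ => u - b) =o[𝓝 b] fun _ => (1 : ℝ) := by
      rw [isLittleO_one_iff]
      have : Continuous fun u : ℝ => u - b := by fun_prop
      simpa using this.tendsto b
    simpa [sq] using hs.mul_isBigO (isBigO_refl (fun u : ℝ => u - b) (𝓝 b))
  have hb' := abs_lt.1 hb
  exact (hder.hasDerivWithinAt).derivWithin
    (uniqueDiffOn_Icc (by norm_num) b ⟨hb'.1.le, hb'.2.le⟩)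

/-- The graph lies above its tangents. -/
theorem tangent_le (h : IsPGF κ p) {b u : ℝ} (hb : b ∈ Ico (0 : ℝ) 1) (hu : u ∈ Icc (0 : ℝ) 1) :
    D κ b * (u - b) ≤ κ u - κ b := by
  have hd : Summable fun q : ℕ => p q * (q * b ^ (q - 1)) := by
    refine Summable.of_norm_bounded h.summable_mean fun q => ?_
    rw [norm_mul, norm_mul, norm_pow, Real.norm_of_nonneg (h.nonneg q), Real.norm_natCast]
    have : ‖b‖ ^ (q - 1) ≤ 1 :=
      pow_le_one₀ (norm_nonneg _) (by rw [Real.norm_of_nonneg hb.1]; exact hb.2.le)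
    have h1 := mul_nonneg (h.nonneg q) (Nat.cast_nonneg (α := ℝ) q)
    nlinarith
  rw [h.D_eq (by rw [abs_of_nonneg hb.1]; exact hb.2)]
  refine hasSum_le (fun q => ?_) (hd.hasSum.mul_right (u - b))
    ((h.hasSum u ⟨by linarith [hu.1], hu.2⟩).sub (h.hasSum b ⟨by linarith [hb.1], hb.2.le⟩))
  have := mul_le_mul_of_nonneg_left (tangent_le_pow hb.1 hu.1 q) (h.nonneg q)
  linarith

theorem tangent_one_le (h : IsPGF κ p) {u : ℝ} (hu : u ∈ Icc (0 : ℝ) 1) :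
    1 - κ u ≤ D κ 1 * (1 - u) := by
  rw [h.D_one]
  refine hasSum_le (fun q => ?_) (h.hasSum_one.sub (h.hasSum u ⟨by linarith [hu.1], hu.2⟩))
    (h.summable_mean.hasSum.mul_right (1 - u))
  have := mul_le_mul_of_nonneg_left (tangent_le_pow zero_le_one hu.1 q) (h.nonneg q)
  simp only [one_pow, mul_one] at this
  linarith

theorem D_nonneg (h : IsPGF κ p) {b : ℝ} (hb : b ∈ Ico (0 : ℝ) 1) : 0 ≤ D κ b := by
  rw [h.D_eq (by rw [abs_of_nonneg hb.1]; exact hb.2)]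
  exact tsum_nonneg fun q => mul_nonneg (h.nonneg q) (by have := hb.1; positivity)

/-- The kernel is not affine. -/
def NonAffine (p : ℕ → ℝ) : Prop := ∃ q, 2 ≤ q ∧ 0 < p q

/-- Only the weights `p 0` and `p 1` can be nonzero. This degenerate case is what each regime has to
exclude before strict convexity becomes available. -/
theorem affine_of_not (h : IsPGF κ p) (hp : ¬ NonAffine p) :
    D κ 1 = p 1 ∧ p 0 + p 1 = 1 ∧ ∀ u ∈ Icc (-1 : ℝ) 1, κ u = p 0 + p 1 * u := by
  have hz : ∀ q, q ∉ Finset.range 2 → p q = 0 := fun q hq => by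
    by_contra hne
    exact hp ⟨q, by simp at hq; omega, lt_of_le_of_ne (h.nonneg q) (Ne.symm hne)⟩
  refine ⟨?_, ?_, fun u hu => ?_⟩
  · rw [h.D_one, tsum_eq_sum (s := Finset.range 2) fun q hq => by rw [hz q hq, mul_zero]]
    simp [Finset.sum_range_succ]
  · have := h.hasSum_one.unique (hasSum_sum_of_ne_finset_zero (s := Finset.range 2) hz)
    rw [this]; simp [Finset.sum_range_succ]
  · have := (h.hasSum u hu).unique (hasSum_sum_of_ne_finset_zero (s := Finset.range 2)
      fun q hq => by rw [hz q hq, zero_mul])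
    rw [this]; simp [Finset.sum_range_succ]

theorem nonAffine_of_one_lt (h : IsPGF κ p) (h1 : 1 < D κ 1) : NonAffine p := by
  by_contra hp
  obtain ⟨e1, e2, -⟩ := h.affine_of_not hp
  linarith [h.nonneg 0]

/-- All monomials are convex on `[0, 1]`, and the one of degree at least `2` with positive weight is
strictly convex. -/
theorem strictConvexOn (h : IsPGF κ p) (hp : NonAffine p) : StrictConvexOn ℝ (Icc 0 1) κ := by
  obtain ⟨n, hn, hpn⟩ := hp
  refine ⟨convex_Icc 0 1, fun x hx y hy hxy a b ha hb hab => ?_⟩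
  simp only [smul_eq_mul]
  have hz : a * x + b * y ∈ Icc (0 : ℝ) 1 := by
    have := convex_Icc (0 : ℝ) 1 hx hy ha.le hb.le hab
    simpa using this
  have hsub : ∀ {u : ℝ}, u ∈ Icc (0 : ℝ) 1 → u ∈ Icc (-1 : ℝ) 1 := fun hu =>
    ⟨by linarith [hu.1], hu.2⟩
  refine hasSum_lt (i := n) (fun q => ?_) ?_ (h.hasSum _ (hsub hz))
    (((h.hasSum x (hsub hx)).mul_left a).add ((h.hasSum y (hsub hy)).mul_left b))
  · have := (convexOn_pow (𝕜 := ℝ) q).2 (x := x) hx.1 (y := y) hy.1 ha.le hb.le hab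
    simp only [smul_eq_mul] at this
    nlinarith [h.nonneg q]
  · have := (strictConvexOn_pow hn).2 (x := x) hx.1 (y := y) hy.1 hxy ha hb hab
    simp only [smul_eq_mul] at this
    nlinarith

/-- Strict inequality between the graph and the chord that ends at `(1, 1)`. -/
theorem chord_lt (h : IsPGF κ p) (hp : NonAffine p) {x u : ℝ} (hx : 0 ≤ x) (hxu : x < u)
    (hu : u < 1) : κ u * (1 - x) < κ x * (1 - u) + (u - x) := by
  have h1 : 0 < 1 - x := by linarith
  have hx' : x ∈ Icc (0 : ℝ) 1 := ⟨hx, by linarith⟩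
  have hab : (1 - u) / (1 - x) + (u - x) / (1 - x) = 1 := by field_simp; ring
  have := (h.strictConvexOn hp).2 hx' (right_mem_Icc.2 zero_le_one) (by linarith)
    (div_pos (by linarith) h1) (div_pos (by linarith) h1) hab
  simp only [smul_eq_mul, h.map_one] at this
  have e : (1 - u) / (1 - x) * x + (u - x) / (1 - x) * 1 = u := by field_simp; ring
  rw [e] at this
  calc κ u * (1 - x) < ((1 - u) / (1 - x) * κ x + (u - x) / (1 - x) * 1) * (1 - x) := by gcongr
    _ = _ := by field_simp

/-- Outside of the degenerate case `κ = 1`, the interval `(-1, 1)` is mapped to itself. -/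
theorem abs_lt_one (h : IsPGF κ p) (hD : D κ 1 ≠ 0) {u : ℝ} (hu : |u| < 1) : |κ u| < 1 := by
  refine (h.abs_map_le (abs_le.1 hu.le)).trans_lt ?_
  have hex : ∃ q, 1 ≤ q ∧ 0 < p q := by
    by_contra hno
    push Not at hno
    refine hD ?_
    rw [h.D_one]
    refine (tsum_congr fun q => ?_).trans tsum_zero
    cases q with
    | zero => simp
    | succ q => rw [le_antisymm (hno (q + 1) (by omega)) (h.nonneg _), mul_zero]
  obtain ⟨q, hq, hpq⟩ := hex
  refine hasSum_lt (i := q) (fun j => ?_) ?_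
    (h.hasSum |u| ⟨by linarith [abs_nonneg u], hu.le⟩) h.hasSum_one
  · exact mul_le_of_le_one_right (h.nonneg j) (pow_le_one₀ (abs_nonneg u) hu.le)
  · exact mul_lt_of_lt_one_right hpq (pow_lt_one₀ (abs_nonneg u) hu (by omega))

theorem iterate_abs_lt_one (h : IsPGF κ p) (hD : D κ 1 ≠ 0) {u : ℝ} (hu : |u| < 1) (L : ℕ) :
    |κ^[L] u| < 1 := by
  induction L with
  | zero => exact hu
  | succ L ih => rw [Function.iterate_succ_apply']; exact h.abs_lt_one hD ih

/-- A kernel that is not odd is bounded away from `-1`. -/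
theorem neg_le_of_not_odd (h : IsPGF κ p) (hodd : ¬ ∀ u ∈ Icc (-1 : ℝ) 1, κ (-u) = -κ u) :
    ∃ k, 0 ≤ k ∧ k < 1 ∧ ∀ u ∈ Icc (-1 : ℝ) 1, -k ≤ κ u := by
  have hex : ∃ q, Even q ∧ 0 < p q := by
    by_contra hno
    push Not at hno
    refine hodd fun u hu => ?_
    refine (h.hasSum (-u) ⟨by linarith [hu.2], by linarith [hu.1]⟩).unique
      ((h.hasSum u hu).neg.congr_fun fun q => ?_)
    rcases Nat.even_or_odd q with he | ho
    · rw [le_antisymm (hno q he) (h.nonneg q)]; simp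
    · rw [ho.neg_pow]; ring
  obtain ⟨q, hq, hpq⟩ := hex
  have hp1 : p q ≤ 1 := le_hasSum h.hasSum_one q fun j _ => h.nonneg j
  refine ⟨1 - p q, by linarith, by linarith, fun u hu => ?_⟩
  -- All terms of `κ(u) + 1 = ∑ p_j (1 + u^j)` are nonnegative, and the term of the even index `q`
  -- is at least `p_q`.
  have h1 := le_hasSum ((h.hasSum u hu).add h.hasSum_one) q fun j _ => by
    have : |u ^ j| ≤ 1 := by rw [abs_pow]; exact pow_le_one₀ (abs_nonneg u) (abs_le.2 hu)
    have h2 := (abs_le.1 this).1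
    nlinarith [h.nonneg j]
  have := mul_nonneg hpq.le (hq.pow_nonneg u)
  linarith

end IsPGF

/-! ### Renormalized iterates: what both regimes have to provide. -/

/-- The asymptotic behaviour of the iterates `κ_L` of a kernel: a pointwise limit of the
renormalized iterates, with matching upper and lower bounds that are uniform near `1`. -/
structure RenormLimit (κ : ℝ → ℝ) (ν β₀ : ℝ) (v b w : ℕ → ℝ) (β : ℝ → ℝ) : Prop where
  nu_pos : 0 < ν
  beta0_pos : 0 < β₀
  v_pos : ∀ᶠ L in atTop, 0 < v L
  v_tendsto : Tendsto v atTop (𝓝 0)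
  w_pos : ∀ᶠ L in atTop, 0 < w L
  w_ratio : Tendsto (fun L => v L * (1 - κ^[L] 0) / w L) atTop (𝓝 β₀)
  w_succ : ∃ C, ∀ᶠ L in atTop, w L ≤ C * w (L + 1)
  limit : ∀ u ∈ Ioo (-1 : ℝ) 1, Tendsto (fun L => (κ^[L] u - b L) / w L) atTop (𝓝 (β u))
  upper : ∃ C, ∀ᶠ L in atTop, ∀ u ∈ Ico (0 : ℝ) 1,
    κ^[L] u - κ^[L] 0 ≤ C * w L * (1 - u) ^ (-ν)
  lower : ∃ c : ℝ, 0 < c ∧ ∃ δ : ℝ, 0 < δ ∧ δ ≤ 1 ∧ ∀ᶠ L in atTop, ∀ u ∈ Ioo (1 - δ) 1,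
    c * (1 - κ^[L] 0) * min 1 (v L * (1 - u) ^ (-ν)) ≤ κ^[L] u - κ^[L] 0

/-! ### The high-disorder regime. -/

namespace IsPGF

variable {κ : ℝ → ℝ} {p : ℕ → ℝ}

/-- If `b < 0`, then `κ(b) - b = ∑ p_q (b^q + |b|)` has nonnegative terms, and the term of an index
`q ≥ 2` with `p_q > 0` is positive, so `b` cannot be fixed. -/
theorem fixed_nonneg (h : IsPGF κ p) (hp : NonAffine p) {b : ℝ} (hb : b ∈ Ioo (-1 : ℝ) 1)
    (hf : κ b = b) : 0 ≤ b := by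
  by_contra! hneg
  obtain ⟨n, hn, hpn⟩ := hp
  have h1 := (h.hasSum b ⟨hb.1.le, hb.2.le⟩).add (h.hasSum_one.mul_right (-b))
  have hle : ∀ q : ℕ, 1 ≤ q → |b ^ q| ≤ -b := fun q hq => by
    rw [abs_pow, abs_of_neg hneg]
    exact pow_le_of_le_one (by linarith) (by linarith [hb.1]) (by omega)
  have h2 : 0 < κ b + 1 * -b := by
    refine hasSum_lt (i := n) (fun q => ?_) ?_ hasSum_zero h1
    · rcases Nat.eq_zero_or_pos q with rfl | hq
      · have := h.nonneg 0; simp; nlinarith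
      · have := (abs_le.1 (hle q hq)).1; nlinarith [h.nonneg q]
    · have : |b ^ n| < -b := by
        rw [abs_pow, abs_of_neg hneg]
        exact pow_lt_self_of_lt_one₀ (by linarith) (by linarith [hb.1]) (by omega)
      have := (abs_lt.1 this).1; nlinarith
  rw [hf] at h2
  linarith

/-- The setting of the high-disorder regime. -/
structure HighDisorder (κ : ℝ → ℝ) (p : ℕ → ℝ) (b : ℝ) : Prop where
  pgf : IsPGF κ p
  one_lt : 1 < D κ 1
  mem : b ∈ Ico (0 : ℝ) 1
  fixed : κ b = b
  pos : 0 < D κ b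

namespace HighDisorder

variable {b : ℝ} (s : HighDisorder κ p b)
include s

theorem nonAffine : NonAffine p := s.pgf.nonAffine_of_one_lt s.one_lt

theorem map_lt {u : ℝ} (hu : u ∈ Ioo b 1) : κ u < u := by
  have := s.pgf.chord_lt s.nonAffine s.mem.1 hu.1 hu.2
  rw [s.fixed] at this
  have h1 : 0 < 1 - b := by linarith [s.mem.2]
  nlinarith

theorem tangent {u : ℝ} (hu : u ∈ Icc (0 : ℝ) 1) : D κ b * (u - b) ≤ κ u - b := by
  simpa [s.fixed] using s.pgf.tangent_le s.mem hu

theorem mem_Icc {u : ℝ} (hu : u ∈ Ioo b 1) : u ∈ Icc (0 : ℝ) 1 :=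
  ⟨s.mem.1.trans hu.1.le, hu.2.le⟩

theorem lt_map {u : ℝ} (hu : u ∈ Ioo b 1) : b < κ u := by
  have := s.tangent (s.mem_Icc hu)
  have := mul_pos s.pos (sub_pos.2 hu.1)
  linarith

theorem maps {u : ℝ} (hu : u ∈ Ioo b 1) : κ u ∈ Ioo b 1 := ⟨s.lt_map hu, (s.map_lt hu).trans hu.2⟩

/-- On `(b, 1)` the graph lies above its tangent at `b` and strictly below the diagonal. -/
theorem lam_lt_one : D κ b < 1 := by
  have hm := s.mem
  have hu : (1 + b) / 2 ∈ Ioo b 1 := ⟨by linarith [hm.2], by linarith [hm.2]⟩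
  have h1 := s.tangent (s.mem_Icc hu)
  have h2 := s.map_lt hu
  have h3 : 0 < (1 + b) / 2 - b := by linarith [hm.2]
  nlinarith

theorem fixed_le_mid : b < (1 + b) / 2 ∧ (1 + b) / 2 < 1 := by
  have := s.mem; constructor <;> linarith [this.2]

/-- The error in the approximate functional equation of `log ((u - b) (1 - u)^{-ν})` is
small near the fixed point. -/
theorem error_le_near_fixed {ν : ℝ} (hν : 0 ≤ ν) : ∃ C, 0 ≤ C ∧ ∀ u ∈ Ioo b 1,
    |Real.log ((κ u - b) / (D κ b * (u - b))) - ν * Real.log ((1 - κ u) / (1 - u))|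
      ≤ C * (u - b) := by
  obtain ⟨hr1, hr2⟩ := s.fixed_le_mid
  set r := (1 + b) / 2 with hr
  have hb := s.mem
  have hl := s.pos
  obtain ⟨C, hC0, hC⟩ := s.pgf.quadratic (r := r) (b := b) (by linarith [hb.1]) hr2
    (by rw [abs_of_nonneg hb.1]; exact hr1.le)
  rw [← s.pgf.D_eq (by rw [abs_of_nonneg hb.1]; exact hb.2), s.fixed] at hC
  set lam := D κ b with hlam
  have hdpos : 0 < (1 - b) / 2 := by linarith [hb.2]
  -- Each bracket adds a constant for `u ≤ (1 + b) / 2` and one for `u > (1 + b) / 2`. In the second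
  -- range `u - b ≥ (1 - b) / 2`, so a bounded quantity is also at most a multiple of `u - b`.
  refine ⟨(C / lam + (1 / lam) / ((1 - b) / 2)) + ν * (1 / ((1 - b) / 2) + D κ 1 / ((1 - b) / 2)),
    ?_, fun u hu => ?_⟩
  · have := s.one_lt; positivity
  have hub : 0 < u - b := sub_pos.2 hu.1
  have hu1 : 0 < 1 - u := sub_pos.2 hu.2
  have ht := s.tangent (s.mem_Icc hu)
  have hlt := s.map_lt hu
  have hA1 : 1 ≤ (κ u - b) / (lam * (u - b)) := by rw [one_le_div (by positivity)]; exact ht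
  have hB1 : 1 ≤ (1 - κ u) / (1 - u) := by rw [one_le_div hu1]; linarith
  have hA : (κ u - b) / (lam * (u - b)) - 1 ≤ (C / lam + (1 / lam) / ((1 - b) / 2)) * (u - b) := by
    rcases le_or_gt u r with hle | hgt
    · have h1 := (abs_le.1 (hC u (by rw [abs_of_nonneg (s.mem_Icc hu).1]; exact hle))).2
      have h2 : (κ u - b) / (lam * (u - b)) - 1 ≤ C / lam * (u - b) := by
        rw [div_sub_one (by positivity), div_le_iff₀ (by positivity)]
        calc _ ≤ C * (u - b) ^ 2 := h1
          _ = _ := by field_simp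
      have h3 : 0 ≤ (1 / lam) / ((1 - b) / 2) * (u - b) := by positivity
      linarith
    · have h2 : (κ u - b) / (lam * (u - b)) ≤ 1 / lam := by
        rw [div_le_div_iff₀ (by positivity) hl]; nlinarith
      have h3 : 1 / lam ≤ (1 / lam) / ((1 - b) / 2) * (u - b) := by
        rw [div_mul_eq_mul_div, le_div_iff₀ hdpos]
        refine mul_le_mul_of_nonneg_left ?_ (by positivity)
        linarith
      have h4 : 0 ≤ C / lam * (u - b) := by positivity
      linarith
  have hB : (1 - κ u) / (1 - u) - 1 ≤ (1 / ((1 - b) / 2) + D κ 1 / ((1 - b) / 2)) * (u - b) := by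
    have hD := s.one_lt
    rcases le_or_gt u r with hle | hgt
    · have h2 : (1 - κ u) / (1 - u) - 1 ≤ 1 / ((1 - b) / 2) * (u - b) := by
        rw [div_sub_one hu1.ne', div_le_iff₀ hu1]
        have h3 : (1 - b) / 2 ≤ 1 - u := by linarith
        have h4 : 1 ≤ 1 / ((1 - b) / 2) * (1 - u) := by
          rw [one_div, ← div_eq_inv_mul, one_le_div hdpos]; exact h3
        have h5 : 0 ≤ lam * (u - b) := by positivity
        nlinarith
      have h3 : 0 ≤ D κ 1 / ((1 - b) / 2) * (u - b) := by positivity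
      linarith
    · have h2 : (1 - κ u) / (1 - u) ≤ D κ 1 := by
        rw [div_le_iff₀ hu1]; exact s.pgf.tangent_one_le (s.mem_Icc hu)
      have h3 : D κ 1 ≤ D κ 1 / ((1 - b) / 2) * (u - b) := by
        rw [div_mul_eq_mul_div, le_div_iff₀ hdpos]
        refine mul_le_mul_of_nonneg_left ?_ (by linarith)
        linarith
      have h4 : 0 ≤ 1 / ((1 - b) / 2) * (u - b) := by positivity
      linarith
  have hlA := Real.log_nonneg hA1
  have hlB := Real.log_nonneg hB1
  have hlA' := Real.log_le_sub_one_of_pos (lt_of_lt_of_le one_pos hA1)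
  have hlB' := Real.log_le_sub_one_of_pos (lt_of_lt_of_le one_pos hB1)
  have hlB2 := mul_le_mul_of_nonneg_left (hlB'.trans hB) hν
  have hlB3 := mul_nonneg hν hlB
  rw [add_mul, mul_assoc ν, abs_le]
  constructor <;> linarith

/-- The same error is small near `1`. -/
theorem error_le_near_one (reg : RegularAtOne κ) {ν : ℝ} (hν : 0 ≤ ν)
    (hlog : ν * Real.log (D κ 1) = -Real.log (D κ b)) :
    ∃ δ : ℝ, 0 < δ ∧ ∃ C, 0 ≤ C ∧ ∀ u ∈ Ioo b 1,
    |Real.log ((κ u - b) / (D κ b * (u - b))) - ν * Real.log ((1 - κ u) / (1 - u))|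
      ≤ C * (1 - u) ^ δ := by
  obtain ⟨γ, c, hγ, hreg⟩ := reg
  have hb := s.mem
  have hl := s.pos
  have hl1 := s.lam_lt_one
  have hm := s.one_lt
  have hdpos : 0 < (1 - b) / 2 := by linarith [hb.2]
  set lam := D κ b with hlam
  set m := D κ 1 with hmdef
  -- The first logarithm has an error of order `1 - u`, the second one of order `(1 - u)^{γ-1}`; the
  -- exponent `δ` serves both.
  have hδ : 0 < min 1 (γ - 1) := lt_min one_pos (by linarith)
  set δ := min 1 (γ - 1) with hδdef
  have hev := hreg.bound one_pos
  rw [eventually_nhdsWithin_iff, Metric.eventually_nhds_iff] at hev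
  obtain ⟨ε, hε, hev⟩ := hev
  have hloglam : Real.log lam ≤ 0 := Real.log_nonpos hl.le hl1.le
  refine ⟨δ, hδ, (m / (lam * ((1 - b) / 2)) + (-Real.log lam) / ((1 - b) / 2))
    + ν * ((|c| + 1) + m / ε ^ δ), ?_, fun u hu => ?_⟩
  · have : 0 ≤ -Real.log lam := by linarith
    positivity
  have hub : 0 < u - b := sub_pos.2 hu.1
  have hu1 : 0 < 1 - u := sub_pos.2 hu.2
  have hu1' : 1 - u ≤ 1 := by linarith [(s.mem_Icc hu).1]
  have ht := s.tangent (s.mem_Icc hu)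
  have hlt := s.map_lt hu
  have hgt := s.lt_map hu
  have hkb : 0 < κ u - b := sub_pos.2 hgt
  have hk1 : 0 < 1 - κ u := by linarith
  have htδ : 1 - u ≤ (1 - u) ^ δ := by
    conv_lhs => rw [← Real.rpow_one (1 - u)]
    exact Real.rpow_le_rpow_of_exponent_ge hu1 hu1' (min_le_left _ _)
  have hB1 : 1 ≤ (1 - κ u) / (1 - u) := by rw [one_le_div hu1]; linarith
  have hBm : (1 - κ u) / (1 - u) ≤ m := by
    rw [div_le_iff₀ hu1]; exact s.pgf.tangent_one_le (s.mem_Icc hu)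
  -- the first logarithm
  have eA : Real.log ((κ u - b) / (lam * (u - b))) = -Real.log lam - Real.log ((u - b) / (κ u - b)) := by
    rw [Real.log_div hkb.ne' (by positivity), Real.log_mul hl.ne' hub.ne',
      Real.log_div hub.ne' hkb.ne']
    ring
  have hA0 : 0 ≤ Real.log ((u - b) / (κ u - b)) :=
    Real.log_nonneg (by rw [one_le_div hkb]; linarith)
  have hA : Real.log ((u - b) / (κ u - b))
      ≤ (m / (lam * ((1 - b) / 2)) + (-Real.log lam) / ((1 - b) / 2)) * (1 - u) := by
    have p1 : 0 ≤ m / (lam * ((1 - b) / 2)) * (1 - u) := by positivity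
    have p2 : 0 ≤ (-Real.log lam) / ((1 - b) / 2) * (1 - u) :=
      mul_nonneg (div_nonneg (by linarith) hdpos.le) hu1.le
    rcases le_or_gt ((1 + b) / 2) u with hge | hlt'
    · have h1 := Real.log_le_sub_one_of_pos (x := (u - b) / (κ u - b)) (by positivity)
      have h2 : (u - b) / (κ u - b) - 1 ≤ m / (lam * ((1 - b) / 2)) * (1 - u) := by
        rw [div_sub_one hkb.ne', div_mul_eq_mul_div,
          div_le_div_iff₀ hkb (by positivity)]
        have h3 : lam * ((1 - b) / 2) ≤ κ u - b := by
          refine le_trans (mul_le_mul_of_nonneg_left ?_ hl.le) ht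
          linarith
        have h4 : u - b - (κ u - b) ≤ m * (1 - u) := by
          have := s.pgf.tangent_one_le (s.mem_Icc hu)
          linarith
        exact mul_le_mul h4 h3 (by positivity) (by positivity)
      linarith
    · have h1 : Real.log ((u - b) / (κ u - b)) ≤ -Real.log lam := by
        rw [← Real.log_inv]
        refine Real.log_le_log (by positivity) ?_
        rw [div_le_iff₀ hkb, ← div_eq_inv_mul, le_div_iff₀ hl]
        linarith
      have h2 : -Real.log lam ≤ (-Real.log lam) / ((1 - b) / 2) * (1 - u) := by
        rw [div_mul_eq_mul_div, le_div_iff₀ hdpos]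
        exact mul_le_mul_of_nonneg_left (by linarith) (by linarith)
      linarith
  -- the second logarithm
  have hBpos : 0 < (1 - κ u) / (1 - u) := by positivity
  have hB0 : Real.log ((1 - κ u) / (1 - u)) ≤ Real.log m := Real.log_le_log hBpos hBm
  have hB : Real.log m - Real.log ((1 - κ u) / (1 - u)) ≤ ((|c| + 1) + m / ε ^ δ) * (1 - u) ^ δ := by
    have p1 : 0 ≤ (|c| + 1) * (1 - u) ^ δ := by positivity
    have p2 : 0 ≤ m / ε ^ δ * (1 - u) ^ δ := by positivity
    rw [← Real.log_div (by positivity) hBpos.ne']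
    have h1 := Real.log_le_sub_one_of_pos (x := m / ((1 - κ u) / (1 - u))) (by positivity)
    have h2 : m / ((1 - κ u) / (1 - u)) - 1 ≤ m - (1 - κ u) / (1 - u) := by
      rw [div_sub_one hBpos.ne']
      exact div_le_self (by linarith) hB1
    rcases lt_or_ge (1 - u) ε with hnear | hfar
    · have h3 := hev (y := u) (by rw [Real.dist_eq, abs_sub_comm, abs_of_pos hu1]; exact hnear) hu.2
      have hg : 0 < (1 - u) ^ γ := by positivity
      rw [Real.norm_eq_abs, Real.norm_of_nonneg hg.le] at h3
      have h4 : m * (1 - u) - (1 - κ u) ≤ (|c| + 1) * (1 - u) ^ γ := by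
        have := (abs_le.1 h3).1
        have := le_abs_self c
        nlinarith
      have h5 : m - (1 - κ u) / (1 - u) ≤ (|c| + 1) * (1 - u) ^ (γ - 1) := by
        rw [Real.rpow_sub_one hu1.ne', ← mul_div_assoc, le_div_iff₀ hu1, sub_mul,
          div_mul_cancel₀ _ hu1.ne']
        exact h4
      have h6 : (1 - u) ^ (γ - 1) ≤ (1 - u) ^ δ :=
        Real.rpow_le_rpow_of_exponent_ge hu1 hu1' (min_le_right _ _)
      have h7 := mul_le_mul_of_nonneg_left h6 (by positivity : 0 ≤ |c| + 1)
      linarith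
    · have h3 : m ≤ m / ε ^ δ * (1 - u) ^ δ := by
        rw [div_mul_eq_mul_div, le_div_iff₀ (by positivity)]
        exact mul_le_mul_of_nonneg_left (Real.rpow_le_rpow hε.le hfar hδ.le) (by linarith)
      linarith
  -- The choice of `ν` makes the limits `-log λ` and `ν log m` at `u = 1` cancel.
  have e : Real.log ((κ u - b) / (lam * (u - b))) - ν * Real.log ((1 - κ u) / (1 - u))
      = -Real.log ((u - b) / (κ u - b)) + ν * (Real.log m - Real.log ((1 - κ u) / (1 - u))) := by
    rw [eA, mul_sub, hlog]; ring
  rw [e]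
  have hB2 := mul_le_mul_of_nonneg_left hB hν
  have hB3 : 0 ≤ ν * (Real.log m - Real.log ((1 - κ u) / (1 - u))) := mul_nonneg hν (by linarith)
  have hc2 : 0 ≤ m / (lam * ((1 - b) / 2)) + (-Real.log lam) / ((1 - b) / 2) := by
    have : 0 ≤ -Real.log lam := by linarith
    positivity
  have hA2 := hA.trans (mul_le_mul_of_nonneg_left htδ hc2)
  rw [add_mul, mul_assoc ν, abs_le]
  constructor <;> linarith

end HighDisorder

end IsPGF

namespace IsPGF

variable {κ : ℝ → ℝ} {p : ℕ → ℝ}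

namespace HighDisorder

variable {b : ℝ} (s : HighDisorder κ p b)
include s

theorem iterate_maps {u : ℝ} (hu : u ∈ Ioo b 1) (L : ℕ) : κ^[L] u ∈ Ioo b 1 :=
  MapsTo.iterate (fun _ hx => s.maps hx) L hu

/-- On orbits, `log ((u - b) (1 - u)^{-ν})` grows linearly up to a bounded error. -/
theorem log_orbit (reg : RegularAtOne κ) {ν : ℝ} (hν : 0 ≤ ν)
    (hlog : ν * Real.log (D κ 1) = -Real.log (D κ b)) : ∃ K, ∀ u ∈ Ioo b 1, ∀ L : ℕ,
    |Real.log (κ^[L] u - b) - ν * Real.log (1 - κ^[L] u)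
      - (Real.log (u - b) - ν * Real.log (1 - u) + L * Real.log (D κ b))| ≤ K := by
  obtain ⟨C1, hC1, hE1⟩ := s.error_le_near_fixed hν
  obtain ⟨δ, hδ, C2, hC2, hE2⟩ := s.error_le_near_one reg hν hlog
  obtain ⟨hr1, hr2⟩ := s.fixed_le_mid
  have hb := s.mem
  set r := (1 + b) / 2 with hr
  have hrmem : r ∈ Ioo b 1 := ⟨hr1, hr2⟩
  set g := r - κ r with hg
  have hg0 : 0 < g := sub_pos.2 (s.map_lt hrmem)
  set η := (1 - κ r) / (1 - r) with hη
  have hη1 : 1 < η := by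
    rw [hη, one_lt_div (by linarith)]; linarith
  have hηδ : 1 < η ^ δ := Real.one_lt_rpow hη1 hδ
  set K1 := C1 * (r - b) / g with hK1
  set K2 := C2 / (η ^ δ - 1) with hK2
  have hK1n : 0 ≤ K1 := div_nonneg (mul_nonneg hC1 (by linarith)) hg0.le
  have hK2n : 0 ≤ K2 := div_nonneg hC2 (by linarith)
  set E : ℝ → ℝ := fun u =>
    Real.log ((κ u - b) / (D κ b * (u - b))) - ν * Real.log ((1 - κ u) / (1 - u)) with hE
  -- A bounded Lyapunov function, both of whose terms decrease along orbits. Below `r` the first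
  -- pays for the error, since convexity gives `u - κ u ≥ g (u - b) / (r - b)`; above `r` the second
  -- does, since `1 - κ u ≥ η (1 - u)` with `η > 1`. The errors along an orbit then telescope to at
  -- most the oscillation of `Φ`.
  set Φ : ℝ → ℝ := fun u => K1 * u - K2 * (1 - u) ^ δ with hΦ
  have step : ∀ u ∈ Ioo b 1, |E u| ≤ Φ u - Φ (κ u) := by
    intro u hu
    have hlt := s.map_lt hu
    have hu1 : 0 < 1 - u := sub_pos.2 hu.2
    have hmono : (1 - u) ^ δ ≤ (1 - κ u) ^ δ := Real.rpow_le_rpow hu1.le (by linarith) hδ.le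
    have n1 : 0 ≤ K1 * (u - κ u) := mul_nonneg hK1n (by linarith)
    have n2 : 0 ≤ K2 * ((1 - κ u) ^ δ - (1 - u) ^ δ) := mul_nonneg hK2n (by linarith)
    have e : Φ u - Φ (κ u) = K1 * (u - κ u) + K2 * ((1 - κ u) ^ δ - (1 - u) ^ δ) := by
      simp only [hΦ]; ring
    rw [e]
    rcases le_or_gt u r with hle | hgt
    · have hconv : κ u * (r - b) ≤ (r - u) * b + (u - b) * κ r := by
        have hrb : 0 < r - b := by linarith
        have hab : (r - u) / (r - b) + (u - b) / (r - b) = 1 := by field_simp; ring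
        have := (s.pgf.strictConvexOn s.nonAffine).convexOn.2 (x := b) ⟨hb.1, hb.2.le⟩
          (y := r) (s.mem_Icc hrmem) (div_nonneg (by linarith) hrb.le)
          (div_nonneg (by linarith [hu.1]) hrb.le) hab
        simp only [smul_eq_mul, s.fixed] at this
        have e : (r - u) / (r - b) * b + (u - b) / (r - b) * r = u := by field_simp; ring
        rw [e] at this
        calc κ u * (r - b) ≤ ((r - u) / (r - b) * b + (u - b) / (r - b) * κ r) * (r - b) := by
              gcongr
          _ = _ := by field_simp
      have h1 : g * (u - b) ≤ (u - κ u) * (r - b) := by rw [hg]; nlinarith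
      have h2 : C1 * (u - b) ≤ K1 * (u - κ u) := by
        rw [hK1, div_mul_eq_mul_div, le_div_iff₀ hg0]
        nlinarith [mul_le_mul_of_nonneg_left h1 hC1]
      linarith [hE1 u hu]
    · have hch := s.pgf.chord_lt s.nonAffine (s.mem_Icc hrmem).1 hgt hu.2
      have h1 : η * (1 - u) ≤ 1 - κ u := by
        rw [hη, div_mul_eq_mul_div, div_le_iff₀ (by linarith)]
        nlinarith
      have h2 : η ^ δ * (1 - u) ^ δ ≤ (1 - κ u) ^ δ := by
        rw [← Real.mul_rpow (by linarith) hu1.le]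
        exact Real.rpow_le_rpow (mul_nonneg (by linarith) hu1.le) h1 hδ.le
      have h3 : C2 * (1 - u) ^ δ ≤ K2 * ((1 - κ u) ^ δ - (1 - u) ^ δ) := by
        rw [hK2, div_mul_eq_mul_div, le_div_iff₀ (by linarith)]
        nlinarith [mul_le_mul_of_nonneg_left h2 hC2]
      linarith [hE2 u hu]
  have hbound : ∀ u ∈ Ioo b 1, |Φ u| ≤ K1 + K2 := by
    intro u hu
    have hu0 := s.mem_Icc hu
    have h1 : (1 - u) ^ δ ≤ 1 := Real.rpow_le_one (by linarith [hu.2]) (by linarith [hu0.1]) hδ.le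
    have h2 : 0 ≤ (1 - u) ^ δ := Real.rpow_nonneg (by linarith [hu.2]) _
    have h3 := mul_le_mul_of_nonneg_left h1 hK2n
    have h4 := mul_nonneg hK2n h2
    have h5 := mul_le_mul_of_nonneg_left hu0.2 hK1n
    have h6 := mul_nonneg hK1n hu0.1
    simp only [hΦ]
    rw [abs_le]; constructor <;> linarith
  have hrec : ∀ u ∈ Ioo b 1, ∀ L : ℕ,
      |Real.log (κ^[L] u - b) - ν * Real.log (1 - κ^[L] u)
      - (Real.log (u - b) - ν * Real.log (1 - u) + L * Real.log (D κ b))| ≤ Φ u - Φ (κ^[L] u) := by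
    intro u hu L
    induction L with
    | zero => simp
    | succ L ih =>
      have hx := s.iterate_maps hu L
      rw [Function.iterate_succ_apply']
      set x := κ^[L] u
      have hEx : E x = Real.log (κ x - b) - ν * Real.log (1 - κ x)
          - (Real.log (x - b) - ν * Real.log (1 - x)) - Real.log (D κ b) := by
        have h1 : 0 < x - b := sub_pos.2 hx.1
        have h2 : 0 < 1 - x := sub_pos.2 hx.2
        have h3 : 0 < κ x - b := sub_pos.2 (s.lt_map hx)
        have h4 : 0 < 1 - κ x := by linarith [s.map_lt hx]
        simp only [hE]
        rw [Real.log_div h3.ne' (mul_pos s.pos h1).ne', Real.log_mul s.pos.ne' h1.ne',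
          Real.log_div h4.ne' h2.ne']
        ring
      have := step x hx
      rw [hEx] at this
      push_cast
      rw [abs_le] at this ih ⊢
      constructor <;> linarith [this.1, this.2, ih.1, ih.2]
  refine ⟨2 * (K1 + K2), fun u hu L => (hrec u hu L).trans ?_⟩
  have h1 := abs_le.1 (hbound u hu)
  have h2 := abs_le.1 (hbound _ (s.iterate_maps hu L))
  linarith [h1.2, h2.1]

/-- Two-sided bounds for the orbits above the fixed point. -/
theorem orbit_bounds (reg : RegularAtOne κ) {ν : ℝ} (hν : 0 ≤ ν)
    (hlog : ν * Real.log (D κ 1) = -Real.log (D κ b)) : ∃ K : ℝ, 0 < K ∧ ∀ u ∈ Ioo b 1, ∀ L : ℕ,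
    κ^[L] u - b ≤ K * D κ b ^ L * (1 - u) ^ (-ν) ∧
    K⁻¹ * D κ b ^ L * (u - b) * (1 - u) ^ (-ν) * (1 - κ^[L] u) ^ ν ≤ κ^[L] u - b := by
  obtain ⟨K, hK⟩ := s.log_orbit reg hν hlog
  refine ⟨Real.exp K, Real.exp_pos K, fun u hu L => ?_⟩
  have h := abs_le.1 (hK u hu L)
  have hx := s.iterate_maps hu L
  set x := κ^[L] u
  have h1 : 0 < x - b := sub_pos.2 hx.1
  have h2 : 0 < 1 - x := sub_pos.2 hx.2
  have h3 : 0 < u - b := sub_pos.2 hu.1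
  have h4 : 0 < 1 - u := sub_pos.2 hu.2
  have hl := s.pos
  have hx1 : Real.log (1 - x) ≤ 0 := Real.log_nonpos h2.le (by linarith [(s.mem_Icc hx).1])
  have hu1 : Real.log (u - b) ≤ 0 := Real.log_nonpos h3.le (by linarith [s.mem.1, hu.2])
  constructor
  · rw [← Real.log_le_log_iff h1 (by positivity), Real.log_mul (by positivity) (by positivity),
      Real.log_mul (by positivity) (by positivity), Real.log_exp, Real.log_pow, Real.log_rpow h4]
    have := mul_nonpos_of_nonneg_of_nonpos hν hx1
    linarith [h.2]
  · rw [← Real.log_le_log_iff (by positivity) h1, Real.log_mul (by positivity) (by positivity),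
      Real.log_mul (by positivity) (by positivity), Real.log_mul (by positivity) (by positivity),
      Real.log_mul (by positivity) (by positivity), Real.log_inv, Real.log_exp, Real.log_pow,
      Real.log_rpow h4, Real.log_rpow h2]
    linarith [h.1]

/-- The tangent at `b` bounds `b - κ(x)` by `κ'(b) (b - x)` for `x` in `[0, b]`. -/
theorem sub_iterate_zero_le (L : ℕ) :
    κ^[L] 0 ≤ b ∧ b - κ^[L] 0 ≤ D κ b ^ L * b := by
  induction L with
  | zero => simp [s.mem.1]
  | succ L ih =>
    rw [Function.iterate_succ_apply']
    have hx := s.pgf.iterate_mem_nonneg (u := 0) (by norm_num) L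
    refine ⟨?_, ?_⟩
    · have := s.pgf.monotoneOn hx ⟨s.mem.1, s.mem.2.le⟩ ih.1
      rwa [s.fixed] at this
    · have h1 := s.tangent hx
      have h2 := mul_le_mul_of_nonneg_left ih.2 s.pos.le
      calc b - κ (κ^[L] 0) ≤ D κ b * (b - κ^[L] 0) := by linarith
        _ ≤ _ := h2
        _ = _ := by ring

theorem iterate_fixed (L : ℕ) : κ^[L] b = b := Function.iterate_fixed s.fixed L

/-- The iterate at `u` deviates from the iterate at `0` by no more than the iterate at `|u|` does.
The latter is controlled by `orbit_bounds` above `b` and by monotonicity below it. -/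
theorem orbit_geometric (reg : RegularAtOne κ) {ν : ℝ} (hν : 0 ≤ ν)
    (hlog : ν * Real.log (D κ 1) = -Real.log (D κ b)) {u : ℝ} (hu : |u| < 1) :
    ∃ C, ∀ L : ℕ, |κ^[L] u - b| ≤ C * D κ b ^ L := by
  obtain ⟨K, hK, hb⟩ := s.orbit_bounds reg hν hlog
  have hl := s.pos
  have hpos : 0 < (1 - |u|) ^ (-ν) := Real.rpow_pos_of_pos (by linarith) _
  refine ⟨K * (1 - |u|) ^ (-ν) + 3 * b, fun L => ?_⟩
  have h1 := s.pgf.iterate_increment (u := u) (abs_le.1 hu.le) L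
  obtain ⟨h2, h3⟩ := s.sub_iterate_zero_le L
  have h4 : κ^[L] |u| - b ≤ K * (1 - |u|) ^ (-ν) * D κ b ^ L := by
    rcases le_or_gt |u| b with hle | hgt
    · have := s.pgf.iterate_monotoneOn L ⟨abs_nonneg u, hu.le⟩ ⟨s.mem.1, s.mem.2.le⟩ hle
      rw [s.iterate_fixed] at this
      have : 0 ≤ K * (1 - |u|) ^ (-ν) * D κ b ^ L := by positivity
      linarith
    · exact (hb |u| ⟨hgt, hu⟩ L).1.trans (le_of_eq (by ring))
  rw [abs_le] at h1 ⊢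
  constructor <;> nlinarith [h1.1, h1.2]

/-- Koenigs' theorem. -/
theorem koenigs (reg : RegularAtOne κ) {ν : ℝ} (hν : 0 ≤ ν)
    (hlog : ν * Real.log (D κ 1) = -Real.log (D κ b)) {u : ℝ} (hu : |u| < 1) :
    ∃ l, Tendsto (fun L => (κ^[L] u - b) / D κ b ^ L) atTop (𝓝 l) := by
  obtain ⟨C, hC⟩ := s.orbit_geometric reg hν hlog hu
  have hl := s.pos
  have hl1 := s.lam_lt_one
  obtain ⟨hr1, hr2⟩ := s.fixed_le_mid
  -- A radius above the fixed point satisfies `κ r < r`, so `[-r, r]` traps the orbit and one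
  -- quadratic remainder bound applies to all its points.
  set r := max |u| ((1 + b) / 2) with hr
  have hr1' : r < 1 := max_lt hu hr2
  have hbr : b ≤ r := hr1.le.trans (le_max_right _ _)
  have hr0 : 0 < r := lt_of_lt_of_le (by linarith [s.mem.1]) (le_max_right |u| ((1 + b) / 2))
  obtain ⟨Q, hQ0, hQ⟩ := s.pgf.quadratic hr0 hr1' (b := b) (by rwa [abs_of_nonneg s.mem.1])
  rw [← s.pgf.D_eq (by rw [abs_of_nonneg s.mem.1]; exact s.mem.2), s.fixed] at hQ
  have hbd : ∀ L : ℕ, |κ^[L] u| ≤ r := by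
    intro L
    induction L with
    | zero => exact le_max_left _ _
    | succ L ih =>
      rw [Function.iterate_succ_apply']
      refine (s.pgf.abs_map_le (abs_le.1 (ih.trans hr1'.le))).trans ?_
      refine (s.pgf.monotoneOn ⟨abs_nonneg _, ih.trans hr1'.le⟩ ⟨hr0.le, hr1'.le⟩ ih).trans ?_
      exact (s.map_lt ⟨lt_of_lt_of_le hr1 (le_max_right _ _), hr1'⟩).le
  -- The quadratic error at step `L` is of order `λ^{2L}`; after division by `λ^{L+1}` it is still
  -- geometric.
  have hcauchy : CauchySeq fun L => (κ^[L] u - b) / D κ b ^ L := by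
    refine cauchySeq_of_le_geometric (D κ b) (Q * C ^ 2 / D κ b) hl1 fun L => ?_
    rw [dist_comm, Real.dist_eq, Function.iterate_succ_apply']
    set x := κ^[L] u
    have h1 := hQ x (hbd L)
    have h2 : (x - b) ^ 2 ≤ (C * D κ b ^ L) ^ 2 := sq_le_sq' (by linarith [(abs_le.1 (hC L)).1])
      (abs_le.1 (hC L)).2
    have e : (κ x - b) / D κ b ^ (L + 1) - (x - b) / D κ b ^ L
        = (κ x - b - D κ b * (x - b)) / D κ b ^ (L + 1) := by field_simp; ring
    rw [e, abs_div, abs_of_pos (pow_pos hl (L + 1)), div_le_iff₀ (pow_pos hl _)]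
    calc _ ≤ Q * (x - b) ^ 2 := h1
      _ ≤ Q * (C * D κ b ^ L) ^ 2 := by gcongr
      _ = _ := by field_simp; ring
  exact cauchySeq_tendsto_of_complete hcauchy

theorem renormLimit (reg : RegularAtOne κ) :
    ∃ β, RenormLimit κ (-(Real.log (D κ b) / Real.log (D κ 1))) (1 - b)
        (fun L => D κ b ^ L) (fun _ => b) (fun L => D κ b ^ L) β := by
  have hl := s.pos
  have hl1 := s.lam_lt_one
  have hb := s.mem
  have hm := Real.log_pos s.one_lt
  have hll := Real.log_neg hl hl1
  set ν := -(Real.log (D κ b) / Real.log (D κ 1)) with hνdef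
  have hν : 0 < ν := by
    rw [hνdef, ← neg_div]; exact div_pos (by linarith) hm
  have hlog : ν * Real.log (D κ 1) = -Real.log (D κ b) := by
    rw [hνdef]; field_simp
  have hlim := fun (u : ℝ) (hu : |u| < 1) => s.koenigs reg hν.le hlog hu
  choose! β hβ using hlim
  obtain ⟨K, hK, hbd⟩ := s.orbit_bounds reg hν.le hlog
  have hd : 0 < (1 - b) / 2 := by linarith [hb.2]
  have hpow : Tendsto (fun L : ℕ => D κ b ^ L) atTop (𝓝 0) :=
    tendsto_pow_atTop_nhds_zero_of_lt_one hl.le hl1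
  refine ⟨β, hν, by linarith [hb.2], Eventually.of_forall fun L => pow_pos hl L, hpow,
    Eventually.of_forall fun L => pow_pos hl L, ?_, ⟨(D κ b)⁻¹, Eventually.of_forall fun L => ?_⟩,
    fun u hu => hβ u (abs_lt.2 hu), ⟨K + b, Eventually.of_forall fun L u hu => ?_⟩,
    ⟨min ((1 - b) / 2) (K⁻¹ * ((1 - b) / 2) * ((1 - b) / 2) ^ ν), by positivity,
      (1 - b) / 2, hd, by linarith [hb.1], Eventually.of_forall fun L u hu => ?_⟩⟩
  · have : Tendsto (fun L : ℕ => κ^[L] 0) atTop (𝓝 b) := by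
      rw [tendsto_iff_dist_tendsto_zero]
      refine squeeze_zero (fun _ => dist_nonneg) (fun L => ?_) (by simpa using hpow.mul_const b)
      have := s.sub_iterate_zero_le L
      rw [dist_comm, Real.dist_eq, abs_of_nonneg (by linarith [this.1])]
      exact this.2
    refine (this.const_sub 1).congr fun L => ?_
    have := pow_pos hl L
    field_simp
  · rw [pow_succ]; exact le_of_eq (by field_simp)
  · have hu1 : 0 < 1 - u := by linarith [hu.2]
    have h1 : 1 ≤ (1 - u) ^ (-ν) :=
      Real.one_le_rpow_of_pos_of_le_one_of_nonpos hu1 (by linarith [hu.1]) (by linarith)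
    have h2 := (s.sub_iterate_zero_le L).2
    have hp := pow_pos hl L
    have h3 : D κ b ^ L * b ≤ b * D κ b ^ L * (1 - u) ^ (-ν) := by
      have : 0 ≤ b * D κ b ^ L := mul_nonneg hb.1 hp.le
      nlinarith
    have h4 : κ^[L] u - b ≤ K * D κ b ^ L * (1 - u) ^ (-ν) := by
      rcases le_or_gt u b with hle | hgt
      · have := s.pgf.iterate_monotoneOn L ⟨hu.1, hu.2.le⟩ ⟨hb.1, hb.2.le⟩ hle
        rw [s.iterate_fixed] at this
        have : 0 ≤ K * D κ b ^ L * (1 - u) ^ (-ν) := by positivity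
        linarith
      · exact (hbd u ⟨hgt, hu.2⟩ L).1
    calc _ = (κ^[L] u - b) + (b - κ^[L] 0) := by ring
      _ ≤ K * D κ b ^ L * (1 - u) ^ (-ν) + b * D κ b ^ L * (1 - u) ^ (-ν) := by linarith
      _ = _ := by ring
  · have hu' : u ∈ Ioo b 1 := ⟨by linarith [hu.1, hb.2], hu.2⟩
    have hu1 : 0 < 1 - u := by linarith [hu.2]
    have hx := s.iterate_maps hu' L
    have h0 := (s.sub_iterate_zero_le L).1
    have h00 := (s.pgf.iterate_mem_nonneg (u := 0) (by norm_num) L).1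
    have hlow := (hbd u hu' L).2
    set x := κ^[L] u
    have hmin0 : 0 ≤ min 1 (D κ b ^ L * (1 - u) ^ (-ν)) := by positivity
    set c := min ((1 - b) / 2) (K⁻¹ * ((1 - b) / 2) * ((1 - b) / 2) ^ ν) with hc
    have hc0 : 0 ≤ c := by positivity
    have hfin : c * (1 - κ^[L] 0) * min 1 (D κ b ^ L * (1 - u) ^ (-ν))
        ≤ c * min 1 (D κ b ^ L * (1 - u) ^ (-ν)) := by
      refine mul_le_mul_of_nonneg_right ?_ hmin0
      exact mul_le_of_le_one_right hc0 (by linarith)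
    have : c * min 1 (D κ b ^ L * (1 - u) ^ (-ν)) ≤ x - b := by
      -- If the iterate is still at distance `(1 - b) / 2` from `1`, the factor `(1 - x)^ν` in the
      -- orbit bound is bounded below; otherwise `x - b` itself exceeds `(1 - b) / 2`. The constant
      -- `c` is the minimum over the two cases.
      rcases le_or_gt ((1 - b) / 2) (1 - x) with hfar | hnear
      · refine le_trans ?_ hlow
        calc c * min 1 (D κ b ^ L * (1 - u) ^ (-ν))
            ≤ (K⁻¹ * ((1 - b) / 2) * ((1 - b) / 2) ^ ν) * (D κ b ^ L * (1 - u) ^ (-ν)) :=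
              mul_le_mul (min_le_right _ _) (min_le_right _ _) hmin0 (by positivity)
          _ ≤ (K⁻¹ * (u - b) * (1 - x) ^ ν) * (D κ b ^ L * (1 - u) ^ (-ν)) := by
              have hy : (1 - b) / 2 ≤ u - b := by linarith [hu.1]
              generalize u - b = y at hy
              have hy0 : 0 ≤ y := hd.le.trans hy
              gcongr
          _ = _ := by ring
      · calc c * min 1 (D κ b ^ L * (1 - u) ^ (-ν)) ≤ ((1 - b) / 2) * 1 :=
              mul_le_mul (min_le_left _ _) (min_le_left _ _) hmin0 hd.le
          _ ≤ x - b := by linarith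
    linarith

end HighDisorder

end IsPGF

/-! ### The sparse regime: expansions at `1`. -/

theorem eventually_left_one : ∀ᶠ u in 𝓝[<] (1 : ℝ), 0 ≤ u ∧ 0 < 1 - u ∧ 1 - u ≤ 1 := by
  have h : Ioo (0 : ℝ) 1 ∈ 𝓝[<] (1 : ℝ) := Ioo_mem_nhdsLT (by norm_num)
  filter_upwards [h] with u hu
  exact ⟨hu.1.le, by linarith [hu.2], by linarith [hu.1]⟩

theorem isBigO_rpow_left_one {α β : ℝ} (h : β ≤ α) :
    (fun u : ℝ => (1 - u) ^ α) =O[𝓝[<] 1] fun u => (1 - u) ^ β := by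
  refine IsBigO.of_bound 1 ?_
  filter_upwards [eventually_left_one] with u ⟨_, h1, h2⟩
  rw [Real.norm_of_nonneg (by positivity), Real.norm_of_nonneg (by positivity), one_mul]
  exact Real.rpow_le_rpow_of_exponent_ge h1 h2 h

theorem isBigO_rpow_mul_left_one {f g : ℝ → ℝ} {α β γ : ℝ}
    (hf : f =O[𝓝[<] 1] fun u : ℝ => (1 - u) ^ α) (hg : g =O[𝓝[<] 1] fun u : ℝ => (1 - u) ^ β)
    (h : γ ≤ α + β) : (fun u => f u * g u) =O[𝓝[<] 1] fun u : ℝ => (1 - u) ^ γ := by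
  refine ((hf.mul hg).congr' EventuallyEq.rfl ?_).trans (isBigO_rpow_left_one h)
  filter_upwards [eventually_left_one] with u ⟨_, h1, _⟩
  rw [Real.rpow_add h1]

theorem tendsto_rpow_left_one {α : ℝ} (h : 0 < α) :
    Tendsto (fun u : ℝ => (1 - u) ^ α) (𝓝[<] 1) (𝓝 0) := by
  have : Tendsto (fun u : ℝ => (1 - u) ^ α) (𝓝 1) (𝓝 ((1 - 1 : ℝ) ^ α)) := by
    refine Tendsto.rpow_const ?_ (Or.inr h.le)
    exact (continuous_const.sub continuous_id).tendsto 1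
  rw [sub_self, Real.zero_rpow h.ne'] at this
  exact this.mono_left nhdsWithin_le_nhds

theorem isBigO_exp_sub_three : (fun y : ℝ => Real.exp y - 1 - y - y ^ 2 / 2)
    =O[𝓝 0] fun y => y ^ 3 := by
  refine IsBigO.of_bound 1 ?_
  have : ∀ᶠ y : ℝ in 𝓝 0, |y| < 1 := (continuous_abs.tendsto' 0 0 abs_zero).eventually_lt_const one_pos
  filter_upwards [this] with y hy
  have h := Real.exp_bound hy.le (n := 3) (by norm_num)
  rw [Real.norm_eq_abs, norm_pow, Real.norm_eq_abs]
  have e : ∑ m ∈ Finset.range 3, y ^ m / (m.factorial : ℝ) = 1 + y + y ^ 2 / 2 := by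
    simp [Finset.sum_range_succ, Nat.factorial]
  rw [e] at h
  calc _ = |Real.exp y - (1 + y + y ^ 2 / 2)| := by ring_nf
    _ ≤ _ := h
    _ ≤ 1 * |y| ^ 3 := by
      rw [mul_comm]; gcongr; norm_num [Nat.factorial]

theorem isBigO_log_sub_three : (fun x : ℝ => -Real.log (1 - x) - x - x ^ 2 / 2)
    =O[𝓝 0] fun x => x ^ 3 := by
  refine IsBigO.of_bound 2 ?_
  have : ∀ᶠ y : ℝ in 𝓝 0, |y| < 1 / 2 :=
    (continuous_abs.tendsto' 0 0 abs_zero).eventually_lt_const (by norm_num)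
  filter_upwards [this] with x hx
  have h := Real.abs_log_sub_add_sum_range_le (x := x) (by linarith) 2
  have e : ∑ i ∈ Finset.range 2, x ^ (i + 1) / ((i : ℝ) + 1) = x + x ^ 2 / 2 := by
    simp [Finset.sum_range_succ]; norm_num
  rw [e] at h
  rw [Real.norm_eq_abs, norm_pow, Real.norm_eq_abs]
  calc _ = |x + x ^ 2 / 2 + Real.log (1 - x)| := by rw [← abs_neg]; ring_nf
    _ ≤ _ := h
    _ ≤ 2 * |x| ^ 3 := by
      rw [div_le_iff₀ (by linarith)]
      have : 0 ≤ |x| ^ 3 := by positivity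
      norm_num; nlinarith

namespace IsPGF

/-- The setting of the sparse regime, with both cases of the expansion at `1` in one form. -/
structure Sparse (κ : ℝ → ℝ) (p : ℕ → ℝ) (ν c a δ : ℝ) : Prop where
  pgf : IsPGF κ p
  crit : D κ 1 = 1
  nu_pos : 0 < ν
  delta_pos : 0 < δ
  delta_le : δ ≤ ν
  c_ne : c ≠ 0
  expansion : (fun u : ℝ => 1 - κ u - ((1 - u) - c * (1 - u) ^ (1 + ν) - a * (1 - u) ^ (1 + 2 * ν)))
    =O[𝓝[<] 1] fun u : ℝ => (1 - u) ^ (1 + 2 * ν + δ)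

namespace Sparse

variable {κ : ℝ → ℝ} {p : ℕ → ℝ} {ν c a δ : ℝ} (s : Sparse κ p ν c a δ)
include s

/-- The relative increment `x = (κ u - u) / (1 - u)` satisfies `1 - κ u = (1 - u)(1 - x)`; powers
and logarithms of `1 - κ u` are expanded through it. -/
theorem rel_expansion : (fun u : ℝ => (κ u - u) / (1 - u) - c * (1 - u) ^ ν - a * (1 - u) ^ (2 * ν))
    =O[𝓝[<] 1] fun u : ℝ => (1 - u) ^ (2 * ν + δ) := by
  have h1 : (fun u : ℝ => (1 - u) ^ (-1 : ℝ)) =O[𝓝[<] 1] fun u : ℝ => (1 - u) ^ (-1 : ℝ) :=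
    isBigO_refl _ _
  have := (isBigO_rpow_mul_left_one s.expansion h1 (γ := 2 * ν + δ) (by linarith)).neg_left
  refine this.congr' ?_ EventuallyEq.rfl
  filter_upwards [eventually_left_one] with u ⟨_, ht, _⟩
  rw [Real.rpow_add ht, Real.rpow_add ht, Real.rpow_neg_one, Real.rpow_one]
  field_simp
  ring

theorem rel_sub_linear : (fun u : ℝ => (κ u - u) / (1 - u) - c * (1 - u) ^ ν)
    =O[𝓝[<] 1] fun u : ℝ => (1 - u) ^ (2 * ν) := by
  have h1 := s.rel_expansion.trans (isBigO_rpow_left_one (by linarith [s.delta_pos]) :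
    (fun u : ℝ => (1 - u) ^ (2 * ν + δ)) =O[𝓝[<] 1] fun u : ℝ => (1 - u) ^ (2 * ν))
  have h2 := (isBigO_refl (fun u : ℝ => (1 - u) ^ (2 * ν)) (𝓝[<] 1)).const_mul_left a
  exact (h1.add h2).congr_left fun u => by ring

theorem rel_isBigO : (fun u : ℝ => (κ u - u) / (1 - u)) =O[𝓝[<] 1] fun u : ℝ => (1 - u) ^ ν := by
  have h1 := s.rel_sub_linear.trans (isBigO_rpow_left_one (by linarith [s.nu_pos]) :
    (fun u : ℝ => (1 - u) ^ (2 * ν)) =O[𝓝[<] 1] fun u : ℝ => (1 - u) ^ ν)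
  have h2 := (isBigO_refl (fun u : ℝ => (1 - u) ^ ν) (𝓝[<] 1)).const_mul_left c
  exact (h1.add h2).congr_left fun u => by ring

theorem rel_tendsto : Tendsto (fun u : ℝ => (κ u - u) / (1 - u)) (𝓝[<] 1) (𝓝 0) :=
  s.rel_isBigO.trans_tendsto (tendsto_rpow_left_one s.nu_pos)

theorem rel_div_tendsto :
    Tendsto (fun u : ℝ => (κ u - u) / (1 - u) * (1 - u) ^ (-ν)) (𝓝[<] 1) (𝓝 c) := by
  have h1 := isBigO_rpow_mul_left_one s.rel_sub_linear
    (isBigO_refl (fun u : ℝ => (1 - u) ^ (-ν)) (𝓝[<] 1)) (γ := ν) (by linarith)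
  have h2 := (h1.trans_tendsto (tendsto_rpow_left_one s.nu_pos)).add_const c
  rw [zero_add] at h2
  refine h2.congr' ?_
  filter_upwards [eventually_left_one] with u ⟨_, ht, _⟩
  have : (1 - u) ^ ν * (1 - u) ^ (-ν) = 1 := by rw [← Real.rpow_add ht]; simp
  linear_combination -c * this

/-- An affine generating function with slope `1` at `1` is the identity, which would force `c = 0`.
-/
theorem nonAffine : NonAffine p := by
  by_contra hp
  obtain ⟨e1, e2, e3⟩ := s.pgf.affine_of_not hp
  rw [s.crit] at e1
  refine s.c_ne (tendsto_nhds_unique s.rel_div_tendsto (tendsto_const_nhds.congr' ?_))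
  filter_upwards [eventually_left_one] with u ⟨h0, ht, _⟩
  rw [e3 u ⟨by linarith, by linarith⟩, ← e1, show p 0 = 0 by linarith]
  simp

/-- Slope `1` at `1` puts the graph weakly above the diagonal; a point `w` between `u` and `1` and
the strict chord inequality from `u` to `1` make this strict at `u`. -/
theorem lt_map {u : ℝ} (hu : u ∈ Ico (0 : ℝ) 1) : u < κ u := by
  obtain ⟨w, hw1, hw2⟩ := exists_between hu.2
  have h1 := s.pgf.tangent_one_le (u := w) ⟨hu.1.trans hw1.le, hw2.le⟩
  have h2 := s.pgf.chord_lt s.nonAffine hu.1 hw1 hw2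
  rw [s.crit] at h1
  have h3 : w * (1 - u) ≤ κ w * (1 - u) := by
    refine mul_le_mul_of_nonneg_right (by linarith) (by linarith [hu.2])
  have h4 : u * (1 - w) < κ u * (1 - w) := by linarith
  exact lt_of_mul_lt_mul_right h4 (by linarith)

theorem map_lt {u : ℝ} (hu : u ∈ Ico (0 : ℝ) 1) : κ u < 1 := by
  have := s.pgf.abs_lt_one (by rw [s.crit]; norm_num) (u := u) (by rw [abs_of_nonneg hu.1]; exact hu.2)
  exact (abs_lt.1 this).2

theorem maps : MapsTo κ (Ico 0 1) (Ico 0 1) := fun _ hu =>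
  ⟨hu.1.trans (s.lt_map hu).le, s.map_lt hu⟩

/-- The constant `c` is the limit of `(κ u - u) (1 - u)^{-1-ν}`, which is nonnegative near `1`. -/
theorem c_pos : 0 < c := by
  refine lt_of_le_of_ne (ge_of_tendsto s.rel_div_tendsto ?_) s.c_ne.symm
  filter_upwards [eventually_left_one] with u ⟨h0, ht, _⟩
  have := s.lt_map (u := u) ⟨h0, by linarith⟩
  have : 0 ≤ κ u - u := by linarith
  positivity

/-- `y = log (s(κ u) / s(u))` for `s(u) = (1 - u)^{-ν}`. -/
theorem log_ratio_expansion :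
    (fun u : ℝ => -ν * Real.log (1 - (κ u - u) / (1 - u)) - (ν * c * (1 - u) ^ ν
      + (ν * a + ν * c ^ 2 / 2) * (1 - u) ^ (2 * ν)))
    =O[𝓝[<] 1] fun u : ℝ => (1 - u) ^ (2 * ν + δ) := by
  have hν := s.nu_pos
  have hδ := s.delta_le
  set x : ℝ → ℝ := fun u => (κ u - u) / (1 - u) with hx
  -- The cubic remainder of the logarithm has order `(1 - u)^{3ν}`; the condition `δ ≤ ν` puts it
  -- into the error term.
  have h3 : (fun u => x u ^ 3) =O[𝓝[<] 1] fun u : ℝ => (1 - u) ^ (2 * ν + δ) := by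
    have h2 := isBigO_rpow_mul_left_one s.rel_isBigO s.rel_isBigO (γ := 2 * ν) (by linarith)
    have := isBigO_rpow_mul_left_one h2 s.rel_isBigO (γ := 2 * ν + δ) (by linarith)
    exact this.congr_left fun u => by simp only [hx]; ring
  have h1 := (isBigO_log_sub_three.comp_tendsto s.rel_tendsto).trans h3
  have h2 : (fun u => x u ^ 2 - c ^ 2 * (1 - u) ^ (2 * ν)) =O[𝓝[<] 1]
      fun u : ℝ => (1 - u) ^ (2 * ν + δ) := by
    have hs : (fun u => x u + c * (1 - u) ^ ν) =O[𝓝[<] 1] fun u : ℝ => (1 - u) ^ ν :=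
      s.rel_isBigO.add ((isBigO_refl _ _).const_mul_left c)
    have := isBigO_rpow_mul_left_one s.rel_sub_linear hs (γ := 2 * ν + δ) (by linarith)
    refine this.congr' ?_ EventuallyEq.rfl
    filter_upwards [eventually_left_one] with u ⟨_, ht, _⟩
    have : (1 - u) ^ ν * (1 - u) ^ ν = (1 - u) ^ (2 * ν) := by rw [← Real.rpow_add ht]; ring_nf
    simp only [hx]
    rw [← this]; ring
  have := ((h1.const_mul_left ν).add (s.rel_expansion.const_mul_left ν)).add
    (h2.const_mul_left (ν / 2))
  refine this.congr_left fun u => ?_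
  simp only [hx, Function.comp_apply]
  ring

theorem log_ratio_sub_linear :
    (fun u : ℝ => -ν * Real.log (1 - (κ u - u) / (1 - u)) - ν * c * (1 - u) ^ ν)
    =O[𝓝[<] 1] fun u : ℝ => (1 - u) ^ (2 * ν) := by
  have h1 := s.log_ratio_expansion.trans (isBigO_rpow_left_one (by linarith [s.delta_pos]) :
    (fun u : ℝ => (1 - u) ^ (2 * ν + δ)) =O[𝓝[<] 1] fun u : ℝ => (1 - u) ^ (2 * ν))
  have h2 := (isBigO_refl (fun u : ℝ => (1 - u) ^ (2 * ν)) (𝓝[<] 1)).const_mul_left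
    (ν * a + ν * c ^ 2 / 2)
  exact (h1.add h2).congr_left fun u => by ring

theorem log_ratio_isBigO :
    (fun u : ℝ => -ν * Real.log (1 - (κ u - u) / (1 - u))) =O[𝓝[<] 1] fun u : ℝ => (1 - u) ^ ν := by
  have h1 := s.log_ratio_sub_linear.trans (isBigO_rpow_left_one (by linarith [s.nu_pos]) :
    (fun u : ℝ => (1 - u) ^ (2 * ν)) =O[𝓝[<] 1] fun u : ℝ => (1 - u) ^ ν)
  have h2 := (isBigO_refl (fun u : ℝ => (1 - u) ^ ν) (𝓝[<] 1)).const_mul_left (ν * c)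
  exact (h1.add h2).congr_left fun u => by ring

/-- Expansion of `s(κ u) - s(u)` for `s(u) = (1 - u)^{-ν}`. -/
theorem increment_expansion :
    (fun u : ℝ => (1 - κ u) ^ (-ν) - (1 - u) ^ (-ν) - ν * c
      - (ν * a + ν * (ν + 1) * c ^ 2 / 2) * (1 - u) ^ ν)
    =O[𝓝[<] 1] fun u : ℝ => (1 - u) ^ (ν + δ) := by
  have hν := s.nu_pos
  have hδ := s.delta_le
  set y : ℝ → ℝ := fun u => -ν * Real.log (1 - (κ u - u) / (1 - u)) with hy
  have hyO : y =O[𝓝[<] 1] fun u : ℝ => (1 - u) ^ ν := s.log_ratio_isBigO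
  have hy0 : Tendsto y (𝓝[<] 1) (𝓝 0) := hyO.trans_tendsto (tendsto_rpow_left_one hν)
  have h3 : (fun u => y u ^ 3) =O[𝓝[<] 1] fun u : ℝ => (1 - u) ^ (2 * ν + δ) := by
    have h2 := isBigO_rpow_mul_left_one hyO hyO (γ := 2 * ν) (by linarith)
    have := isBigO_rpow_mul_left_one h2 hyO (γ := 2 * ν + δ) (by linarith)
    exact this.congr_left fun u => by ring
  have h1 := (isBigO_exp_sub_three.comp_tendsto hy0).trans h3
  have h2 : (fun u => y u ^ 2 - (ν * c) ^ 2 * (1 - u) ^ (2 * ν)) =O[𝓝[<] 1]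
      fun u : ℝ => (1 - u) ^ (2 * ν + δ) := by
    have hs : (fun u => y u + ν * c * (1 - u) ^ ν) =O[𝓝[<] 1] fun u : ℝ => (1 - u) ^ ν :=
      hyO.add ((isBigO_refl _ _).const_mul_left (ν * c))
    have := isBigO_rpow_mul_left_one s.log_ratio_sub_linear hs (γ := 2 * ν + δ) (by linarith)
    refine this.congr' ?_ EventuallyEq.rfl
    filter_upwards [eventually_left_one] with u ⟨_, ht, _⟩
    have : (1 - u) ^ ν * (1 - u) ^ ν = (1 - u) ^ (2 * ν) := by rw [← Real.rpow_add ht]; ring_nf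
    simp only [hy]
    rw [← this]; ring
  have h4 := (h1.add s.log_ratio_expansion).add (h2.const_mul_left (1 / 2))
  have := isBigO_rpow_mul_left_one h4 (isBigO_refl (fun u : ℝ => (1 - u) ^ (-ν)) (𝓝[<] 1))
    (γ := ν + δ) (by linarith)
  refine this.congr' ?_ EventuallyEq.rfl
  filter_upwards [eventually_left_one] with u ⟨h0, ht, _⟩
  have hk : 0 < 1 - κ u := by linarith [s.map_lt (u := u) ⟨h0, by linarith⟩]
  have hexp : Real.exp (y u) * (1 - u) ^ (-ν) = (1 - κ u) ^ (-ν) := by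
    have e : 1 - (κ u - u) / (1 - u) = (1 - κ u) / (1 - u) := by field_simp; ring
    simp only [hy]
    rw [e, Real.log_div hk.ne' ht.ne', Real.rpow_def_of_pos ht, Real.rpow_def_of_pos hk,
      ← Real.exp_add]
    congr 1; ring
  have e1 : (1 - u) ^ ν * (1 - u) ^ (-ν) = 1 := by rw [← Real.rpow_add ht]; simp
  have e2 : (1 - u) ^ (2 * ν) * (1 - u) ^ (-ν) = (1 - u) ^ ν := by
    rw [← Real.rpow_add ht]; congr 1; ring
  simp only [Function.comp_apply]
  linear_combination hexp - ν * c * e1 - (ν * a + ν * (ν + 1) * c ^ 2 / 2) * e2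

/-- The approximate Abel function `s - A log s`, `s(u) = (1 - u)^{-ν}`. -/
theorem abel_expansion {A : ℝ} (hA : A = a / c + (ν + 1) * c / 2) :
    (fun u : ℝ => ((1 - κ u) ^ (-ν) - A * Real.log ((1 - κ u) ^ (-ν)))
      - ((1 - u) ^ (-ν) - A * Real.log ((1 - u) ^ (-ν))) - ν * c)
    =O[𝓝[<] 1] fun u : ℝ => (1 - u) ^ (ν + δ) := by
  have hδ := s.delta_le
  have h1 := s.log_ratio_sub_linear.trans (isBigO_rpow_left_one (by linarith) :
    (fun u : ℝ => (1 - u) ^ (2 * ν)) =O[𝓝[<] 1] fun u : ℝ => (1 - u) ^ (ν + δ))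
  refine (s.increment_expansion.add (h1.const_mul_left (-A))).congr' ?_ EventuallyEq.rfl
  filter_upwards [eventually_left_one] with u ⟨h0, ht, _⟩
  have hk : 0 < 1 - κ u := by linarith [s.map_lt (u := u) ⟨h0, by linarith⟩]
  have e : 1 - (κ u - u) / (1 - u) = (1 - κ u) / (1 - u) := by field_simp; ring
  -- The constant `A` is the one for which the terms of order `(1 - u)^ν` in the increments of `s`
  -- and of `A log s` cancel.
  have hAc : A * c = a + (ν + 1) * c ^ 2 / 2 := by
    rw [hA]; have := s.c_ne; field_simp
  rw [e, Real.log_div hk.ne' ht.ne', Real.log_rpow hk, Real.log_rpow ht]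
  linear_combination ν * (1 - u) ^ ν * hAc

theorem increment_tendsto :
    Tendsto (fun u : ℝ => (1 - κ u) ^ (-ν) - (1 - u) ^ (-ν)) (𝓝[<] 1) (𝓝 (ν * c)) := by
  have h1 := s.increment_expansion.trans_tendsto
    (tendsto_rpow_left_one (by linarith [s.nu_pos, s.delta_pos] : 0 < ν + δ))
  have h2 := (tendsto_rpow_left_one s.nu_pos).const_mul (ν * a + ν * (ν + 1) * c ^ 2 / 2)
  have := (h1.add h2).add_const (ν * c)
  simp only [mul_zero, add_zero, zero_add] at this
  exact this.congr fun u => by ring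

end Sparse

end IsPGF

/-! ### The sparse regime: orbits in the Abel coordinate. -/

theorem log_nat_add_sub_log_tendsto (N : ℕ) :
    Tendsto (fun L : ℕ => Real.log ((L + N : ℕ) : ℝ) - Real.log L) atTop (𝓝 0) := by
  have h1 : Tendsto (fun L : ℕ => 1 + (N : ℝ) / L) atTop (𝓝 1) := by
    simpa using (tendsto_const_div_atTop_nhds_zero_nat (N : ℝ)).const_add 1
  have h2 := h1.log one_ne_zero
  rw [Real.log_one] at h2
  refine h2.congr' ?_
  filter_upwards [eventually_gt_atTop 0] with L hL
  have hLp : (0 : ℝ) < L := Nat.cast_pos.2 hL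
  rw [← Real.log_div (by positivity) hLp.ne']
  congr 1; push_cast; field_simp

theorem continuousOn_one_sub_rpow {r ν : ℝ} (hr : r < 1) :
    ContinuousOn (fun u : ℝ => (1 - u) ^ (-ν)) (Icc 0 r) := by
  refine ContinuousOn.rpow_const (by fun_prop) fun u hu => Or.inl ?_
  linarith [hu.2]

namespace IsPGF

namespace Sparse

variable {κ : ℝ → ℝ} {p : ℕ → ℝ} {ν c a δ : ℝ} (s : Sparse κ p ν c a δ)
include s

theorem continuousOn_map_rpow {r : ℝ} (hr : r < 1) :
    ContinuousOn (fun u => (1 - κ u) ^ (-ν)) (Icc 0 r) := by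
  have hsub : Icc (0 : ℝ) r ⊆ Icc (-1) 1 := Icc_subset_Icc (by norm_num) hr.le
  refine ContinuousOn.rpow_const (continuousOn_const.sub (s.pgf.continuousOn.mono hsub))
    fun u hu => Or.inl ?_
  have := s.map_lt (u := u) ⟨hu.1, hu.2.trans_lt hr⟩
  linarith

/-- Near `1` the increment of `(1 - u)^{-ν}` is close to `νc > 0`; on the remaining compact interval
it is continuous and, as `κ u > u`, positive. The resulting linear growth is uniform in the starting
point. -/
theorem exists_increment_ge :
    ∃ d : ℝ, 0 < d ∧ ∀ u ∈ Ico (0 : ℝ) 1, (1 - u) ^ (-ν) + d ≤ (1 - κ u) ^ (-ν) := by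
  have hνc : 0 < ν * c := mul_pos s.nu_pos s.c_pos
  have hev := s.increment_tendsto.eventually_const_lt (half_lt_self hνc)
  obtain ⟨l, hl, hl'⟩ := (mem_nhdsLT_iff_exists_Ioo_subset' (show (0 : ℝ) < 1 by norm_num)).1 hev
  set r := max l 0 with hr
  have hr1 : r < 1 := max_lt hl (by norm_num)
  obtain ⟨u0, hu0, hmin⟩ := isCompact_Icc.exists_isMinOn (nonempty_Icc.2 (le_max_right l 0))
    ((s.continuousOn_map_rpow hr1).sub (continuousOn_one_sub_rpow hr1))
  have hpos : 0 < (1 - κ u0) ^ (-ν) - (1 - u0) ^ (-ν) := by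
    have hu : u0 ∈ Ico (0 : ℝ) 1 := ⟨hu0.1, hu0.2.trans_lt hr1⟩
    have h1 := s.lt_map hu
    have h2 := s.map_lt hu
    have := Real.rpow_lt_rpow_of_neg (by linarith : 0 < 1 - κ u0) (by linarith : 1 - κ u0 < 1 - u0)
      (by linarith [s.nu_pos] : -ν < 0)
    linarith
  refine ⟨min (ν * c / 2) ((1 - κ u0) ^ (-ν) - (1 - u0) ^ (-ν)), lt_min (by linarith) hpos,
    fun u hu => ?_⟩
  rcases le_or_gt u r with hle | hgt
  · have := hmin (a := u) ⟨hu.1, hle⟩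
    simp only [mem_ofPred_eq, Pi.sub_apply] at this
    linarith [min_le_right (ν * c / 2) ((1 - κ u0) ^ (-ν) - (1 - u0) ^ (-ν))]
  · have h1 : u ∈ Ioo l 1 := ⟨(le_max_left _ _).trans_lt hgt, hu.2⟩
    have := hl' h1
    simp only [mem_ofPred_eq] at this
    linarith [min_le_left (ν * c / 2) ((1 - κ u0) ^ (-ν) - (1 - u0) ^ (-ν))]

/-- The error in the approximate Abel equation. -/
def abelError (_ : Sparse κ p ν c a δ) (A u : ℝ) : ℝ :=
  ((1 - κ u) ^ (-ν) - A * Real.log ((1 - κ u) ^ (-ν)))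
      - ((1 - u) ^ (-ν) - A * Real.log ((1 - u) ^ (-ν))) - ν * c

/-- The expansion gives the bound near `1`. On the remaining compact interval the error is bounded
and `1 - u` is bounded below. -/
theorem exists_abelError_le {A : ℝ} (hA : A = a / c + (ν + 1) * c / 2) :
    ∃ C, 0 ≤ C ∧ ∀ u ∈ Ico (0 : ℝ) 1, |s.abelError A u| ≤ C * (1 - u) ^ (ν + δ) := by
  have hνδ : 0 < ν + δ := by linarith [s.nu_pos, s.delta_pos]
  obtain ⟨C, hC⟩ := (s.abel_expansion hA).bound
  obtain ⟨l, hl, hl'⟩ := (mem_nhdsLT_iff_exists_Ioo_subset' (show (0 : ℝ) < 1 by norm_num)).1 hC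
  set r := max l 0 with hr
  have hr1 : r < 1 := max_lt hl (by norm_num)
  have hne1 : ∀ u ∈ Icc (0 : ℝ) r, (1 - κ u) ^ (-ν) ≠ 0 := fun u hu => by
    have := s.map_lt (u := u) ⟨hu.1, hu.2.trans_lt hr1⟩
    exact (Real.rpow_pos_of_pos (by linarith) _).ne'
  have hne2 : ∀ u ∈ Icc (0 : ℝ) r, (1 - u) ^ (-ν) ≠ 0 := fun u hu =>
    (Real.rpow_pos_of_pos (by linarith [hu.2]) _).ne'
  have hcont : ContinuousOn (s.abelError A) (Icc 0 r) := by
    have h1 := s.continuousOn_map_rpow hr1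
    have h2 := continuousOn_one_sub_rpow (ν := ν) hr1
    exact (((h1.sub (continuousOn_const.mul (h1.log hne1))).sub
      (h2.sub (continuousOn_const.mul (h2.log hne2)))).sub continuousOn_const)
  obtain ⟨M, hM⟩ := isCompact_Icc.exists_bound_of_continuousOn hcont
  have hr0 : 0 < (1 - r) ^ (ν + δ) := Real.rpow_pos_of_pos (by linarith) _
  have hMn : 0 ≤ M := (norm_nonneg _).trans (hM 0 ⟨le_rfl, le_max_right _ _⟩)
  refine ⟨max C (M / (1 - r) ^ (ν + δ)), le_max_of_le_right (by positivity), fun u hu => ?_⟩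
  have hu1 : 0 < 1 - u := by linarith [hu.2]
  have hpow : 0 < (1 - u) ^ (ν + δ) := Real.rpow_pos_of_pos hu1 _
  rcases le_or_gt u r with hle | hgt
  · have h1 := hM u ⟨hu.1, hle⟩
    rw [Real.norm_eq_abs] at h1
    refine h1.trans (le_trans ?_ (mul_le_mul_of_nonneg_right (le_max_right _ _) hpow.le))
    rw [div_mul_eq_mul_div, le_div_iff₀ hr0]
    refine mul_le_mul_of_nonneg_left ?_ hMn
    exact Real.rpow_le_rpow (by linarith) (by linarith) hνδ.le
  · have h1 : u ∈ Ioo l 1 := ⟨(le_max_left _ _).trans_lt hgt, hu.2⟩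
    have := hl' h1
    simp only [mem_ofPred_eq] at this
    rw [Real.norm_eq_abs, Real.norm_of_nonneg hpow.le] at this
    exact this.trans (mul_le_mul_of_nonneg_right (le_max_left _ _) hpow.le)

theorem iterate_mem {u : ℝ} (hu : u ∈ Ico (0 : ℝ) 1) (L : ℕ) : κ^[L] u ∈ Ico (0 : ℝ) 1 :=
  s.maps.iterate L hu

theorem orbit_growth {d : ℝ}
    (hd : ∀ u ∈ Ico (0 : ℝ) 1, (1 - u) ^ (-ν) + d ≤ (1 - κ u) ^ (-ν)) {u : ℝ}
    (hu : u ∈ Ico (0 : ℝ) 1) (L : ℕ) : 1 + d * L ≤ (1 - κ^[L] u) ^ (-ν) := by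
  induction L with
  | zero =>
    simpa using Real.one_le_rpow_of_pos_of_le_one_of_nonpos (by linarith [hu.2])
      (by linarith [hu.1]) (by linarith [s.nu_pos] : -ν ≤ 0)
  | succ L ih =>
    rw [Function.iterate_succ_apply']
    have := hd _ (s.iterate_mem hu L)
    push_cast; linarith

/-- Along orbits the error in Abel's equation is summable, uniformly in the starting point. -/
theorem exists_summable_bound {A : ℝ} (hA : A = a / c + (ν + 1) * c / 2) :
    ∃ e : ℕ → ℝ, Summable e ∧ ∀ u ∈ Ico (0 : ℝ) 1, ∀ L, |s.abelError A (κ^[L] u)| ≤ e L := by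
  obtain ⟨C, hC0, hC⟩ := s.exists_abelError_le hA
  obtain ⟨d, hd0, hd⟩ := s.exists_increment_ge
  have hν := s.nu_pos
  have hδ := s.delta_pos
  -- With this `m` the growth `1 + d L` is at least `m (L + 1)`, so the error is bounded by a
  -- multiple of `(L + 1)^{-(ν+δ)/ν}`, whose exponent is below `-1`.
  set m := min 1 d with hm
  have hm0 : 0 < m := lt_min one_pos hd0
  refine ⟨fun L => C * (m ^ (-((ν + δ) / ν)) * ((L + 1 : ℕ) : ℝ) ^ (-((ν + δ) / ν))), ?_,
    fun u hu L => ?_⟩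
  · refine ((Summable.mul_left _ ?_)).mul_left C
    have h1 : -((ν + δ) / ν) < -1 := by rw [neg_lt_neg_iff, one_lt_div hν]; linarith
    exact (summable_nat_add_iff 1).2 (Real.summable_nat_rpow.2 h1)
  · have hx := s.iterate_mem hu L
    refine (hC _ hx).trans (mul_le_mul_of_nonneg_left ?_ hC0)
    have hg := s.orbit_growth hd hu L
    set x := κ^[L] u
    have hx1 : 0 < 1 - x := by linarith [hx.2]
    have e : (1 - x) ^ (ν + δ) = ((1 - x) ^ (-ν)) ^ (-((ν + δ) / ν)) := by
      rw [← Real.rpow_mul hx1.le]; congr 1; field_simp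
    rw [e, ← Real.mul_rpow hm0.le (by positivity)]
    refine Real.rpow_le_rpow_of_nonpos (by positivity) ?_ (by rw [neg_nonpos]; positivity)
    refine le_trans ?_ hg
    push_cast
    have h1 := min_le_left 1 d
    have h2 : m * L ≤ d * L := mul_le_mul_of_nonneg_right (min_le_right 1 d) (Nat.cast_nonneg L)
    linarith

/-- The approximate Abel function. -/
def abel (_ : Sparse κ p ν c a δ) (A u : ℝ) : ℝ :=
  (1 - u) ^ (-ν) - A * Real.log ((1 - u) ^ (-ν))

theorem abel_iterate (A u : ℝ) (L : ℕ) : s.abel A (κ^[L] u)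
    = s.abel A u + ν * c * L + ∑ k ∈ Finset.range L, s.abelError A (κ^[k] u) := by
  induction L with
  | zero => simp
  | succ L ih =>
    rw [Finset.sum_range_succ, Function.iterate_succ_apply']
    have : s.abel A (κ (κ^[L] u)) = s.abel A (κ^[L] u) + ν * c + s.abelError A (κ^[L] u) := by
      simp only [abel, abelError]; ring
    rw [this, ih]; push_cast; ring

/-- The errors telescope against a summable sequence that does not depend on `u`. This uniformity is
what the bounds near `1` rest on; the pointwise limit needs summability only. -/
theorem abel_uniform {A : ℝ} (hA : A = a / c + (ν + 1) * c / 2) :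
    ∃ E, ∀ u ∈ Ico (0 : ℝ) 1, ∀ L : ℕ, |s.abel A (κ^[L] u) - s.abel A u - ν * c * L| ≤ E := by
  obtain ⟨e, he, hbd⟩ := s.exists_summable_bound hA
  refine ⟨∑' k, e k, fun u hu L => ?_⟩
  rw [s.abel_iterate]
  have e1 : s.abel A u + ν * c * L + ∑ k ∈ Finset.range L, s.abelError A (κ^[k] u) - s.abel A u
      - ν * c * L = ∑ k ∈ Finset.range L, s.abelError A (κ^[k] u) := by ring
  rw [e1]
  refine (Finset.abs_sum_le_sum_abs _ _).trans ((Finset.sum_le_sum fun k _ => hbd u hu k).trans ?_)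
  exact he.sum_le_tsum _ fun k _ => (abs_nonneg _).trans (hbd u hu k)

theorem abel_tendsto {A : ℝ} (hA : A = a / c + (ν + 1) * c / 2) {u : ℝ} (hu : u ∈ Ico (0 : ℝ) 1) :
    ∃ S, Tendsto (fun L : ℕ => s.abel A (κ^[L] u) - ν * c * L) atTop (𝓝 S) := by
  obtain ⟨e, he, hbd⟩ := s.exists_summable_bound hA
  have hs : Summable fun k => s.abelError A (κ^[k] u) := Summable.of_norm_bounded he (hbd u hu)
  refine ⟨s.abel A u + ∑' k, s.abelError A (κ^[k] u),
    (hs.hasSum.tendsto_sum_nat.const_add (s.abel A u)).congr fun L => ?_⟩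
  rw [s.abel_iterate]; ring

theorem orbit_tendsto_atTop {u : ℝ} (hu : u ∈ Ico (0 : ℝ) 1) :
    Tendsto (fun L : ℕ => (1 - κ^[L] u) ^ (-ν)) atTop atTop := by
  obtain ⟨d, hd0, hd⟩ := s.exists_increment_ge
  refine tendsto_atTop_mono (fun L => s.orbit_growth hd hu L) ?_
  exact tendsto_atTop_add_const_left _ _ (tendsto_natCast_atTop_atTop.const_mul_atTop hd0)

/-- The Abel function grows like `νcL`, and its logarithmic term is negligible against `s`. This
first order law is then fed back to evaluate `log s` in the second order expansion. -/
theorem orbit_div_tendsto {u : ℝ} (hu : u ∈ Ico (0 : ℝ) 1) :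
    Tendsto (fun L : ℕ => (1 - κ^[L] u) ^ (-ν) / L) atTop (𝓝 (ν * c)) := by
  obtain ⟨S, hS⟩ := s.abel_tendsto rfl hu
  set A := a / c + (ν + 1) * c / 2
  have htop := s.orbit_tendsto_atTop hu
  set σ : ℕ → ℝ := fun L => (1 - κ^[L] u) ^ (-ν) with hσ
  have hlog : Tendsto (fun L => Real.log (σ L) / σ L) atTop (𝓝 0) := by
    have := Real.isLittleO_log_id_atTop.tendsto_div_nhds_zero
    exact this.comp htop
  have h1 : Tendsto (fun L : ℕ => s.abel A (κ^[L] u) / L) atTop (𝓝 (ν * c)) := by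
    have hS0 := hS.div_atTop (tendsto_natCast_atTop_atTop (R := ℝ))
    have := hS0.add_const (ν * c)
    rw [zero_add] at this
    refine this.congr' ?_
    filter_upwards [eventually_gt_atTop 0] with L hL
    have : (0 : ℝ) < L := Nat.cast_pos.2 hL
    field_simp; ring
  have h2 : Tendsto (fun L => 1 - A * (Real.log (σ L) / σ L)) atTop (𝓝 1) := by
    simpa using (hlog.const_mul A).const_sub 1
  have h3 := h1.div h2 one_ne_zero
  rw [div_one] at h3
  refine h3.congr' ?_
  filter_upwards [eventually_gt_atTop 0, htop.eventually_gt_atTop 0,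
    h2.eventually_ne one_ne_zero] with L hL hσL hne
  have hLp : (0 : ℝ) < L := Nat.cast_pos.2 hL
  have e : s.abel A (κ^[L] u) = σ L * (1 - A * (Real.log (σ L) / σ L)) := by
    simp only [abel]
    rw [mul_sub, mul_one, mul_left_comm, mul_div_cancel₀ _ hσL.ne']
  simp only [Pi.div_apply]
  rw [e, div_right_comm, mul_div_cancel_right₀ _ hne]

theorem log_orbit_tendsto {u : ℝ} (hu : u ∈ Ico (0 : ℝ) 1) :
    Tendsto (fun L : ℕ => Real.log ((1 - κ^[L] u) ^ (-ν)) - Real.log L) atTop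
      (𝓝 (Real.log (ν * c))) := by
  have hνc : 0 < ν * c := mul_pos s.nu_pos s.c_pos
  refine ((s.orbit_div_tendsto hu).log hνc.ne').congr' ?_
  filter_upwards [eventually_gt_atTop 0, (s.orbit_tendsto_atTop hu).eventually_gt_atTop 0]
    with L hL hσL
  rw [Real.log_div hσL.ne' (Nat.cast_pos.2 hL).ne']

/-- Adding `A log s = A log L + A log (νc) + o(1)` to the limit of the Abel function produces the
logarithmic correction. -/
theorem orbit_expansion_nonneg {A : ℝ} (hA : A = a / c + (ν + 1) * c / 2) {u : ℝ}
    (hu : u ∈ Ico (0 : ℝ) 1) :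
    ∃ S, Tendsto (fun L : ℕ => (1 - κ^[L] u) ^ (-ν) - ν * c * L - A * Real.log L) atTop (𝓝 S) := by
  obtain ⟨S, hS⟩ := s.abel_tendsto hA hu
  refine ⟨_, (hS.add ((s.log_orbit_tendsto hu).const_mul A)).congr fun L => ?_⟩
  simp only [abel]; ring

theorem iterate_tendsto_one {u : ℝ} (hu : u ∈ Ico (0 : ℝ) 1) :
    Tendsto (fun L : ℕ => κ^[L] u) atTop (𝓝 1) := by
  have h := (tendsto_rpow_neg_atTop (inv_pos.2 s.nu_pos)).comp (s.orbit_tendsto_atTop hu)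
  have h2 := h.const_sub 1
  rw [sub_zero] at h2
  refine h2.congr fun L => ?_
  have hx := s.iterate_mem hu L
  have hν := s.nu_pos
  simp only [Function.comp_apply]
  rw [← Real.rpow_mul (by linarith [hx.2])]
  field_simp
  rw [Real.rpow_one]; ring

/-- The lower bound `κ_N(0) - (κ_N(|u|) - κ_N(0))` for `κ_N(u)` tends to `1`, so negative starting
points also become nonnegative after finitely many steps. -/
theorem exists_iterate_mem {u : ℝ} (hu : |u| < 1) : ∃ N : ℕ, κ^[N] u ∈ Ico (0 : ℝ) 1 := by
  have h0 := s.iterate_tendsto_one (u := 0) (by norm_num)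
  have h1 := s.iterate_tendsto_one (u := |u|) ⟨abs_nonneg u, hu⟩
  have h2 := (h0.sub (h1.sub h0)).eventually_const_lt (show (0 : ℝ) < 1 - (1 - 1) by norm_num)
  obtain ⟨N, hN⟩ := h2.exists
  have h3 := s.pgf.iterate_abs_lt_one (by rw [s.crit]; norm_num) hu N
  have h4 := (abs_le.1 (s.pgf.iterate_increment (abs_le.1 hu.le) N)).1
  exact ⟨N, by linarith, (abs_lt.1 h3).2⟩

theorem orbit_expansion {A : ℝ} (hA : A = a / c + (ν + 1) * c / 2) {u : ℝ} (hu : |u| < 1) :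
    ∃ S, Tendsto (fun L : ℕ => (1 - κ^[L] u) ^ (-ν) - ν * c * L - A * Real.log L) atTop (𝓝 S) := by
  obtain ⟨N, hN⟩ := s.exists_iterate_mem hu
  obtain ⟨S, hS⟩ := s.orbit_expansion_nonneg hA hN
  refine ⟨S - A * 0 - ν * c * N, ?_⟩
  rw [← tendsto_add_atTop_iff_nat N]
  refine ((hS.sub ((log_nat_add_sub_log_tendsto N).const_mul A)).sub_const (ν * c * N)).congr
    fun L => ?_
  rw [Function.iterate_add_apply]
  push_cast; ring

end Sparse

end IsPGF

/-! ### The sparse regime: from the Abel coordinate back to the iterates. -/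

theorem one_sub_rpow_neg_le {ρ z : ℝ} (hρ : 0 ≤ ρ) (hz : 0 < 1 + z) :
    1 - (1 + z) ^ (-ρ) ≤ ρ * z := by
  rw [Real.rpow_def_of_pos hz]
  have h1 := Real.add_one_le_exp (Real.log (1 + z) * -ρ)
  have h2 := mul_le_mul_of_nonneg_left (Real.log_le_sub_one_of_pos hz) hρ
  linarith

/-- The upper bound applied to `1 / (1 + z)` bounds `(1 + z)^ρ` from below, and inversion gives the
claim. -/
theorem le_one_sub_rpow_neg {ρ z : ℝ} (hρ : 0 ≤ ρ) (hz : 0 < 1 + z) (hz' : 0 < 1 + (1 + ρ) * z) :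
    ρ * z / (1 + (1 + ρ) * z) ≤ 1 - (1 + z) ^ (-ρ) := by
  have h1 := one_sub_rpow_neg_le (z := (1 + z)⁻¹ - 1) hρ (by ring_nf; positivity)
  have e1 : 1 + ((1 + z)⁻¹ - 1) = (1 + z)⁻¹ := by ring
  rw [e1, Real.inv_rpow hz.le, ← Real.rpow_neg hz.le, neg_neg] at h1
  have h3 : (1 + (1 + ρ) * z) / (1 + z) ≤ (1 + z) ^ ρ := by
    have : (1 + (1 + ρ) * z) / (1 + z) = 1 - ρ * ((1 + z)⁻¹ - 1) := by field_simp; ring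
    rw [this]; linarith
  rw [Real.rpow_neg hz.le]
  have h4 := inv_anti₀ (div_pos hz' hz) h3
  rw [inv_div] at h4
  have : ρ * z / (1 + (1 + ρ) * z) = 1 - (1 + z) / (1 + (1 + ρ) * z) := by
    rw [eq_sub_iff_add_eq, ← add_div, div_eq_one_iff_eq hz'.ne']; ring
  rw [this]; linarith

theorem min_one_le_one_sub_rpow_neg {ρ x : ℝ} (hρ : 0 ≤ ρ) (hx : 0 ≤ x) :
    ρ / (2 + ρ) * min 1 x ≤ 1 - (1 + x) ^ (-ρ) := by
  refine le_trans ?_ (le_one_sub_rpow_neg hρ (by linarith) (by positivity))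
  rw [div_mul_eq_mul_div, div_le_div_iff₀ (by positivity) (by positivity), mul_assoc, mul_assoc]
  refine mul_le_mul_of_nonneg_left ?_ hρ
  rcases le_total 1 x with h | h
  · rw [min_eq_left h]; nlinarith
  · rw [min_eq_right h]; exact mul_le_mul_of_nonneg_left (by nlinarith) hx

theorem tendsto_log_sq_div_nat : Tendsto (fun L : ℕ => Real.log L ^ 2 / L) atTop (𝓝 0) :=
  ((Real.isLittleO_pow_log_id_atTop (n := 2)).tendsto_div_nhds_zero).comp tendsto_natCast_atTop_atTop

theorem tendsto_log_div_nat : Tendsto (fun L : ℕ => Real.log L / L) atTop (𝓝 0) :=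
  (Real.isLittleO_log_id_atTop.tendsto_div_nhds_zero).comp tendsto_natCast_atTop_atTop

/-- If `σ_L = B L + A log L + S + o(1)` then `L (1 - (σ_L / (B L))^{-ρ})` is
`(ρ / B) (A log L + S) + o(1)`. -/
theorem rpow_neg_expansion {σ : ℕ → ℝ} {A B S ρ : ℝ} (hB : 0 < B) (hρ : 0 < ρ)
    (h : Tendsto (fun L : ℕ => σ L - B * L - A * Real.log L) atTop (𝓝 S)) :
    Tendsto (fun L : ℕ => L * (1 - (σ L / (B * L)) ^ (-ρ)) - ρ / B * A * Real.log L) atTop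
      (𝓝 (ρ / B * S)) := by
  set z : ℕ → ℝ := fun L => σ L / (B * L) - 1 with hz
  have hLz : ∀ᶠ L : ℕ in atTop, L * z L = B⁻¹ * (σ L - B * L - A * Real.log L)
      + B⁻¹ * A * Real.log L := by
    filter_upwards [eventually_gt_atTop 0] with L hL
    have : (0 : ℝ) < L := Nat.cast_pos.2 hL
    simp only [hz]; field_simp; ring
  -- The relative deviation `z` is of order at most `log L / L`, so its square is negligible even
  -- after multiplication by `L`.
  have hLz2 : Tendsto (fun L : ℕ => L * z L ^ 2) atTop (𝓝 0) := by
    set y : ℕ → ℝ := fun L => σ L - B * L - A * Real.log L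
    have h1 : Tendsto (fun L : ℕ => B⁻¹ ^ 2 * (y L ^ 2 / L) + 2 * B⁻¹ ^ 2 * A * y L * (Real.log L / L)
        + (B⁻¹ * A) ^ 2 * (Real.log L ^ 2 / L)) atTop
        (𝓝 (B⁻¹ ^ 2 * 0 + 2 * B⁻¹ ^ 2 * A * S * 0 + (B⁻¹ * A) ^ 2 * 0)) :=
      ((((h.pow 2).div_atTop tendsto_natCast_atTop_atTop).const_mul _).add
        ((h.const_mul _).mul tendsto_log_div_nat)).add (tendsto_log_sq_div_nat.const_mul _)
    simp only [mul_zero, add_zero] at h1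
    refine h1.congr' ?_
    filter_upwards [hLz, eventually_gt_atTop 0] with L h2 hL
    have : (0 : ℝ) < L := Nat.cast_pos.2 hL
    have e : (L : ℝ) * z L ^ 2 = (L * z L) ^ 2 / L := by field_simp
    rw [e, h2]; ring
  have hz0 : Tendsto z atTop (𝓝 0) := by
    have h1 : Tendsto (fun L : ℕ => z L ^ 2) atTop (𝓝 0) := by
      refine (hLz2.div_atTop tendsto_natCast_atTop_atTop).congr' ?_
      filter_upwards [eventually_gt_atTop 0] with L hL
      have : (0 : ℝ) < L := Nat.cast_pos.2 hL
      field_simp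
    have h2 := h1.sqrt
    simp only [Real.sqrt_sq_eq_abs, Real.sqrt_zero] at h2
    exact (tendsto_zero_iff_abs_tendsto_zero z).2 h2
  have herr : Tendsto (fun L : ℕ => L * (1 - (1 + z L) ^ (-ρ)) - L * (ρ * z L)) atTop (𝓝 0) := by
    refine squeeze_zero_norm' (a := fun L : ℕ => 2 * (ρ * (1 + ρ)) * (L * z L ^ 2)) ?_
      (by simpa using hLz2.const_mul (2 * (ρ * (1 + ρ))))
    have hsm : ∀ᶠ L in atTop, |(1 + ρ) * z L| < 1 / 2 := by
      have := (hz0.const_mul (1 + ρ)).abs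
      simp only [mul_zero, abs_zero] at this
      exact this.eventually_lt_const (by norm_num)
    filter_upwards [hsm, hz0.eventually_const_lt (show (-1 : ℝ) < 0 by norm_num)] with L h1 h2
    have h1' := abs_lt.1 h1
    have hd : 0 < 1 + (1 + ρ) * z L := by linarith
    have h3 := one_sub_rpow_neg_le hρ.le (show 0 < 1 + z L by linarith)
    have h4 := le_one_sub_rpow_neg hρ.le (show 0 < 1 + z L by linarith) hd
    have h5 : ρ * z L - 2 * (ρ * (1 + ρ)) * z L ^ 2 ≤ ρ * z L / (1 + (1 + ρ) * z L) := by
      rw [le_div_iff₀ hd]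
      have h6 : 0 ≤ ρ * (1 + ρ) * z L ^ 2 := by positivity
      have h7 := mul_nonneg h6 (show 0 ≤ 1 + 2 * ((1 + ρ) * z L) by linarith)
      linarith
    have hL : (0 : ℝ) ≤ L := Nat.cast_nonneg L
    rw [Real.norm_eq_abs, ← mul_sub, abs_mul, abs_of_nonneg hL, mul_left_comm]
    refine mul_le_mul_of_nonneg_left (abs_le.2 ⟨by linarith, ?_⟩) hL
    have h6 : 0 ≤ ρ * (1 + ρ) * z L ^ 2 := by positivity
    linarith
  have hfin := herr.add (h.const_mul (ρ / B))
  rw [zero_add] at hfin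
  refine hfin.congr' ?_
  filter_upwards [hLz] with L h1
  have e1 : 1 + z L = σ L / (B * L) := by simp [hz]
  have e2 : (L : ℝ) * (ρ * z L) = ρ * (L * z L) := by ring
  rw [e1, e2, h1]; ring

namespace IsPGF

namespace Sparse

variable {κ : ℝ → ℝ} {p : ℕ → ℝ} {ν c a δ : ℝ} (s : Sparse κ p ν c a δ)
include s

theorem one_sub_iterate {u : ℝ} {L : ℕ} (hu : κ^[L] u < 1) :
    1 - κ^[L] u = ((1 - κ^[L] u) ^ (-ν)) ^ (-ν⁻¹) := by
  rw [← Real.rpow_mul (by linarith), neg_mul_neg, mul_inv_cancel₀ s.nu_pos.ne', Real.rpow_one]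

/-- Since `1 - κ_L(u)` is the power `-1/ν` of `(1 - κ_L(u))^{-ν}`, the expansion of the latter up to
`o(1)` determines `κ_L(u)` up to `o(w_L)`; the limit is a multiple of the constant `S`. -/
theorem renorm_limit {A : ℝ} (hA : A = a / c + (ν + 1) * c / 2) {u : ℝ} (hu : |u| < 1) :
    ∃ B, Tendsto (fun L : ℕ => (κ^[L] u - (1 - (ν * c) ^ (-ν⁻¹) * (L : ℝ) ^ (-ν⁻¹)
      + (ν * c) ^ (-ν⁻¹) * ν⁻¹ * A / (ν * c) * (L : ℝ) ^ (-(ν⁻¹ + 1)) * Real.log L))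
        / (L : ℝ) ^ (-(ν⁻¹ + 1))) atTop (𝓝 B) := by
  obtain ⟨S, hS⟩ := s.orbit_expansion hA hu
  have hνc : 0 < ν * c := mul_pos s.nu_pos s.c_pos
  have h1 := (rpow_neg_expansion hνc (inv_pos.2 s.nu_pos) hS).const_mul ((ν * c) ^ (-ν⁻¹))
  refine ⟨_, h1.congr' ?_⟩
  filter_upwards [eventually_gt_atTop 0] with L hL
  have hLp : (0 : ℝ) < L := Nat.cast_pos.2 hL
  have hx := (abs_lt.1 (s.pgf.iterate_abs_lt_one (by rw [s.crit]; norm_num) hu L)).2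
  have hσ : 0 < (1 - κ^[L] u) ^ (-ν) := Real.rpow_pos_of_pos (by linarith) _
  have e1 := s.one_sub_iterate hx
  rw [Real.div_rpow hσ.le (by positivity), Real.mul_rpow hνc.le hLp.le, ← e1]
  have e2 : (L : ℝ) ^ (-(ν⁻¹ + 1)) = (L : ℝ) ^ (-ν⁻¹) / L := by
    rw [neg_add, Real.rpow_add hLp, Real.rpow_neg_one, div_eq_mul_inv]
  rw [e2]
  have h3 : 0 < (L : ℝ) ^ (-ν⁻¹) := Real.rpow_pos_of_pos hLp _
  have h4 : 0 < (ν * c) ^ (-ν⁻¹) := Real.rpow_pos_of_pos hνc _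
  set X := (L : ℝ) ^ (-ν⁻¹)
  set Y := (ν * c) ^ (-ν⁻¹)
  have hc := s.c_pos
  have hν := s.nu_pos
  field_simp
  ring

/-- The increments of the orbits in the coordinate `(1 - u)^{-ν}`. -/
theorem orbit_increment : ∃ C : ℝ, 0 < C ∧ ∃ R : ℝ, 1 ≤ R ∧ ∀ᶠ L : ℕ in atTop,
    ∀ u ∈ Ico (0 : ℝ) 1,
      (1 - κ^[L] u) ^ (-ν) - (1 - κ^[L] 0) ^ (-ν) ≤ C * (1 - u) ^ (-ν) ∧
      (R ≤ (1 - u) ^ (-ν) →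
        (1 - u) ^ (-ν) / 3 ≤ (1 - κ^[L] u) ^ (-ν) - (1 - κ^[L] 0) ^ (-ν)) := by
  obtain ⟨E, hE⟩ := s.abel_uniform rfl
  set A := a / c + (ν + 1) * c / 2
  have h0 : (0 : ℝ) ∈ Ico (0 : ℝ) 1 := by norm_num
  have hE0 : 0 ≤ E := (abs_nonneg _).trans (hE 0 h0 0)
  have hν := s.nu_pos
  have hlog : ∀ᶠ x : ℝ in atTop, |A| * Real.log x + 1 + 2 * E ≤ x / 2 := by
    have h1 : Tendsto (fun x : ℝ => |A| * (Real.log x / x) + (1 + 2 * E) / x) atTop (𝓝 0) := by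
      simpa using ((Real.isLittleO_log_id_atTop.tendsto_div_nhds_zero).const_mul |A|).add
        ((tendsto_const_nhds (x := 1 + 2 * E)).div_atTop tendsto_id)
    filter_upwards [h1.eventually_lt_const (show (0 : ℝ) < 1 / 2 by norm_num),
      eventually_gt_atTop 0] with x h2 h3
    have := mul_lt_mul_of_pos_right h2 h3
    rw [add_mul, mul_assoc, div_mul_cancel₀ _ h3.ne', div_mul_cancel₀ _ h3.ne'] at this
    linarith
  obtain ⟨R, hR⟩ := eventually_atTop.1 hlog
  refine ⟨2 * (1 + |A| + 2 * E), by positivity, max R 1, le_max_right _ _, ?_⟩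
  filter_upwards [(s.orbit_tendsto_atTop h0).eventually_ge_atTop (2 * |A| + 1)] with L hL u hu
  have hx0 := s.iterate_mem h0 L
  have hx := s.iterate_mem hu L
  have hmono : κ^[L] 0 ≤ κ^[L] u :=
    s.pgf.iterate_monotoneOn L ⟨le_rfl, zero_le_one⟩ ⟨hu.1, hu.2.le⟩ hu.1
  have hσ : (1 - κ^[L] 0) ^ (-ν) ≤ (1 - κ^[L] u) ^ (-ν) :=
    Real.rpow_le_rpow_of_nonpos (by linarith [hx.2]) (by linarith) (by linarith)
  have hs1 : 1 ≤ (1 - u) ^ (-ν) := Real.one_le_rpow_of_pos_of_le_one_of_nonpos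
    (by linarith [hu.2]) (by linarith [hu.1]) (by linarith)
  have a1 := abs_le.1 (hE u hu L)
  have a2 := abs_le.1 (hE 0 h0 L)
  simp only [abel, sub_zero, Real.one_rpow, Real.log_one, mul_zero] at a1 a2
  set x := (1 - κ^[L] u) ^ (-ν)
  set y := (1 - κ^[L] 0) ^ (-ν)
  set t := (1 - u) ^ (-ν)
  have hA0 := abs_nonneg A
  have hy : 0 < y := by linarith
  have hxp : 0 < x := by linarith
  have hlogd : |A * (Real.log x - Real.log y)| ≤ (x - y) / 2 := by
    have h1 : 0 ≤ Real.log x - Real.log y := by linarith [Real.log_le_log hy hσ]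
    have h2 : Real.log x - Real.log y ≤ (x - y) / y := by
      rw [← Real.log_div hxp.ne' hy.ne', sub_div, div_self hy.ne']
      exact Real.log_le_sub_one_of_pos (by positivity)
    rw [abs_mul, abs_of_nonneg h1]
    refine (mul_le_mul_of_nonneg_left h2 hA0).trans ?_
    rw [← mul_div_assoc, div_le_div_iff₀ hy two_pos]
    have := mul_le_mul_of_nonneg_right (show 2 * |A| ≤ y by linarith) (sub_nonneg.2 hσ)
    linarith
  have b1 := abs_le.1 hlogd
  have hlt : |A * Real.log t| ≤ |A| * Real.log t := by
    rw [abs_mul, abs_of_nonneg (Real.log_nonneg hs1)]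
  have b2 := abs_le.1 hlt
  constructor
  · have h1 : Real.log t ≤ t := (Real.log_le_sub_one_of_pos (by linarith)).trans (by linarith)
    have h2 := mul_le_mul_of_nonneg_left h1 hA0
    have h3 := mul_le_mul_of_nonneg_left hs1 hE0
    linarith
  · intro hRt
    have := hR t ((le_max_left _ _).trans hRt)
    linarith

/-- In terms of the relative increment `z` of the Abel coordinate the difference is `(1 - κ_L(0)) (1
- (1 + z)^{-1/ν})`, to which the elementary two-sided bounds apply. -/
theorem sub_iterate_eq {u : ℝ} (hu : u ∈ Ico (0 : ℝ) 1) (L : ℕ) :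
    κ^[L] u - κ^[L] 0 = (1 - κ^[L] 0) *
      (1 - (1 + ((1 - κ^[L] u) ^ (-ν) - (1 - κ^[L] 0) ^ (-ν)) / (1 - κ^[L] 0) ^ (-ν)) ^ (-ν⁻¹)) := by
  have hx := (s.iterate_mem hu L).2
  have hy := (s.iterate_mem (u := 0) (by norm_num) L).2
  have hσ : 0 < (1 - κ^[L] u) ^ (-ν) := Real.rpow_pos_of_pos (by linarith) _
  have hσ0 : 0 < (1 - κ^[L] 0) ^ (-ν) := Real.rpow_pos_of_pos (by linarith) _
  have e : 1 + ((1 - κ^[L] u) ^ (-ν) - (1 - κ^[L] 0) ^ (-ν)) / (1 - κ^[L] 0) ^ (-ν)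
      = (1 - κ^[L] u) ^ (-ν) / (1 - κ^[L] 0) ^ (-ν) := by field_simp; ring
  rw [e, Real.div_rpow hσ.le hσ0.le, ← s.one_sub_iterate hx, ← s.one_sub_iterate hy, mul_sub, mul_one,
    mul_div_cancel₀ _ (by linarith)]
  ring

theorem renormLimit {A : ℝ} (hA : A = a / c + (ν + 1) * c / 2) :
    ∃ β, RenormLimit κ ν ((ν * c) ^ (-ν⁻¹)) (fun L => (L : ℝ)⁻¹)
      (fun L => 1 - (ν * c) ^ (-ν⁻¹) * (L : ℝ) ^ (-ν⁻¹)
        + (ν * c) ^ (-ν⁻¹) * ν⁻¹ * A / (ν * c) * (L : ℝ) ^ (-(ν⁻¹ + 1)) * Real.log L)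
      (fun L => (L : ℝ) ^ (-(ν⁻¹ + 1))) β := by
  have hν := s.nu_pos
  have hνc : 0 < ν * c := mul_pos s.nu_pos s.c_pos
  have hρ := inv_pos.2 hν
  have h0 : (0 : ℝ) ∈ Ico (0 : ℝ) 1 := by norm_num
  choose! β hβ using fun (u : ℝ) (hu : |u| < 1) => s.renorm_limit hA hu
  obtain ⟨C, hC, R, hR, hinc⟩ := s.orbit_increment
  have hw : ∀ {L : ℕ}, 0 < L → (L : ℝ) ^ (-(ν⁻¹ + 1)) = (L : ℝ) ^ (-ν⁻¹) * (L : ℝ)⁻¹ := fun hL => by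
    rw [neg_add, Real.rpow_add (Nat.cast_pos.2 hL), Real.rpow_neg_one]
  refine ⟨β, hν, Real.rpow_pos_of_pos hνc _, ?_, tendsto_inv_atTop_nhds_zero_nat, ?_, ?_, ?_,
    fun u hu => hβ u (abs_lt.2 hu), ?_, ?_⟩
  · filter_upwards [eventually_gt_atTop 0] with L hL
    exact inv_pos.2 (Nat.cast_pos.2 hL)
  · filter_upwards [eventually_gt_atTop 0] with L hL
    exact Real.rpow_pos_of_pos (Nat.cast_pos.2 hL) _
  · have h1 := (s.orbit_div_tendsto h0).rpow_const (p := -ν⁻¹) (Or.inl hνc.ne')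
    refine h1.congr' ?_
    filter_upwards [eventually_gt_atTop 0] with L hL
    have hLp : (0 : ℝ) < L := Nat.cast_pos.2 hL
    have hx := (s.iterate_mem h0 L).2
    rw [Real.div_rpow (Real.rpow_nonneg (by linarith) _) hLp.le, ← s.one_sub_iterate hx, hw hL]
    have := Real.rpow_pos_of_pos hLp (-ν⁻¹)
    field_simp
  · refine ⟨2 ^ (ν⁻¹ + 1), ?_⟩
    filter_upwards [eventually_gt_atTop 0] with L hL
    have hLp : (1 : ℝ) ≤ L := Nat.one_le_cast.2 hL
    have h2 : ((2 : ℝ) ^ (ν⁻¹ + 1)) = (2⁻¹ : ℝ) ^ (-(ν⁻¹ + 1)) := by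
      rw [Real.rpow_neg (by norm_num), Real.inv_rpow (by norm_num), inv_inv]
    rw [h2, ← Real.mul_rpow (by norm_num) (by positivity)]
    refine Real.rpow_le_rpow_of_nonpos (by positivity) ?_ (by linarith)
    push_cast; linarith
  · obtain ⟨d, hd0, hd⟩ := s.exists_increment_ge
    -- The bound `1 - (1 + z)^{-ρ} ≤ ρ z` leaves `ρ (x - y) y^{-(ρ+1)}`, with `x - y ≤ C (1 -
    -- u)^{-ν}` and `y ≥ d L`.
    refine ⟨d ^ (-(ν⁻¹ + 1)) * ν⁻¹ * C, ?_⟩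
    filter_upwards [hinc, eventually_gt_atTop 0] with L hL hLpos u hu
    have hLp : (0 : ℝ) < L := Nat.cast_pos.2 hLpos
    have hx := (s.iterate_mem hu L).2
    have hy := (s.iterate_mem h0 L).2
    have hmono : κ^[L] 0 ≤ κ^[L] u :=
      s.pgf.iterate_monotoneOn L ⟨le_rfl, zero_le_one⟩ ⟨hu.1, hu.2.le⟩ hu.1
    have hσ : (1 - κ^[L] 0) ^ (-ν) ≤ (1 - κ^[L] u) ^ (-ν) :=
      Real.rpow_le_rpow_of_nonpos (by linarith) (by linarith) (by linarith)
    have hg := s.orbit_growth hd h0 L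
    rw [s.sub_iterate_eq hu L]
    set x := (1 - κ^[L] u) ^ (-ν)
    set y := (1 - κ^[L] 0) ^ (-ν) with hyd
    have hdL : 0 < d * L := by positivity
    have hyp : 0 < y := by linarith
    have e1 := s.one_sub_iterate hy
    rw [← hyd] at e1
    have h1 := one_sub_rpow_neg_le (z := (x - y) / y) hρ.le
      (by have := div_nonneg (sub_nonneg.2 hσ) hyp.le; linarith)
    have h2 := mul_le_mul_of_nonneg_left h1 (sub_nonneg.2 hy.le)
    refine h2.trans ?_
    have h3 : (1 - κ^[L] 0) * (ν⁻¹ * ((x - y) / y)) = ν⁻¹ * (x - y) * y ^ (-(ν⁻¹ + 1)) := by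
      rw [e1, neg_add, Real.rpow_add hyp, Real.rpow_neg_one]; ring
    rw [h3]
    have h4 : y ^ (-(ν⁻¹ + 1)) ≤ (d * L) ^ (-(ν⁻¹ + 1)) :=
      Real.rpow_le_rpow_of_nonpos hdL (by linarith) (by linarith)
    have h5 := (hL u hu).1
    calc ν⁻¹ * (x - y) * y ^ (-(ν⁻¹ + 1))
        ≤ ν⁻¹ * (C * (1 - u) ^ (-ν)) * (d * L) ^ (-(ν⁻¹ + 1)) := by
          refine mul_le_mul (mul_le_mul_of_nonneg_left h5 hρ.le) h4 (Real.rpow_nonneg hyp.le _) ?_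
          have := Real.rpow_nonneg (show 0 ≤ 1 - u by linarith [hu.2]) (-ν)
          positivity
      _ = _ := by rw [Real.mul_rpow hd0.le hLp.le]; ring
  · set C1 := ν * c + 1
    have hC1 : 0 < C1 := by positivity
    have hs0 := (s.orbit_div_tendsto h0).eventually_lt_const (show ν * c < C1 by simp [C1])
    have hRp : 0 < R := by linarith
    -- The neighbourhood `1 - u < R^{-1/ν}` is where `(1 - u)^{-ν} ≥ R`. There `x - y ≥ t / 3` and
    -- `y ≤ C1 L`, so the relative increment is at least `t / (3 C1 L)`.
    refine ⟨ν⁻¹ / (2 + ν⁻¹) * min 1 (1 / (3 * C1)), by positivity, R ^ (-ν⁻¹),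
      Real.rpow_pos_of_pos hRp _, Real.rpow_le_one_of_one_le_of_nonpos hR (by linarith), ?_⟩
    filter_upwards [hinc, hs0, eventually_gt_atTop 0] with L hL hLs hLpos u hu
    have hLp : (0 : ℝ) < L := Nat.cast_pos.2 hLpos
    have hu' : u ∈ Ico (0 : ℝ) 1 := by
      have := Real.rpow_le_one_of_one_le_of_nonpos hR (show -ν⁻¹ ≤ 0 by linarith)
      exact ⟨by linarith [hu.1], hu.2⟩
    have hy := (s.iterate_mem h0 L).2
    have hu1 : 0 < 1 - u := by linarith [hu.2]
    have hRt : R ≤ (1 - u) ^ (-ν) := by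
      have h1 := Real.rpow_le_rpow_of_nonpos hu1 (show 1 - u ≤ R ^ (-ν⁻¹) by linarith [hu.1])
        (show -ν ≤ 0 by linarith)
      rwa [← Real.rpow_mul hRp.le, neg_mul_neg, inv_mul_cancel₀ hν.ne', Real.rpow_one] at h1
    have hinc' := (hL u hu').2 hRt
    rw [s.sub_iterate_eq hu' L]
    set x := (1 - κ^[L] u) ^ (-ν)
    set y := (1 - κ^[L] 0) ^ (-ν)
    set t := (1 - u) ^ (-ν)
    have hyp : 0 < y := Real.rpow_pos_of_pos (by linarith) _
    rw [div_lt_iff₀ hLp] at hLs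
    have htp : 0 < t := by linarith
    have hxy : 1 / (3 * C1) * ((L : ℝ)⁻¹ * t) ≤ (x - y) / y := by
      rw [le_div_iff₀ hyp]
      refine le_trans ?_ hinc'
      have h1 := mul_le_mul_of_nonneg_left hLs.le (show 0 ≤ 1 / (3 * C1) * ((L : ℝ)⁻¹ * t) by positivity)
      refine h1.trans (le_of_eq ?_)
      field_simp
    have h1 := min_one_le_one_sub_rpow_neg hρ.le (hxy.trans' (by positivity))
    have h2 : min 1 (1 / (3 * C1)) * min 1 ((L : ℝ)⁻¹ * t) ≤ min 1 ((x - y) / y) := by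
      refine le_min ?_ (le_trans ?_ hxy)
      · exact mul_le_one₀ (min_le_left _ _) (by positivity) (min_le_left _ _)
      · exact mul_le_mul (min_le_right _ _) (min_le_right _ _) (by positivity) (by positivity)
    have h3 := mul_le_mul_of_nonneg_left h2 (show 0 ≤ ν⁻¹ / (2 + ν⁻¹) by positivity)
    have h4 := mul_le_mul_of_nonneg_left (h3.trans h1) (sub_nonneg.2 hy.le)
    linarith

end Sparse

end IsPGF

theorem IsPGF.exists_renormLimit {κ : ℝ → ℝ} {p : ℕ → ℝ} (h : IsPGF κ p) {ν β₀ : ℝ} {v b w : ℕ → ℝ}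
    (hreg : Regime κ ν β₀ v b w) : D κ 1 ≠ 0 ∧ ∃ β, RenormLimit κ ν β₀ v b w β := by
  cases hreg with
  | high b reg one_lt mem fixed ne_zero =>
    refine ⟨by linarith, ?_⟩
    have hb : b ∈ Ico (0 : ℝ) 1 := ⟨h.fixed_nonneg (h.nonAffine_of_one_lt one_lt) mem fixed, mem.2⟩
    have s : HighDisorder κ p b :=
      ⟨h, one_lt, hb, fixed, lt_of_le_of_ne (h.D_nonneg hb) (Ne.symm ne_zero)⟩
    exact s.renormLimit reg
  | sparseA γ₁ γ₂ c₁ c₂ ρ β₀ β₁ crit hγ₁ hγ₂ hc₁ expansion hρ hβ₀ hβ₁ =>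
    refine ⟨by rw [crit]; norm_num, ?_⟩
    -- Since `γ₂ > 1 + 2ν`, the term with `c₂` belongs to the error and `a = 0`.
    have s : Sparse κ p (γ₁ - 1) c₁ 0 (min (γ₁ - 1) (γ₂ - (2 * γ₁ - 1))) := by
      refine ⟨h, crit, by linarith, lt_min (by linarith) (by linarith), min_le_left _ _, hc₁, ?_⟩
      have hle : 1 + 2 * (γ₁ - 1) + min (γ₁ - 1) (γ₂ - (2 * γ₁ - 1)) ≤ γ₂ := by
        linarith [min_le_right (γ₁ - 1) (γ₂ - (2 * γ₁ - 1))]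
      have h1 := (expansion.isBigO.sub ((isBigO_refl (fun u : ℝ => (1 - u) ^ γ₂)
        (𝓝[<] 1)).const_mul_left c₂)).trans (isBigO_rpow_left_one hle)
      refine h1.congr_left fun u => ?_
      rw [add_sub_cancel]; ring
    have key := s.renormLimit (A := γ₁ * c₁ / 2) (by ring)
    subst hρ hβ₀ hβ₁
    exact key
  | sparseB γ₁ γ₂ γ₃ c₁ c₂ c₃ ρ β₀ β₁ crit hγ₁ hγ₂ hγ₃ hc₁ expansion hρ hβ₀ hβ₁ =>
    refine ⟨by rw [crit]; norm_num, ?_⟩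
    -- Here `γ₂ = 1 + 2ν` exactly, so `a = c₂` and the term with `c₃` joins the error.
    have s : Sparse κ p (γ₁ - 1) c₁ c₂ (min (γ₁ - 1) (γ₃ - γ₂)) := by
      refine ⟨h, crit, by linarith, lt_min (by linarith) (by linarith), min_le_left _ _, hc₁, ?_⟩
      have hle : 1 + 2 * (γ₁ - 1) + min (γ₁ - 1) (γ₃ - γ₂) ≤ γ₃ := by
        linarith [min_le_right (γ₁ - 1) (γ₃ - γ₂)]
      have h1 := (expansion.isBigO.sub ((isBigO_refl (fun u : ℝ => (1 - u) ^ γ₃)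
        (𝓝[<] 1)).const_mul_left c₃)).trans (isBigO_rpow_left_one hle)
      refine h1.congr_left fun u => ?_
      rw [add_sub_cancel, show 1 + 2 * (γ₁ - 1) = γ₂ by rw [hγ₂]; ring]; ring
    have key := s.renormLimit (A := γ₁ * c₁ / 2 + c₂ / c₁) (by ring)
    subst hρ hβ₀ hβ₁
    exact key

/-! ### The profile of the iterates. -/

/-- The iterates of the kernel, normalized to vanish at `0` and to be `1` at `1`. -/
def profile (κ : ℝ → ℝ) (L : ℕ) (u : ℝ) : ℝ := (κ^[L] u - κ^[L] 0) / (1 - κ^[L] 0)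

/-- The properties of the normalized iterates that govern the integrals of their powers. -/
structure IsProfile (h : ℕ → ℝ → ℝ) (ν : ℝ) (v : ℕ → ℝ) (g : ℝ → ℝ) : Prop where
  nu_pos : 0 < ν
  v_pos : ∀ᶠ L in atTop, 0 < v L
  v_tendsto : Tendsto v atTop (𝓝 0)
  continuousOn : ∀ L, ContinuousOn (h L) (Icc (-1) 1)
  limit : ∀ u ∈ Ioo (-1 : ℝ) 1, Tendsto (fun L => h L u / v L) atTop (𝓝 (g u))
  upper : ∃ C : ℝ, 0 < C ∧ ∀ᶠ L in atTop, ∀ u ∈ Ioo (-1 : ℝ) 1,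
    |h L u| ≤ C * min 1 (v L * (1 - |u|) ^ (-ν))
  lower : ∃ c : ℝ, 0 < c ∧ ∃ δ : ℝ, 0 < δ ∧ δ ≤ 1 ∧ ∀ᶠ L in atTop, ∀ u ∈ Ioo (1 - δ) 1,
    c * min 1 (v L * (1 - u) ^ (-ν)) ≤ h L u

namespace IsPGF

variable {κ : ℝ → ℝ} {p : ℕ → ℝ} {ν β₀ : ℝ} {v b w : ℕ → ℝ} {β : ℝ → ℝ}

theorem one_sub_iterate_zero_pos (h : IsPGF κ p) (hD : D κ 1 ≠ 0) (L : ℕ) : 0 < 1 - κ^[L] 0 := by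
  have := (abs_lt.1 (h.iterate_abs_lt_one hD (u := 0) (by simp) L)).2
  linarith

theorem _root_.NNGF.RenormLimit.scale_le (r : RenormLimit κ ν β₀ v b w β) :
    ∀ᶠ L in atTop, w L ≤ 2 / β₀ * (v L * (1 - κ^[L] 0)) := by
  filter_upwards [r.w_ratio.eventually_const_lt (half_lt_self r.beta0_pos), r.w_pos] with L h1 h2
  have := r.beta0_pos
  rw [lt_div_iff₀ h2] at h1
  rw [div_mul_eq_mul_div, le_div_iff₀ this]
  linarith

/-- The limit comes from subtracting the limits at `u` and at `0` and changing the scale from `w` to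
`v (1 - κ_L(0))`. In the upper bound the `1` is `κ_L ≤ 1`, and `iterate_increment` extends the bound
from `|u|` to `u`. -/
theorem isProfile (h : IsPGF κ p) (hD : D κ 1 ≠ 0) (r : RenormLimit κ ν β₀ v b w β) :
    IsProfile (profile κ) ν v (fun u => (β u - β 0) / β₀) := by
  have hpos := h.one_sub_iterate_zero_pos hD
  refine ⟨r.nu_pos, r.v_pos, r.v_tendsto, fun L => ?_, fun u hu => ?_, ?_, ?_⟩
  · exact ((h.iterate_continuousOn L).sub continuousOn_const).div_const _
  · have h1 := ((r.limit u hu).sub (r.limit 0 (by norm_num))).div r.w_ratio r.beta0_pos.ne'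
    refine h1.congr' ?_
    filter_upwards [r.v_pos, r.w_pos] with L hv hw
    have := hpos L
    simp only [Pi.div_apply, profile]
    field_simp
    ring
  · obtain ⟨C, hC⟩ := r.upper
    have hβ := r.beta0_pos
    refine ⟨max 1 (C * (2 / β₀)), by positivity, ?_⟩
    filter_upwards [hC, r.scale_le, r.v_pos, r.w_pos] with L h1 h2 h3 h4 u hu
    have hu' : |u| < 1 := abs_lt.2 hu
    have hL := hpos L
    have ht : 0 < (1 - |u|) ^ (-ν) := Real.rpow_pos_of_pos (by linarith) _
    have h5 := h1 |u| ⟨abs_nonneg u, hu'⟩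
    have h50 := h1 0 (by norm_num)
    have hC0 : 0 ≤ C := by
      simp only [sub_self, sub_zero, Real.one_rpow, mul_one] at h50
      exact nonneg_of_mul_nonneg_left h50 h4
    have h6 := h.iterate_increment (u := u) ⟨hu.1.le, hu.2.le⟩ L
    have h7 := (h.iterate_mem_nonneg (u := |u|) ⟨abs_nonneg u, hu'.le⟩ L).2
    rw [profile, abs_div, abs_of_pos hL, div_le_iff₀ hL]
    refine h6.trans ?_
    rcases min_choice 1 (v L * (1 - |u|) ^ (-ν)) with hm | hm <;> rw [hm]
    · rw [mul_one]
      refine le_trans ?_ (mul_le_mul_of_nonneg_right (le_max_left _ _) hL.le)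
      linarith
    · refine h5.trans ?_
      calc C * w L * (1 - |u|) ^ (-ν)
          ≤ C * (2 / β₀ * (v L * (1 - κ^[L] 0))) * (1 - |u|) ^ (-ν) := by gcongr
        _ = C * (2 / β₀) * (v L * (1 - |u|) ^ (-ν) * (1 - κ^[L] 0)) := by ring
        _ ≤ max 1 (C * (2 / β₀)) * (v L * (1 - |u|) ^ (-ν) * (1 - κ^[L] 0)) := by
            gcongr; exact le_max_right _ _
        _ = _ := by ring
  · obtain ⟨c, hc, δ, hδ, hδ1, hlow⟩ := r.lower
    refine ⟨c, hc, δ, hδ, hδ1, ?_⟩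
    filter_upwards [hlow] with L h1 u hu
    rw [profile, le_div_iff₀ (hpos L)]
    have := h1 u hu
    linarith

/-- If `κ` is not odd, then the negative part of the normalized iterates is of order `v`. -/
theorem profile_ge (h : IsPGF κ p) (hD : D κ 1 ≠ 0) (r : RenormLimit κ ν β₀ v b w β)
    (hodd : ¬ ∀ u ∈ Icc (-1 : ℝ) 1, κ (-u) = -κ u) :
    ∃ C : ℝ, 0 ≤ C ∧ ∀ᶠ L in atTop, ∀ u ∈ Ioo (-1 : ℝ) 1, -(C * v L) ≤ profile κ L u := by
  obtain ⟨k, hk0, hk1, hk⟩ := h.neg_le_of_not_odd hodd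
  obtain ⟨C, hC⟩ := r.upper
  obtain ⟨C', hC'⟩ := r.w_succ
  have h00 := h.map_nonneg (u := 0) (by norm_num)
  have h01 : κ 0 < 1 := by have := h.one_sub_iterate_zero_pos hD 1; simpa using this
  set M := |C| * ((1 - k) ^ (-ν) + (1 - κ 0) ^ (-ν)) with hM
  have hM0 : 0 ≤ M := mul_nonneg (abs_nonneg C)
    (add_nonneg (Real.rpow_nonneg (by linarith) _) (Real.rpow_nonneg (by linarith) _))
  have hβ := r.beta0_pos
  refine ⟨M * |C'| * (2 / β₀), by positivity, ?_⟩
  -- The first of `L + 1` layers is split off: it maps `[-1, 1]` into `[-k, 1]` with `k < 1`. The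
  -- remaining `L` layers can then fall below `κ_L(0)` only by `κ_L(k) - κ_L(0) = O(w_L)`.
  rw [← map_add_atTop_eq_nat 1, eventually_map]
  filter_upwards [hC, hC', r.w_pos, (tendsto_add_atTop_nat 1).eventually (r.scale_le),
    (tendsto_add_atTop_nat 1).eventually r.w_pos] with L h1 h2 h3 h4 h5 u hu
  have hx := h.mapsTo (x := u) ⟨hu.1.le, hu.2.le⟩
  have hlow : κ^[L] 0 - (κ^[L] k - κ^[L] 0) ≤ κ^[L] (κ u) := by
    have hk' : κ^[L] 0 ≤ κ^[L] k := h.iterate_monotoneOn L (by norm_num) ⟨hk0, hk1.le⟩ hk0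
    rcases le_total 0 (κ u) with hpos | hneg
    · have := h.iterate_monotoneOn L (by norm_num) ⟨hpos, hx.2⟩ hpos
      linarith
    · have h6 := (abs_le.1 (h.iterate_increment hx L)).1
      have h7 := h.iterate_monotoneOn L ⟨abs_nonneg (κ u), abs_le.2 hx⟩ ⟨hk0, hk1.le⟩
        (show |κ u| ≤ k by rw [abs_of_nonpos hneg]; linarith [hk u ⟨hu.1.le, hu.2.le⟩])
      linarith
  have hkb := h1 k ⟨hk0, hk1⟩
  have h0b := h1 (κ 0) ⟨h00, h01⟩
  have hCw : C * w L ≤ |C| * w L := mul_le_mul_of_nonneg_right (le_abs_self C) h3.le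
  have hkp : 0 ≤ (1 - k) ^ (-ν) := Real.rpow_nonneg (by linarith) _
  have h0p : 0 ≤ (1 - κ 0) ^ (-ν) := Real.rpow_nonneg (by linarith) _
  have g1 := mul_le_mul_of_nonneg_right hCw hkp
  have g2 := mul_le_mul_of_nonneg_right hCw h0p
  have g3 : w L ≤ |C'| * w (L + 1) :=
    h2.trans (mul_le_mul_of_nonneg_right (le_abs_self C') h5.le)
  have hpos := h.one_sub_iterate_zero_pos hD (L + 1)
  have g4 : M * w L ≤ M * |C'| * (2 / β₀) * v (L + 1) * (1 - κ^[L + 1] 0) := by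
    calc M * w L ≤ M * (|C'| * (2 / β₀ * (v (L + 1) * (1 - κ^[L + 1] 0)))) := by gcongr; exact g3.trans (by gcongr)
      _ = _ := by ring
  rw [profile, le_div_iff₀ hpos]
  rw [Function.iterate_succ_apply, Function.iterate_succ_apply] at *
  have g5 : M * w L = |C| * w L * (1 - k) ^ (-ν) + |C| * w L * (1 - κ 0) ^ (-ν) := by rw [hM]; ring
  linarith

end IsPGF

/-! ### The Gegenbauer measure and integrals of truncated powers. -/

/-- The density of `gegenbauerMeasure d`. -/
def gegenbauerDensity (d : ℕ) (u : ℝ) : ℝ :=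
  area d / area (d + 1) * (1 - u ^ 2) ^ ((d : ℝ) / 2 - 1)

theorem measurable_gegenbauerDensity (d : ℕ) : Measurable (gegenbauerDensity d) := by
  unfold gegenbauerDensity; fun_prop

theorem area_nonneg (n : ℕ) : 0 ≤ area n := measureReal_nonneg

theorem gegenbauerDensity_nonneg (d : ℕ) {u : ℝ} (hu : u ∈ Ioo (-1 : ℝ) 1) :
    0 ≤ gegenbauerDensity d u :=
  mul_nonneg (div_nonneg (area_nonneg _) (area_nonneg _))
    (Real.rpow_nonneg (by nlinarith [hu.1, hu.2]) _)

theorem gegenbauerMeasure_eq (d : ℕ) : gegenbauerMeasure d =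
    ((volume : Measure ℝ).restrict (Ioo (-1) 1)).withDensity
      fun u => ENNReal.ofReal (gegenbauerDensity d u) := by
  rw [gegenbauerMeasure, ← restrict_Ioo_eq_restrict_Icc]
  rfl

theorem ae_gegenbauer_mem (d : ℕ) : ∀ᵐ u ∂(gegenbauerMeasure d), u ∈ Ioo (-1 : ℝ) 1 := by
  rw [gegenbauerMeasure_eq]
  exact (withDensity_absolutelyContinuous _ _).ae_le (ae_restrict_mem measurableSet_Ioo)

theorem integral_gegenbauer (d : ℕ) (f : ℝ → ℝ) :
    ∫ u, f u ∂(gegenbauerMeasure d) = ∫ u in Ioo (-1) 1, gegenbauerDensity d u * f u := by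
  rw [gegenbauerMeasure_eq, integral_withDensity_eq_integral_toReal_smul
    (measurable_gegenbauerDensity d).ennreal_ofReal (ae_of_all _ fun _ => ENNReal.ofReal_lt_top)]
  refine setIntegral_congr_fun measurableSet_Ioo fun u hu => ?_
  simp only [smul_eq_mul]
  rw [ENNReal.toReal_ofReal (gegenbauerDensity_nonneg d hu)]

theorem integrable_gegenbauer_iff (d : ℕ) (f : ℝ → ℝ) : Integrable f (gegenbauerMeasure d) ↔
    IntegrableOn (fun u => gegenbauerDensity d u * f u) (Ioo (-1) 1) := by
  rw [gegenbauerMeasure_eq, integrable_withDensity_iff_integrable_smul'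
    (measurable_gegenbauerDensity d).ennreal_ofReal (ae_of_all _ fun _ => ENNReal.ofReal_lt_top),
    IntegrableOn]
  refine integrable_congr ?_
  filter_upwards [ae_restrict_mem measurableSet_Ioo] with u hu
  rw [ENNReal.toReal_ofReal (gegenbauerDensity_nonneg d hu), smul_eq_mul]

/-- Controls the harmless factor `(1 + |u|)^{d/2-1}` of the density without a distinction by the
sign of the exponent. -/
theorem rpow_le_two_rpow_abs {x r : ℝ} (h1 : 1 ≤ x) (h2 : x ≤ 2) : x ^ r ≤ 2 ^ |r| :=
  (Real.rpow_le_rpow_of_exponent_le h1 (le_abs_self r)).trans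
    (Real.rpow_le_rpow (by linarith) h2 (abs_nonneg r))

theorem two_rpow_neg_abs_le {x r : ℝ} (h1 : 1 ≤ x) (h2 : x ≤ 2) : 2 ^ (-|r|) ≤ x ^ r :=
  (Real.rpow_le_rpow_of_nonpos (by linarith) h2 (by linarith [abs_nonneg r])).trans
    (Real.rpow_le_rpow_of_exponent_le h1 (neg_abs_le r))

theorem gegenbauerDensity_eq (d : ℕ) {u : ℝ} (hu : |u| ≤ 1) : gegenbauerDensity d u
    = area d / area (d + 1) * ((1 - |u|) ^ ((d : ℝ) / 2 - 1) * (1 + |u|) ^ ((d : ℝ) / 2 - 1)) := by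
  rw [gegenbauerDensity, ← Real.mul_rpow (by linarith) (by positivity), ← sq_abs]
  congr 2; ring

theorem integrableOn_one_sub_abs_rpow {r : ℝ} (hr : -1 < r) :
    IntegrableOn (fun u : ℝ => (1 - |u|) ^ r) (Ioo (-1) 1) := by
  have h0 : IntervalIntegrable (fun t : ℝ => t ^ r) volume 0 2 :=
    intervalIntegral.intervalIntegrable_rpow' hr
  have h1 : IntegrableOn (fun u : ℝ => (1 - u) ^ r) (Ioo (-1) 1) := by
    have := h0.comp_sub_left 1
    norm_num at this
    exact ((intervalIntegrable_iff_integrableOn_Ioc_of_le (by norm_num)).1 this.symm).mono_set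
      Ioo_subset_Ioc_self
  have h2 : IntegrableOn (fun u : ℝ => (1 + u) ^ r) (Ioo (-1) 1) := by
    have := h0.comp_add_left 1
    norm_num at this
    exact ((intervalIntegrable_iff_integrableOn_Ioc_of_le (by norm_num)).1 this).mono_set
      Ioo_subset_Ioc_self
  refine (h1.add h2).mono' (by fun_prop : Measurable _).aestronglyMeasurable ?_
  filter_upwards [ae_restrict_mem measurableSet_Ioo] with u hu
  have e1 : 0 ≤ (1 - u) ^ r := Real.rpow_nonneg (by linarith [hu.2]) _
  have e2 : 0 ≤ (1 + u) ^ r := Real.rpow_nonneg (by linarith [hu.1]) _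
  have hu' := abs_lt.2 hu
  rw [Real.norm_of_nonneg (Real.rpow_nonneg (by linarith) _)]
  rcases abs_choice u with h | h <;> rw [h]
  · exact le_add_of_nonneg_right e2
  · rw [sub_neg_eq_add]; exact le_add_of_nonneg_left e1

theorem integrable_gegenbauer_rpow {d : ℕ} {r : ℝ} (hr : r < (d : ℝ) / 2) :
    Integrable (fun u : ℝ => (1 - |u|) ^ (-r)) (gegenbauerMeasure d) := by
  rw [integrable_gegenbauer_iff]
  have h := (integrableOn_one_sub_abs_rpow (r := (d : ℝ) / 2 - 1 - r) (by linarith)).const_mul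
    (area d / area (d + 1) * 2 ^ |(d : ℝ) / 2 - 1|)
  refine h.mono' ((measurable_gegenbauerDensity d).mul (by fun_prop)).aestronglyMeasurable ?_
  filter_upwards [ae_restrict_mem measurableSet_Ioo] with u hu
  have hu' := abs_lt.2 hu
  have ht : 0 < 1 - |u| := by linarith
  have hK : 0 ≤ area d / area (d + 1) := div_nonneg (area_nonneg _) (area_nonneg _)
  have h2 := rpow_le_two_rpow_abs (r := (d : ℝ) / 2 - 1) (x := 1 + |u|)
    (by linarith [abs_nonneg u]) (by linarith)
  rw [norm_mul, Real.norm_of_nonneg (gegenbauerDensity_nonneg d hu),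
    Real.norm_of_nonneg (Real.rpow_nonneg ht.le _), gegenbauerDensity_eq d hu'.le,
    sub_eq_add_neg _ r, Real.rpow_add ht]
  have e1 := Real.rpow_nonneg ht.le ((d : ℝ) / 2 - 1)
  have e2 := Real.rpow_nonneg ht.le (-r)
  have h3 := mul_le_mul_of_nonneg_left h2 (mul_nonneg (mul_nonneg hK e1) e2)
  linarith

/-- The density of `1 - u` under `gegenbauerMeasure d`, up to a constant factor. -/
theorem setIntegral_gegenbauer (d : ℕ) (F : ℝ → ℝ) :
    ∫ u in Ioo 0 1, gegenbauerDensity d u * F (1 - u)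
      = area d / area (d + 1) * ∫ t in Ioo 0 1,
          (t ^ ((d : ℝ) / 2 - 1) * (2 - t) ^ ((d : ℝ) / 2 - 1)) * F t := by
  have h := intervalIntegral.integral_comp_sub_left (a := 0) (b := 1) (fun t : ℝ =>
    area d / area (d + 1) * ((t ^ ((d : ℝ) / 2 - 1) * (2 - t) ^ ((d : ℝ) / 2 - 1)) * F t)) 1
  rw [sub_self, sub_zero, intervalIntegral.integral_of_le zero_le_one,
    intervalIntegral.integral_of_le zero_le_one, integral_Ioc_eq_integral_Ioo,
    integral_Ioc_eq_integral_Ioo] at h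
  rw [← integral_const_mul, ← h]
  refine setIntegral_congr_fun measurableSet_Ioo fun u hu => ?_
  have hu' : |u| = u := abs_of_pos hu.1
  rw [gegenbauerDensity_eq d (by rw [hu']; exact hu.2.le), hu']
  ring_nf

theorem integral_gegenbauer_one_sub_abs (d : ℕ) (F : ℝ → ℝ) :
    ∫ u, F (1 - |u|) ∂(gegenbauerMeasure d)
      = 2 * (area d / area (d + 1)) * ∫ t in Ioo 0 1,
          (t ^ ((d : ℝ) / 2 - 1) * (2 - t) ^ ((d : ℝ) / 2 - 1)) * F t := by
  rw [integral_gegenbauer, mul_assoc, ← setIntegral_gegenbauer, ← integral_indicator measurableSet_Ioo,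
    ← integral_indicator measurableSet_Ioo]
  have h := integral_comp_abs (f := (Iio (1 : ℝ)).indicator fun u => gegenbauerDensity d u * F (1 - u))
  rw [← integral_indicator measurableSet_Ioi] at h
  convert h using 2
  · ext u
    by_cases hu : |u| < 1
    · rw [indicator_of_mem (show u ∈ Ioo (-1) 1 from abs_lt.1 hu), indicator_of_mem (mem_Iio.2 hu)]
      simp [gegenbauerDensity]
    · rw [indicator_of_notMem (show u ∉ Ioo (-1) 1 from fun h => hu (abs_lt.2 h)),
        indicator_of_notMem (show |u| ∉ Iio 1 from hu)]
  · congr 1; ext u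
    rw [indicator_indicator, Ioi_inter_Iio]

theorem integral_gegenbauer_indicator (d : ℕ) (F : ℝ → ℝ) :
    ∫ u, (Ioo (0 : ℝ) 1).indicator (fun u => F (1 - u)) u ∂(gegenbauerMeasure d)
      = (area d / area (d + 1)) * ∫ t in Ioo 0 1,
          (t ^ ((d : ℝ) / 2 - 1) * (2 - t) ^ ((d : ℝ) / 2 - 1)) * F t := by
  rw [integral_gegenbauer, ← setIntegral_gegenbauer]
  have e : (fun u => gegenbauerDensity d u * (Ioo (0 : ℝ) 1).indicator (fun u => F (1 - u)) u)
      = (Ioo (0 : ℝ) 1).indicator fun u => gegenbauerDensity d u * F (1 - u) := by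
    ext u; rw [indicator_apply, indicator_apply]; split_ifs <;> simp
  rw [e, setIntegral_indicator measurableSet_Ioo,
    inter_eq_right.2 (Ioo_subset_Ioo_left (by norm_num))]

/-- Splitting the integral of a truncated power at the truncation point. -/
theorem integral_truncated_le {a ν τ : ℝ} (ha : 0 < a) (hτ : τ ∈ Ioo (0 : ℝ) 1) (q : ℕ) :
    ∫ t in Ioo 0 1, (t ^ (a - 1) * (2 - t) ^ (a - 1)) * min 1 (τ ^ ν * t ^ (-ν)) ^ q
      ≤ 2 ^ |a - 1| * (τ ^ a / a + τ ^ (ν * q) * ∫ t in τ..1, t ^ (a - 1 - ν * q)) := by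
  have hint : IntegrableOn (fun t : ℝ => t ^ (a - 1)) (Ioo 0 1) :=
    ((intervalIntegrable_iff_integrableOn_Ioc_of_le zero_le_one).1
      (intervalIntegral.intervalIntegrable_rpow' (by linarith))).mono_set Ioo_subset_Ioc_self
  have hmin : ∀ t ∈ Ioo (0 : ℝ) 1, 0 ≤ min 1 (τ ^ ν * t ^ (-ν)) := fun t ht =>
    le_min zero_le_one (mul_nonneg (Real.rpow_nonneg hτ.1.le _) (Real.rpow_nonneg ht.1.le _))
  have hint2 : IntegrableOn (fun t : ℝ => t ^ (a - 1) * min 1 (τ ^ ν * t ^ (-ν)) ^ q) (Ioo 0 1) := by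
    refine hint.mono' (by fun_prop : Measurable _).aestronglyMeasurable ?_
    filter_upwards [ae_restrict_mem measurableSet_Ioo] with t ht
    have h1 := hmin t ht
    have h2 := Real.rpow_nonneg ht.1.le (a - 1)
    rw [Real.norm_of_nonneg (by positivity)]
    exact mul_le_of_le_one_right h2 (pow_le_one₀ h1 (min_le_left _ _))
  have hint3 : IntegrableOn (fun t : ℝ => t ^ (a - 1) * min 1 (τ ^ ν * t ^ (-ν)) ^ q) (Ioc 0 1) :=
    integrableOn_Ioc_iff_integrableOn_Ioo (by simp) |>.2 hint2
  have step1 : ∫ t in Ioo 0 1, (t ^ (a - 1) * (2 - t) ^ (a - 1)) * min 1 (τ ^ ν * t ^ (-ν)) ^ q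
      ≤ 2 ^ |a - 1| * ∫ t in Ioo 0 1, t ^ (a - 1) * min 1 (τ ^ ν * t ^ (-ν)) ^ q := by
    rw [← integral_const_mul]
    refine integral_mono_of_nonneg ?_ (hint2.const_mul _) ?_
    · filter_upwards [ae_restrict_mem measurableSet_Ioo] with t ht
      have h1 := hmin t ht
      have h2 := Real.rpow_nonneg ht.1.le (a - 1)
      have h3 := Real.rpow_nonneg (show 0 ≤ 2 - t by linarith [ht.2]) (a - 1)
      simp only [Pi.zero_apply]; positivity
    · filter_upwards [ae_restrict_mem measurableSet_Ioo] with t ht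
      have h1 := hmin t ht
      have h2 := Real.rpow_nonneg ht.1.le (a - 1)
      have h3 := rpow_le_two_rpow_abs (x := 2 - t) (r := a - 1) (by linarith [ht.2]) (by linarith [ht.1])
      have h4 := mul_le_mul_of_nonneg_left h3 (mul_nonneg h2 (pow_nonneg h1 q))
      linarith
  refine step1.trans (mul_le_mul_of_nonneg_left ?_ (by positivity))
  rw [← integral_Ioc_eq_integral_Ioo, ← intervalIntegral.integral_of_le zero_le_one]
  have hi1 : IntervalIntegrable (fun t : ℝ => t ^ (a - 1) * min 1 (τ ^ ν * t ^ (-ν)) ^ q) volume 0 τ :=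
    (intervalIntegrable_iff_integrableOn_Ioc_of_le hτ.1.le).2
      (hint3.mono_set (Ioc_subset_Ioc_right hτ.2.le))
  have hi2 : IntervalIntegrable (fun t : ℝ => t ^ (a - 1) * min 1 (τ ^ ν * t ^ (-ν)) ^ q) volume τ 1 :=
    (intervalIntegrable_iff_integrableOn_Ioc_of_le hτ.2.le).2
      (hint3.mono_set (Ioc_subset_Ioc_left hτ.1.le))
  rw [← intervalIntegral.integral_add_adjacent_intervals hi1 hi2]
  refine add_le_add ?_ ?_
  · have h0 : ∫ t in (0 : ℝ)..τ, t ^ (a - 1) = τ ^ a / a := by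
      rw [integral_rpow (Or.inl (by linarith)), sub_add_cancel, Real.zero_rpow ha.ne', sub_zero]
    rw [← h0]
    refine intervalIntegral.integral_mono_on hτ.1.le hi1
      (intervalIntegral.intervalIntegrable_rpow' (by linarith)) fun t ht => ?_
    have h2 := Real.rpow_nonneg ht.1 (a - 1)
    exact mul_le_of_le_one_right h2 (pow_le_one₀ (le_min zero_le_one (mul_nonneg
      (Real.rpow_nonneg hτ.1.le _) (Real.rpow_nonneg ht.1 _))) (min_le_left _ _))
  · rw [← intervalIntegral.integral_const_mul]
    refine intervalIntegral.integral_mono_on hτ.2.le hi2 ?_ fun t ht => ?_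
    · refine (intervalIntegral.intervalIntegrable_rpow (Or.inr ?_)).const_mul _
      rw [uIcc_of_le hτ.2.le]; exact fun h => hτ.1.not_ge h.1
    · have ht0 : 0 < t := hτ.1.trans_le ht.1
      have h2 := Real.rpow_nonneg ht0.le (a - 1)
      have h3 : min 1 (τ ^ ν * t ^ (-ν)) ^ q ≤ (τ ^ ν * t ^ (-ν)) ^ q :=
        pow_le_pow_left₀ (le_min zero_le_one (mul_nonneg
          (Real.rpow_nonneg hτ.1.le _) (Real.rpow_nonneg ht0.le _))) (min_le_right _ _) q
      refine (mul_le_mul_of_nonneg_left h3 h2).trans (le_of_eq ?_)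
      rw [mul_pow, ← Real.rpow_mul_natCast hτ.1.le, ← Real.rpow_mul_natCast ht0.le,
        sub_eq_add_neg (a - 1), Real.rpow_add ht0, neg_mul]
      ring

/-- The moments of truncated powers above the critical exponent. -/
theorem exists_truncated_le {d q : ℕ} {ν : ℝ} (hd : 1 ≤ d) (hq : (d : ℝ) / 2 < ν * q) :
    ∃ C : ℝ, ∀ τ ∈ Ioo (0 : ℝ) 1,
      ∫ u, min 1 (τ ^ ν * (1 - |u|) ^ (-ν)) ^ q ∂(gegenbauerMeasure d) ≤ C * τ ^ ((d : ℝ) / 2) := by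
  have ha : 0 < (d : ℝ) / 2 := by have : (0 : ℝ) < d := Nat.cast_pos.2 hd; positivity
  set a := (d : ℝ) / 2
  have hK : 0 ≤ 2 * (area d / area (d + 1)) :=
    mul_nonneg zero_le_two (div_nonneg (area_nonneg _) (area_nonneg _))
  refine ⟨2 * (area d / area (d + 1)) * (2 ^ |a - 1| * (1 / a + 1 / (ν * q - a))), fun τ hτ => ?_⟩
  rw [integral_gegenbauer_one_sub_abs d fun t => min 1 (τ ^ ν * t ^ (-ν)) ^ q]
  refine (mul_le_mul_of_nonneg_left (integral_truncated_le ha hτ q) hK).trans ?_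
  rw [mul_assoc _ (_ * _) (_ : ℝ)]
  refine mul_le_mul_of_nonneg_left ?_ hK
  rw [mul_assoc]
  refine mul_le_mul_of_nonneg_left ?_ (by positivity)
  rw [add_mul, one_div_mul_eq_div]
  refine add_le_add le_rfl ?_
  rw [integral_rpow (Or.inr ⟨by linarith, by
    rw [uIcc_of_le hτ.2.le]; exact fun h => hτ.1.not_ge h.1⟩), Real.one_rpow,
    show a - 1 - ν * q + 1 = -(ν * q - a) by ring, ← neg_sub, neg_div_neg_eq, mul_div_assoc']
  have hs : 0 < ν * q - a := by linarith
  rw [one_div_mul_eq_div]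
  gcongr
  have : τ ^ (ν * q) * τ ^ (-(ν * q - a)) = τ ^ a := by
    rw [← Real.rpow_add hτ.1]; congr 1; ring
  rw [mul_sub, this]
  have := Real.rpow_nonneg hτ.1.le (ν * q)
  linarith

/-- The moments of truncated powers at the critical exponent. -/
theorem exists_truncated_le_log {d q : ℕ} {ν : ℝ} (hd : 1 ≤ d)
    (hq : ν * q = (d : ℝ) / 2) :
    ∃ C : ℝ, ∀ τ ∈ Ioo (0 : ℝ) 1,
      ∫ u, min 1 (τ ^ ν * (1 - |u|) ^ (-ν)) ^ q ∂(gegenbauerMeasure d)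
        ≤ C * (τ ^ ((d : ℝ) / 2) * (1 + Real.log τ⁻¹)) := by
  have ha : 0 < (d : ℝ) / 2 := by have : (0 : ℝ) < d := Nat.cast_pos.2 hd; positivity
  set a := (d : ℝ) / 2
  have hK : 0 ≤ 2 * (area d / area (d + 1)) :=
    mul_nonneg zero_le_two (div_nonneg (area_nonneg _) (area_nonneg _))
  refine ⟨2 * (area d / area (d + 1)) * (2 ^ |a - 1| * (1 / a + 1)), fun τ hτ => ?_⟩
  rw [integral_gegenbauer_one_sub_abs d fun t => min 1 (τ ^ ν * t ^ (-ν)) ^ q]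
  refine (mul_le_mul_of_nonneg_left (integral_truncated_le ha hτ q) hK).trans ?_
  rw [mul_assoc _ (_ * _) (_ : ℝ)]
  refine mul_le_mul_of_nonneg_left ?_ hK
  rw [mul_assoc]
  refine mul_le_mul_of_nonneg_left ?_ (by positivity)
  have hlog : 0 ≤ Real.log τ⁻¹ := Real.log_nonneg (one_le_inv_iff₀.2 ⟨hτ.1, hτ.2.le⟩)
  have e : ∫ t in τ..1, t ^ (a - 1 - ν * q) = Real.log τ⁻¹ := by
    rw [hq, show a - 1 - a = -1 by ring]
    simp only [Real.rpow_neg_one]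
    rw [integral_inv_of_pos hτ.1 one_pos, one_div]
  rw [e, hq]
  have := Real.rpow_nonneg hτ.1.le a
  have h2 : 0 ≤ τ ^ a / a * Real.log τ⁻¹ := by positivity
  have h3 : (1 / a + 1) * (τ ^ a * (1 + Real.log τ⁻¹))
    = τ ^ a / a + τ ^ a / a * Real.log τ⁻¹ + τ ^ a + τ ^ a * Real.log τ⁻¹ := by field_simp; ring
  linarith

/-- Lower bound for the mass near `1`. -/
theorem le_integral_indicator_near_one {d : ℕ} (hd : 1 ≤ d) (hK : 0 < area d / area (d + 1)) :
    ∃ c : ℝ, 0 < c ∧ ∀ τ ∈ Ioo (0 : ℝ) 1, c * τ ^ ((d : ℝ) / 2) ≤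
      ∫ u, (Ioo (1 - τ) 1).indicator (fun _ => (1 : ℝ)) u ∂(gegenbauerMeasure d) := by
  have ha : 0 < (d : ℝ) / 2 := by have : (0 : ℝ) < d := Nat.cast_pos.2 hd; positivity
  set a := (d : ℝ) / 2
  refine ⟨area d / area (d + 1) * (2 ^ (-|a - 1|) / a), by positivity, fun τ hτ => ?_⟩
  have e : (Ioo (1 - τ) 1).indicator (fun _ => (1 : ℝ))
      = (Ioo (0 : ℝ) 1).indicator fun u => (Iio τ).indicator (fun _ => 1) (1 - u) := by
    ext u
    simp only [indicator_apply, mem_Ioo, mem_Iio]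
    have := hτ.2
    split_ifs <;> first | rfl | (exfalso; grind)
  rw [e, integral_gegenbauer_indicator, mul_assoc]
  refine mul_le_mul_of_nonneg_left ?_ hK.le
  have h1 : ∫ t in Ioo 0 1, t ^ (a - 1) * (2 - t) ^ (a - 1) * (Iio τ).indicator (fun _ => (1 : ℝ)) t
      = ∫ t in Ioo 0 τ, t ^ (a - 1) * (2 - t) ^ (a - 1) := by
    have : (fun t : ℝ => t ^ (a - 1) * (2 - t) ^ (a - 1) * (Iio τ).indicator (fun _ => (1 : ℝ)) t)
      = (Iio τ).indicator fun t => t ^ (a - 1) * (2 - t) ^ (a - 1) := by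
      ext t; rw [indicator_apply, indicator_apply]; split_ifs <;> simp
    rw [this, setIntegral_indicator measurableSet_Iio]
    congr 2; ext t; simp only [mem_inter_iff, mem_Ioo, mem_Iio]; grind
  have h0 : ∫ t in Ioo (0 : ℝ) τ, 2 ^ (-|a - 1|) * t ^ (a - 1) = 2 ^ (-|a - 1|) / a * τ ^ a := by
    rw [integral_const_mul, ← integral_Ioc_eq_integral_Ioo,
      ← intervalIntegral.integral_of_le hτ.1.le, integral_rpow (Or.inl (by linarith)),
      sub_add_cancel, Real.zero_rpow ha.ne', sub_zero]
    ring
  have hint : IntegrableOn (fun t : ℝ => t ^ (a - 1)) (Ioo 0 τ) :=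
    ((intervalIntegrable_iff_integrableOn_Ioc_of_le hτ.1.le).1
      (intervalIntegral.intervalIntegrable_rpow' (by linarith))).mono_set Ioo_subset_Ioc_self
  rw [h1, ← h0]
  refine setIntegral_mono_on (hint.const_mul _) ?_ measurableSet_Ioo fun t ht => ?_
  · refine (hint.const_mul (2 ^ |a - 1|)).mono' (by fun_prop : Measurable _).aestronglyMeasurable ?_
    filter_upwards [ae_restrict_mem measurableSet_Ioo] with t ht
    have h2 := Real.rpow_nonneg ht.1.le (a - 1)
    have h3 := rpow_le_two_rpow_abs (x := 2 - t) (r := a - 1)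
      (by linarith [ht.2, hτ.2]) (by linarith [ht.1])
    rw [Real.norm_of_nonneg (mul_nonneg h2 (Real.rpow_nonneg (by linarith [ht.2, hτ.2]) _)), mul_comm]
    exact mul_le_mul_of_nonneg_right h3 h2
  · rw [mul_comm]
    exact mul_le_mul_of_nonneg_left (two_rpow_neg_abs_le (by linarith [ht.2, hτ.2])
      (by linarith [ht.1])) (Real.rpow_nonneg ht.1.le _)

/-- Lower bound for the integral of the critical power away from the truncation point. -/
theorem le_integral_indicator_critical {d : ℕ} (hK : 0 < area d / area (d + 1)) :
    ∃ c : ℝ, 0 < c ∧ ∀ δ ∈ Ioo (0 : ℝ) 1, ∀ τ ∈ Ioo 0 δ, c * (Real.log τ⁻¹ - Real.log δ⁻¹) ≤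
      ∫ u, (Ioo (1 - δ) (1 - τ)).indicator (fun u => (1 - u) ^ (-((d : ℝ) / 2))) u
        ∂(gegenbauerMeasure d) := by
  set a := (d : ℝ) / 2
  refine ⟨area d / area (d + 1) * 2 ^ (-|a - 1|), by positivity, fun δ hδ τ hτ => ?_⟩
  have e : (Ioo (1 - δ) (1 - τ)).indicator (fun u : ℝ => (1 - u) ^ (-a))
      = (Ioo (0 : ℝ) 1).indicator fun u => (Ioo τ δ).indicator (fun t => t ^ (-a)) (1 - u) := by
    ext u
    simp only [indicator_apply, mem_Ioo]
    have := hδ.2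
    have := hτ.1
    split_ifs <;> first | rfl | (exfalso; grind)
  rw [e, integral_gegenbauer_indicator d ((Ioo τ δ).indicator fun t => t ^ (-a)), mul_assoc]
  refine mul_le_mul_of_nonneg_left ?_ hK.le
  have h1 : ∫ t in Ioo 0 1, t ^ (a - 1) * (2 - t) ^ (a - 1) * (Ioo τ δ).indicator (fun t => t ^ (-a)) t
      = ∫ t in Ioo τ δ, (2 - t) ^ (a - 1) * t⁻¹ := by
    have : EqOn (fun t : ℝ => t ^ (a - 1) * (2 - t) ^ (a - 1) * (Ioo τ δ).indicator (fun t => t ^ (-a)) t)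
      ((Ioo τ δ).indicator fun t => (2 - t) ^ (a - 1) * t⁻¹) (Ioo 0 1) := fun t ht => by
      simp only [indicator_apply]
      split_ifs
      · have : t ^ (a - 1) * t ^ (-a) = t⁻¹ := by
          rw [← Real.rpow_add ht.1, show a - 1 + -a = -1 by ring, Real.rpow_neg_one]
        rw [← this]; ring
      · simp
    rw [setIntegral_congr_fun measurableSet_Ioo this, setIntegral_indicator measurableSet_Ioo,
      inter_eq_right.2 (Ioo_subset_Ioo hτ.1.le hδ.2.le)]
  have h0 : ∫ t in Ioo τ δ, 2 ^ (-|a - 1|) * t⁻¹ = 2 ^ (-|a - 1|) * (Real.log τ⁻¹ - Real.log δ⁻¹) := by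
    rw [integral_const_mul, ← integral_Ioc_eq_integral_Ioo,
      ← intervalIntegral.integral_of_le hτ.2.le, integral_inv_of_pos hτ.1 hδ.1,
      Real.log_div hδ.1.ne' hτ.1.ne', Real.log_inv, Real.log_inv]
    ring
  have hc1 : IntegrableOn (fun t : ℝ => t⁻¹) (Ioo τ δ) :=
    (ContinuousOn.integrableOn_Icc (continuousOn_inv₀.mono fun t ht =>
      (hτ.1.trans_le ht.1).ne')).mono_set Ioo_subset_Icc_self
  rw [h1, ← h0]
  refine setIntegral_mono_on (hc1.const_mul _) ?_ measurableSet_Ioo fun t ht => ?_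
  · refine (hc1.const_mul (2 ^ |a - 1|)).mono' (by fun_prop : Measurable _).aestronglyMeasurable ?_
    filter_upwards [ae_restrict_mem measurableSet_Ioo] with t ht
    have ht0 : 0 < t := hτ.1.trans ht.1
    have ht1 : t < 1 := ht.2.trans hδ.2
    have h3 := rpow_le_two_rpow_abs (x := 2 - t) (r := a - 1) (by linarith) (by linarith)
    rw [Real.norm_of_nonneg (mul_nonneg (Real.rpow_nonneg (by linarith) _) (by positivity))]
    exact mul_le_mul_of_nonneg_right h3 (by positivity)
  · have ht0 : 0 < t := hτ.1.trans ht.1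
    have ht1 : t < 1 := ht.2.trans hδ.2
    exact mul_le_mul_of_nonneg_right (two_rpow_neg_abs_le (by linarith) (by linarith)) (by positivity)

/-- Interpolation: it trades part of the speed for a weaker singularity `(1 - |u|)^{-νθ}`, which can
be integrable when `(1 - |u|)^{-ν}` is not. -/
theorem min_one_le_rpow {x θ : ℝ} (hx : 0 ≤ x) (h0 : 0 ≤ θ) (h1 : θ ≤ 1) : min 1 x ≤ x ^ θ := by
  rcases le_total x 1 with h | h
  · rw [min_eq_right h]
    rcases hx.eq_or_lt with rfl | hx
    · exact Real.rpow_nonneg le_rfl _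
    · simpa using Real.rpow_le_rpow_of_exponent_ge hx h h1
  · rw [min_eq_left h]; exact Real.one_le_rpow h h0

/-! ### Central moments of the profile. -/

namespace IsProfile

variable {h : ℕ → ℝ → ℝ} {ν : ℝ} {v : ℕ → ℝ} {g : ℝ → ℝ} (s : IsProfile h ν v g) {d : ℕ}
include s

theorem aestronglyMeasurable (d L : ℕ) : AEStronglyMeasurable (h L) (gegenbauerMeasure d) := by
  rw [gegenbauerMeasure_eq]
  exact (((s.continuousOn L).mono Ioo_subset_Icc_self).aestronglyMeasurable
    measurableSet_Ioo).mono_ac (withDensity_absolutelyContinuous _ _)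

/-- An exponent with which the mean is negligible in the moment of order `q`. -/
theorem exists_exponent (hd : 1 ≤ d) {q : ℕ} (hq : 2 ≤ q) (hdq : (d : ℝ) / (2 * ν) ≤ q) :
    ∃ θ : ℝ, 0 < θ ∧ θ ≤ 1 ∧ ν * θ < (d : ℝ) / 2 ∧ (d : ℝ) / (2 * ν) ≤ θ * q ∧
      ((d : ℝ) / (2 * ν) < q → (d : ℝ) / (2 * ν) < θ * q) := by
  have hν := s.nu_pos
  have hd0 : (0 : ℝ) < d := Nat.cast_pos.2 hd
  have hq' : (2 : ℝ) ≤ q := by exact_mod_cast hq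
  set α := (d : ℝ) / (2 * ν) with hα
  have hα0 : 0 < α := by positivity
  have e : (d : ℝ) / 2 = ν * α := by rw [hα]; field_simp
  -- The factor `3/4` lies strictly between `1/2` and `1`: `θ < α` gives integrability, while `q ≥
  -- 2` gives `θ q ≥ 3α/2 > α` if `θ = 3α/4`.
  refine ⟨min 1 (3 / 4 * α), by positivity, min_le_left _ _, ?_, ?_, ?_⟩
  · rw [e]; exact mul_lt_mul_of_pos_left ((min_le_right _ _).trans_lt (by linarith)) hν
  · rcases min_choice 1 (3 / 4 * α) with h | h <;> rw [h]
    · linarith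
    · nlinarith
  · intro hlt
    rcases min_choice 1 (3 / 4 * α) with h | h <;> rw [h]
    · linarith
    · nlinarith

/-- The sign problem of odd powers is settled here. An even power is nonnegative; an odd power is
increasing, so a lower bound for the profile passes to it. -/
theorem pow_sub_ge {q : ℕ} {C : ℝ} (hC : 0 ≤ C)
    (hneg : Even q ∨ ∀ᶠ L in atTop, ∀ u ∈ Ioo (-1 : ℝ) 1, -(C * v L) ≤ h L u) :
    ∀ᶠ L in atTop, ∀ u ∈ Ioo (-1 : ℝ) 1,
      -(|∫ t, h L t ∂(gegenbauerMeasure d)| + C * v L) ^ q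
        ≤ (h L u - ∫ t, h L t ∂(gegenbauerMeasure d)) ^ q := by
  have key : ∀ᶠ L in atTop, Even q ∨ ∀ u ∈ Ioo (-1 : ℝ) 1, -(C * v L) ≤ h L u := by
    rcases hneg with he | hn
    · exact Eventually.of_forall fun _ => Or.inl he
    · exact hn.mono fun L hL => Or.inr hL
  filter_upwards [key, s.v_pos] with L hL hv u hu
  have h0 : 0 ≤ (|∫ t, h L t ∂(gegenbauerMeasure d)| + C * v L) ^ q := by positivity
  rcases Nat.even_or_odd q with he | ho
  · exact (neg_nonpos.2 h0).trans (he.pow_nonneg _)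
  · rcases hL with he | hn
    · exact absurd he (Nat.not_even_iff_odd.2 ho)
    · rw [← ho.neg_pow]
      refine ho.strictMono_pow.monotone ?_
      have := hn u hu
      have h2 := le_abs_self (∫ t, h L t ∂(gegenbauerMeasure d))
      linarith

/-- The truncated upper bound is at most `C v^θ (1 - |u|)^{-νθ}`, which is integrable for this `θ`.
-/
theorem abs_mean_le {θ : ℝ} (h0 : 0 < θ) (h1 : θ ≤ 1) (hθ : ν * θ < (d : ℝ) / 2) :
    ∃ C : ℝ, 0 < C ∧ ∀ᶠ L in atTop, |∫ u, h L u ∂(gegenbauerMeasure d)| ≤ C * v L ^ θ := by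
  obtain ⟨C, hC, hu⟩ := s.upper
  have hint := integrable_gegenbauer_rpow hθ
  have hI : 0 ≤ ∫ u, (1 - |u|) ^ (-(ν * θ)) ∂(gegenbauerMeasure d) := by
    refine integral_nonneg_of_ae ((ae_gegenbauer_mem d).mono fun u hu => ?_)
    exact Real.rpow_nonneg (by linarith [abs_lt.2 hu]) _
  refine ⟨C * (∫ u, (1 - |u|) ^ (-(ν * θ)) ∂(gegenbauerMeasure d)) + 1, by positivity, ?_⟩
  filter_upwards [hu, s.v_pos] with L hL hv
  have hvθ := Real.rpow_pos_of_pos hv θ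
  rw [← Real.norm_eq_abs]
  refine (norm_integral_le_of_norm_le (hint.const_mul (C * v L ^ θ)) ?_).trans ?_
  · filter_upwards [ae_gegenbauer_mem d] with u hu
    have ht : 0 < 1 - |u| := by linarith [abs_lt.2 hu]
    have hx := Real.rpow_nonneg ht.le (-ν)
    refine (hL u hu).trans ?_
    rw [mul_assoc]
    refine mul_le_mul_of_nonneg_left ((min_one_le_rpow (by positivity) h0.le h1).trans ?_) hC.le
    rw [Real.mul_rpow hv.le hx, ← Real.rpow_mul ht.le, neg_mul]
  · rw [integral_const_mul]; linarith

theorem mean_tendsto (hd : 1 ≤ d) :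
    Tendsto (fun L => ∫ u, h L u ∂(gegenbauerMeasure d)) atTop (𝓝 0) := by
  have hν := s.nu_pos
  have hd0 : (0 : ℝ) < d := Nat.cast_pos.2 hd
  have hα0 : 0 < (d : ℝ) / (2 * ν) := by positivity
  obtain ⟨C, hC, hm⟩ := s.abs_mean_le (d := d) (θ := min 1 ((d : ℝ) / (2 * ν) / 2)) (by positivity)
    (min_le_left _ _) (by
      have h1 := mul_le_mul_of_nonneg_left (min_le_right 1 ((d : ℝ) / (2 * ν) / 2)) hν.le
      refine h1.trans_lt ?_
      have : ν * ((d : ℝ) / (2 * ν) / 2) = d / 4 := by field_simp; ring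
      rw [this]; linarith)
  refine squeeze_zero_norm' hm ?_
  have h1 := s.v_tendsto.rpow_const (p := min 1 ((d : ℝ) / (2 * ν) / 2)) (Or.inr (by positivity))
  rw [Real.zero_rpow (by positivity)] at h1
  simpa using h1.const_mul C

/-- Convergence of the rescaled moments below the critical exponent. -/
theorem moment_tendsto {q : ℕ} (hq : 1 ≤ q) (hdq : ν * q < (d : ℝ) / 2) :
    MemLp g q (gegenbauerMeasure d) ∧
    Tendsto (fun L => (∫ u, (h L u - ∫ t, h L t ∂(gegenbauerMeasure d)) ^ q ∂(gegenbauerMeasure d))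
      / v L ^ q) atTop
      (𝓝 (∫ u, (g u - ∫ t, g t ∂(gegenbauerMeasure d)) ^ q ∂(gegenbauerMeasure d))) := by
  have hν := s.nu_pos
  have hq1 : (1 : ℝ) ≤ q := Nat.one_le_cast.2 hq
  have hν1 : ν * 1 < (d : ℝ) / 2 := (mul_le_mul_of_nonneg_left hq1 hν.le).trans_lt hdq
  have hν1' : ν < (d : ℝ) / 2 := by linarith
  obtain ⟨C, hC, hup⟩ := s.upper
  obtain ⟨C', hC', hm⟩ := s.abs_mean_le one_pos le_rfl hν1
  have hlim : ∀ᵐ u ∂(gegenbauerMeasure d), Tendsto (fun L => h L u / v L) atTop (𝓝 (g u)) :=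
    (ae_gegenbauer_mem d).mono fun u hu => s.limit u hu
  have hmeas : ∀ L, AEStronglyMeasurable (fun u => h L u / v L) (gegenbauerMeasure d) := fun L => by
    simpa only [div_eq_mul_inv] using (s.aestronglyMeasurable d L).mul_const (v L)⁻¹
  have hgm : AEStronglyMeasurable g (gegenbauerMeasure d) :=
    aestronglyMeasurable_of_tendsto_ae atTop hmeas hlim
  have hbd : ∀ᶠ L in atTop, ∀ u ∈ Ioo (-1 : ℝ) 1, |h L u / v L| ≤ C * (1 - |u|) ^ (-ν) := by
    filter_upwards [hup, s.v_pos] with L hL hv u hu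
    rw [abs_div, abs_of_pos hv, div_le_iff₀ hv]
    refine (hL u hu).trans ((mul_le_mul_of_nonneg_left (min_le_right _ _) hC.le).trans ?_)
    rw [mul_comm (v L)]; exact (mul_assoc _ _ _).ge
  have hmean : Tendsto (fun L => (∫ u, h L u ∂(gegenbauerMeasure d)) / v L) atTop
      (𝓝 (∫ t, g t ∂(gegenbauerMeasure d))) := by
    simp only [← integral_div]
    refine tendsto_integral_filter_of_dominated_convergence (fun u => C * (1 - |u|) ^ (-ν))
      (Eventually.of_forall hmeas) ?_ ((integrable_gegenbauer_rpow hν1').const_mul C) hlim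
    filter_upwards [hbd] with L hL
    exact (ae_gegenbauer_mem d).mono fun u hu => hL u hu
  have hgb : ∀ᵐ u ∂(gegenbauerMeasure d), |g u| ≤ C * (1 - |u|) ^ (-ν) := by
    filter_upwards [ae_gegenbauer_mem d] with u hu
    exact le_of_tendsto (s.limit u hu).abs (hbd.mono fun L hL => hL u hu)
  have hone : ∀ u ∈ Ioo (-1 : ℝ) 1, 1 ≤ (1 - |u|) ^ (-ν) := fun u hu =>
    Real.one_le_rpow_of_pos_of_le_one_of_nonpos (by linarith [abs_lt.2 hu])
      (by linarith [abs_nonneg u]) (by linarith)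
  have hpow : ∀ u ∈ Ioo (-1 : ℝ) 1, ((1 - |u|) ^ (-ν)) ^ q = (1 - |u|) ^ (-(ν * q)) := fun u hu => by
    rw [← Real.rpow_mul_natCast (by linarith [abs_lt.2 hu]), neg_mul]
  have hI := integrable_gegenbauer_rpow hdq
  constructor
  · have hq0 : (q : ENNReal) ≠ 0 := by exact_mod_cast (by omega : q ≠ 0)
    have h1 : MemLp (fun u : ℝ => C * (1 - |u|) ^ (-ν)) q (gegenbauerMeasure d) := by
      rw [← integrable_norm_rpow_iff (by fun_prop : Measurable _).aestronglyMeasurable hq0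
        (ENNReal.natCast_ne_top q)]
      refine (hI.const_mul (C ^ q)).congr ?_
      filter_upwards [ae_gegenbauer_mem d] with u hu
      have := hone u hu
      rw [Real.norm_of_nonneg (by positivity), ENNReal.toReal_natCast, Real.rpow_natCast, mul_pow,
        hpow u hu]
    refine h1.mono' hgm hgb
  · have hrw : ∀ᶠ L in atTop, ∫ u, (h L u / v L - (∫ t, h L t ∂(gegenbauerMeasure d)) / v L) ^ q
        ∂(gegenbauerMeasure d) = (∫ u, (h L u - ∫ t, h L t ∂(gegenbauerMeasure d)) ^ q
          ∂(gegenbauerMeasure d)) / v L ^ q := by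
      refine Eventually.of_forall fun L => ?_
      simp only [← sub_div, div_pow, integral_div]
    refine Tendsto.congr' hrw ?_
    -- The rescaled mean is at most `C' ≤ C' (1 - |u|)^{-ν}`, so one multiple of `(1 - |u|)^{-ν}`
    -- dominates the centred profile.
    refine tendsto_integral_filter_of_dominated_convergence
      (fun u => (C + C') ^ q * (1 - |u|) ^ (-(ν * q)))
      (Eventually.of_forall fun L => ((hmeas L).sub aestronglyMeasurable_const).pow q) ?_
      (hI.const_mul _) ?_
    · filter_upwards [hbd, hm, s.v_pos] with L hL hmL hv
      filter_upwards [ae_gegenbauer_mem d] with u hu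
      rw [norm_pow, Real.norm_eq_abs, ← hpow u hu, ← mul_pow]
      refine pow_le_pow_left₀ (abs_nonneg _) ((abs_sub _ _).trans ?_) q
      have h2 : |(∫ t, h L t ∂(gegenbauerMeasure d)) / v L| ≤ C' := by
        rw [abs_div, abs_of_pos hv, div_le_iff₀ hv]
        simpa using hmL
      have h3 := hL u hu
      have h4 := mul_le_mul_of_nonneg_left (hone u hu) hC'.le
      linarith
    · filter_upwards [hlim] with u hu
      exact (hu.sub hmean).pow q

variable [IsProbabilityMeasure (gegenbauerMeasure d)]

theorem bounded (d L : ℕ) : ∃ C, ∀ᵐ u ∂(gegenbauerMeasure d), |h L u| ≤ C := by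
  obtain ⟨C, hC⟩ := isCompact_Icc.exists_bound_of_continuousOn (s.continuousOn L)
  exact ⟨C, (ae_gegenbauer_mem d).mono fun u hu => hC u ⟨hu.1.le, hu.2.le⟩⟩

theorem integrable_pow (L q : ℕ) (m : ℝ) :
    Integrable (fun u => (h L u - m) ^ q) (gegenbauerMeasure d) := by
  obtain ⟨C, hC⟩ := s.bounded d L
  refine Integrable.of_bound (((s.aestronglyMeasurable d L).sub aestronglyMeasurable_const).pow q)
    ((C + |m|) ^ q) (hC.mono fun u hu => ?_)
  rw [norm_pow, Real.norm_eq_abs]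
  exact pow_le_pow_left₀ (abs_nonneg _) ((abs_sub _ _).trans (by linarith)) q

/-- The central moments are bounded in terms of truncated powers. -/
theorem moment_le {q : ℕ} {R : ℕ → ℝ} {A B : ℝ} (hA : ∀ᶠ L in atTop,
      ∫ u, min 1 (v L * (1 - |u|) ^ (-ν)) ^ q ∂(gegenbauerMeasure d) ≤ A * R L)
    (hB : ∀ᶠ L in atTop, |∫ u, h L u ∂(gegenbauerMeasure d)| ^ q ≤ B * R L) :
    ∃ C, ∀ᶠ L in atTop, |∫ u, (h L u - ∫ t, h L t ∂(gegenbauerMeasure d)) ^ q ∂(gegenbauerMeasure d)|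
      ≤ C * R L := by
  obtain ⟨C, hC, hup⟩ := s.upper
  refine ⟨2 ^ (q - 1) * (C ^ q * A + B), ?_⟩
  filter_upwards [hup, hA, hB, s.v_pos] with L hL hAL hBL hv
  set m := ∫ t, h L t ∂(gegenbauerMeasure d)
  have hx : ∀ u ∈ Ioo (-1 : ℝ) 1, 0 ≤ min 1 (v L * (1 - |u|) ^ (-ν)) := fun u hu =>
    le_min zero_le_one (mul_nonneg hv.le (Real.rpow_nonneg (by linarith [abs_lt.2 hu]) _))
  have hint : Integrable (fun u : ℝ => min 1 (v L * (1 - |u|) ^ (-ν)) ^ q) (gegenbauerMeasure d) := by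
    refine Integrable.of_bound (by fun_prop : Measurable _).aestronglyMeasurable 1
      ((ae_gegenbauer_mem d).mono fun u hu => ?_)
    rw [Real.norm_of_nonneg (pow_nonneg (hx u hu) q)]
    exact pow_le_one₀ (hx u hu) (min_le_left _ _)
  have hb : ∀ᵐ u ∂(gegenbauerMeasure d), ‖(h L u - m) ^ q‖
      ≤ 2 ^ (q - 1) * (C ^ q * min 1 (v L * (1 - |u|) ^ (-ν)) ^ q + |m| ^ q) := by
    filter_upwards [ae_gegenbauer_mem d] with u hu
    rw [norm_pow, Real.norm_eq_abs]
    have h1 : |h L u - m| ≤ C * min 1 (v L * (1 - |u|) ^ (-ν)) + |m| :=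
      (abs_sub _ _).trans (by linarith [hL u hu])
    refine (pow_le_pow_left₀ (abs_nonneg _) h1 q).trans ?_
    rw [← mul_pow]
    exact add_pow_le (mul_nonneg hC.le (hx u hu)) (abs_nonneg m) q
  rw [← Real.norm_eq_abs]
  refine (norm_integral_le_of_norm_le (((hint.const_mul _).add (integrable_const _)).const_mul _)
    hb).trans ?_
  rw [integral_const_mul, integral_add' (hint.const_mul _) (integrable_const _), integral_const_mul]
  simp only [integral_const, probReal_univ, one_smul]
  rw [mul_assoc]
  refine mul_le_mul_of_nonneg_left ?_ (by positivity)
  have := mul_le_mul_of_nonneg_left hAL (show 0 ≤ C ^ q by positivity)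
  rw [add_mul]; linarith

/-- A lower bound for the central moments. -/
theorem le_moment {q : ℕ} {R E : ℕ → ℝ} {φ : ℕ → ℝ → ℝ} {c : ℝ} (hc : 0 < c)
    (hR : ∀ᶠ L in atTop, 0 ≤ R L)
    (hφi : ∀ᶠ L in atTop, Integrable (φ L) (gegenbauerMeasure d))
    (hφ : ∀ᶠ L in atTop, c * R L ≤ ∫ u, φ L u ∂(gegenbauerMeasure d))
    (hE : E =o[atTop] R)
    (hle : ∀ᶠ L in atTop, ∀ u ∈ Ioo (-1 : ℝ) 1,
      φ L u - E L ≤ (h L u - ∫ t, h L t ∂(gegenbauerMeasure d)) ^ q) :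
    ∀ᶠ L in atTop, c / 2 * R L ≤
      ∫ u, (h L u - ∫ t, h L t ∂(gegenbauerMeasure d)) ^ q ∂(gegenbauerMeasure d) := by
  filter_upwards [hR, hφi, hφ, hE.bound (half_pos hc), hle] with L h1 h2 h3 h4 h5
  have h6 : ∫ u, (φ L u - E L) ∂(gegenbauerMeasure d) ≤
      ∫ u, (h L u - ∫ t, h L t ∂(gegenbauerMeasure d)) ^ q ∂(gegenbauerMeasure d) :=
    integral_mono_ae (h2.sub (integrable_const _)) (s.integrable_pow L q _)
      ((ae_gegenbauer_mem d).mono fun u hu => h5 u hu)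
  rw [integral_sub h2 (integrable_const _)] at h6
  simp only [integral_const, probReal_univ, one_smul] at h6
  rw [Real.norm_eq_abs, Real.norm_of_nonneg h1] at h4
  linarith [le_abs_self (E L)]

end IsProfile

namespace IsProfile

variable {h : ℕ → ℝ → ℝ} {ν : ℝ} {v : ℕ → ℝ} {g : ℝ → ℝ} (s : IsProfile h ν v g) {d : ℕ}
include s

/-- The truncation point. -/
theorem truncation_point : ∃ τ : ℕ → ℝ, Tendsto τ atTop (𝓝 0) ∧
    ∀ᶠ L in atTop, 0 < τ L ∧ τ L ^ ν = v L ∧ τ L ^ ((d : ℝ) / 2) = v L ^ ((d : ℝ) / (2 * ν)) ∧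
      Real.log (v L)⁻¹ = ν * Real.log (τ L)⁻¹ := by
  have hν := s.nu_pos
  refine ⟨fun L => v L ^ ν⁻¹, ?_, ?_⟩
  · have h1 := s.v_tendsto.rpow_const (p := ν⁻¹) (Or.inr (by positivity))
    rwa [Real.zero_rpow (by positivity)] at h1
  · filter_upwards [s.v_pos] with L hv
    refine ⟨Real.rpow_pos_of_pos hv _, ?_, ?_, ?_⟩
    · rw [← Real.rpow_mul hv.le, inv_mul_cancel₀ hν.ne', Real.rpow_one]
    · rw [← Real.rpow_mul hv.le]; congr 1; field_simp
    · rw [Real.log_inv, Real.log_inv, Real.log_rpow hv]; field_simp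

theorem eventually_lt_one : ∀ᶠ L in atTop, v L < 1 := s.v_tendsto.eventually_lt_const one_pos

/-- The error caused by the mean is negligible. -/
theorem mean_pow_isBigO {q : ℕ} {θ C C' : ℝ} (h1 : θ ≤ 1) (hC' : 0 ≤ C')
    (hm : ∀ᶠ L in atTop, |∫ t, h L t ∂(gegenbauerMeasure d)| ≤ C * v L ^ θ) :
    (fun L => (|∫ t, h L t ∂(gegenbauerMeasure d)| + C' * v L) ^ q)
      =O[atTop] fun L => v L ^ (θ * q) := by
  refine IsBigO.of_bound ((C + C') ^ q) ?_
  filter_upwards [hm, s.v_pos, s.eventually_lt_one] with L hL hv hv1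
  have hx : v L ≤ v L ^ θ := by
    simpa using Real.rpow_le_rpow_of_exponent_ge hv hv1.le h1
  rw [Real.rpow_mul_natCast hv.le, norm_pow, norm_pow, ← mul_pow,
    Real.norm_of_nonneg (by positivity), Real.norm_of_nonneg (Real.rpow_nonneg hv.le _)]
  refine pow_le_pow_left₀ (by positivity) ?_ q
  have := mul_le_mul_of_nonneg_left hx hC'
  linarith

theorem rpow_isLittleO {x y : ℝ} (hxy : y < x) :
    (fun L => v L ^ x) =o[atTop] fun L => v L ^ y := by
  refine isLittleO_of_tendsto' (s.v_pos.mono fun L hv h => absurd h (Real.rpow_pos_of_pos hv _).ne') ?_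
  have h1 := s.v_tendsto.rpow_const (p := x - y) (Or.inr (by linarith))
  rw [Real.zero_rpow (by linarith)] at h1
  refine h1.congr' (s.v_pos.mono fun L hv => ?_)
  rw [Real.rpow_sub hv]

variable [IsProbabilityMeasure (gegenbauerMeasure d)]

/-- The order of the central moments above the critical exponent. -/
theorem moment_isTheta (hd : 1 ≤ d) (hK : 0 < area d / area (d + 1)) {q : ℕ} (hq : 2 ≤ q)
    (hdq : (d : ℝ) / (2 * ν) < q) {C₁ : ℝ} (hC₁ : 0 ≤ C₁)
    (hneg : Even q ∨ ∀ᶠ L in atTop, ∀ u ∈ Ioo (-1 : ℝ) 1, -(C₁ * v L) ≤ h L u) :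
    (fun L => ∫ u, (h L u - ∫ t, h L t ∂(gegenbauerMeasure d)) ^ q ∂(gegenbauerMeasure d))
      =Θ[atTop] fun L => v L ^ ((d : ℝ) / (2 * ν)) := by
  have hν := s.nu_pos
  obtain ⟨τ, hτ0, hτ⟩ := s.truncation_point (d := d)
  obtain ⟨θ, hθ0, hθ1, hθa, -, hθq⟩ := s.exists_exponent hd hq hdq.le
  obtain ⟨C, hC, hm⟩ := s.abs_mean_le hθ0 hθ1 hθa
  have hlt : (d : ℝ) / 2 < ν * q := by
    have h1 := mul_lt_mul_of_pos_left hdq hν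
    have e : ν * ((d : ℝ) / (2 * ν)) = d / 2 := by field_simp
    rwa [e] at h1
  have hτ1 := hτ0.eventually_lt_const one_pos
  have hRnn : ∀ᶠ L in atTop, 0 ≤ v L ^ ((d : ℝ) / (2 * ν)) :=
    s.v_pos.mono fun L hv => Real.rpow_nonneg hv.le _
  have hE : ∀ C' : ℝ, 0 ≤ C' → (fun L => (|∫ t, h L t ∂(gegenbauerMeasure d)| + C' * v L) ^ q)
      =o[atTop] fun L => v L ^ ((d : ℝ) / (2 * ν)) := fun C' hC' =>
    (s.mean_pow_isBigO hθ1 hC' hm).trans_isLittleO (s.rpow_isLittleO (hθq hdq))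
  constructor
  · obtain ⟨A, hA⟩ := exists_truncated_le hd hlt
    have hJ : ∀ᶠ L in atTop, ∫ u, min 1 (v L * (1 - |u|) ^ (-ν)) ^ q ∂(gegenbauerMeasure d)
        ≤ A * v L ^ ((d : ℝ) / (2 * ν)) := by
      filter_upwards [hτ, hτ1] with L ⟨h1, h2, h3, _⟩ h4
      rw [← h3, ← h2]; exact hA _ ⟨h1, h4⟩
    have hB : ∀ᶠ L in atTop, |∫ u, h L u ∂(gegenbauerMeasure d)| ^ q
        ≤ 1 * v L ^ ((d : ℝ) / (2 * ν)) := by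
      filter_upwards [(hE 0 le_rfl).bound one_pos, hRnn] with L h1 h2
      rw [Real.norm_of_nonneg h2, zero_mul, add_zero, Real.norm_of_nonneg (by positivity)] at h1
      exact h1
    obtain ⟨C2, hC2⟩ := s.moment_le hJ hB
    refine IsBigO.of_bound C2 ?_
    filter_upwards [hC2, hRnn] with L h1 h2
    rwa [Real.norm_of_nonneg h2]
  · obtain ⟨c, hc, δ, hδ, hδ1, hlow⟩ := s.lower
    obtain ⟨c', hc', hmass⟩ := le_integral_indicator_near_one hd hK
    -- On `(1 - τ, 1)` the truncated power equals `1`, so the profile is at least `c` while its mean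
    -- is below `c / 2`. This interval has mass of order `τ^{d/2}`; elsewhere only the negligible
    -- error `E` is lost.
    have key := s.le_moment (d := d) (q := q) (R := fun L => v L ^ ((d : ℝ) / (2 * ν)))
      (E := fun L => (|∫ t, h L t ∂(gegenbauerMeasure d)| + C₁ * v L) ^ q)
      (φ := fun L u => (c / 2) ^ q * (Ioo (1 - τ L) 1).indicator (fun _ => (1 : ℝ)) u)
      (c := (c / 2) ^ q * c') (by positivity) hRnn
      (Eventually.of_forall fun L =>
        ((integrable_const (1 : ℝ)).indicator measurableSet_Ioo).const_mul _) ?_ (hE C₁ hC₁) ?_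
    · refine IsBigO.of_bound ((c / 2) ^ q * c' / 2)⁻¹ ?_
      filter_upwards [key, hRnn] with L h1 h2
      rw [Real.norm_of_nonneg h2, ← div_eq_inv_mul, le_div_iff₀ (by positivity), mul_comm]
      exact h1.trans (Real.le_norm_self _)
    · filter_upwards [hτ, hτ1] with L ⟨h1, h2, h3, _⟩ h4
      rw [integral_const_mul, ← h3, mul_assoc]
      exact mul_le_mul_of_nonneg_left (hmass _ ⟨h1, h4⟩) (by positivity)
    · filter_upwards [hτ, hτ0.eventually_lt_const hδ, hlow, s.pow_sub_ge (d := d) (q := q) hC₁ hneg,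
        (s.mean_tendsto hd).eventually_lt_const (half_pos hc), s.v_pos]
        with L ⟨h1, h2, _, _⟩ h3 h4 h5 h6 hv u hu
      by_cases hmem : u ∈ Ioo (1 - τ L) 1
      · rw [indicator_of_mem hmem, mul_one]
        have hu1 : 0 < 1 - u := by linarith [hu.2]
        have h7 := h4 u ⟨by linarith [hmem.1], hu.2⟩
        have h8 : 1 ≤ v L * (1 - u) ^ (-ν) := by
          rw [← h2, Real.rpow_neg hu1.le, ← div_eq_mul_inv, one_le_div (Real.rpow_pos_of_pos hu1 _)]
          exact Real.rpow_le_rpow hu1.le (by linarith [hmem.1]) hν.le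
        rw [min_eq_left h8, mul_one] at h7
        have h9 := pow_le_pow_left₀ (half_pos hc).le
          (show c / 2 ≤ h L u - ∫ t, h L t ∂(gegenbauerMeasure d) by linarith) q
        have : 0 ≤ (|∫ t, h L t ∂(gegenbauerMeasure d)| + C₁ * v L) ^ q := by positivity
        linarith
      · rw [indicator_of_notMem hmem, mul_zero, zero_sub]
        exact h5 u hu

/-- The order of the central moments at the critical exponent. -/
theorem moment_isTheta_log (hd : 1 ≤ d) (hK : 0 < area d / area (d + 1)) {q : ℕ} (hq : 2 ≤ q)
    (hdq : (q : ℝ) = d / (2 * ν)) {C₁ : ℝ} (hC₁ : 0 ≤ C₁)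
    (hneg : Even q ∨ ∀ᶠ L in atTop, ∀ u ∈ Ioo (-1 : ℝ) 1, -(C₁ * v L) ≤ h L u) :
    (fun L => ∫ u, (h L u - ∫ t, h L t ∂(gegenbauerMeasure d)) ^ q ∂(gegenbauerMeasure d))
      =Θ[atTop] fun L => v L ^ q * Real.log (v L)⁻¹ := by
  have hν := s.nu_pos
  obtain ⟨τ, hτ0, hτ⟩ := s.truncation_point (d := d)
  have heq : ν * q = (d : ℝ) / 2 := by rw [hdq]; field_simp
  have hq2 : (2 : ℝ) ≤ q := by exact_mod_cast hq
  -- At the critical exponent `νq = d/2`, and `q ≥ 2` gives `ν < d/2`; the mean is then `O(v)`.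
  obtain ⟨C, hC, hm⟩ := s.abs_mean_le (d := d) one_pos le_rfl (by nlinarith)
  have hlogtop : Tendsto (fun L => Real.log (v L)⁻¹) atTop atTop :=
    Real.tendsto_log_atTop.comp (tendsto_inv_nhdsGT_zero.comp
      (tendsto_nhdsWithin_iff.2 ⟨s.v_tendsto, s.v_pos⟩))
  have hlog1 := hlogtop.eventually_ge_atTop 1
  have hτ1 := hτ0.eventually_lt_const one_pos
  have hRnn : ∀ᶠ L in atTop, 0 ≤ v L ^ q * Real.log (v L)⁻¹ := by
    filter_upwards [s.v_pos, hlog1] with L hv h1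
    positivity
  have hvR : (fun L => v L ^ q) =o[atTop] fun L => v L ^ q * Real.log (v L)⁻¹ := by
    have h1 : (fun _ : ℕ => (1 : ℝ)) =o[atTop] fun L => Real.log (v L)⁻¹ :=
      (isLittleO_const_left).2 (Or.inr (tendsto_norm_atTop_atTop.comp hlogtop))
    simpa using (isBigO_refl (fun L => v L ^ q) atTop).mul_isLittleO h1
  have hE : ∀ C' : ℝ, 0 ≤ C' → (fun L => (|∫ t, h L t ∂(gegenbauerMeasure d)| + C' * v L) ^ q)
      =o[atTop] fun L => v L ^ q * Real.log (v L)⁻¹ := fun C' hC' => by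
    have h1 := s.mean_pow_isBigO (q := q) le_rfl hC' hm
    simp only [one_mul, Real.rpow_natCast] at h1
    exact h1.trans_isLittleO hvR
  constructor
  · obtain ⟨A, hA⟩ := exists_truncated_le_log hd heq
    have hJ : ∀ᶠ L in atTop, ∫ u, min 1 (v L * (1 - |u|) ^ (-ν)) ^ q ∂(gegenbauerMeasure d)
        ≤ (|A| * (1 + ν⁻¹)) * (v L ^ q * Real.log (v L)⁻¹) := by
      filter_upwards [hτ, hτ1, hlog1, s.v_pos] with L ⟨h1, h2, h3, h4⟩ h5 h6 hv
      have h7 := hA _ ⟨h1, h5⟩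
      rw [h2, h3, ← hdq, Real.rpow_natCast] at h7
      have h8 : Real.log (τ L)⁻¹ = ν⁻¹ * Real.log (v L)⁻¹ := by rw [h4]; field_simp
      rw [h8] at h7
      refine h7.trans ?_
      calc A * (v L ^ q * (1 + ν⁻¹ * Real.log (v L)⁻¹))
          ≤ |A| * (v L ^ q * (Real.log (v L)⁻¹ + ν⁻¹ * Real.log (v L)⁻¹)) := by
            gcongr
            exact le_abs_self A
        _ = _ := by ring
    have hB : ∀ᶠ L in atTop, |∫ u, h L u ∂(gegenbauerMeasure d)| ^ q
        ≤ 1 * (v L ^ q * Real.log (v L)⁻¹) := by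
      filter_upwards [(hE 0 le_rfl).bound one_pos, hRnn] with L h1 h2
      rw [Real.norm_of_nonneg h2, zero_mul, add_zero, Real.norm_of_nonneg (by positivity)] at h1
      exact h1
    obtain ⟨C2, hC2⟩ := s.moment_le hJ hB
    refine IsBigO.of_bound C2 ?_
    filter_upwards [hC2, hRnn] with L h1 h2
    rwa [Real.norm_of_nonneg h2]
  · obtain ⟨c, hc, δ₀, hδ₀, -, hlow⟩ := s.lower
    obtain ⟨c', hc', hmass⟩ := le_integral_indicator_critical (d := d) hK
    -- Within distance `δ` of `1` the mean, at most `C v`, is no more than half of the lower bound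
    -- `c v (1 - u)^{-ν}`.
    obtain ⟨δ, hδ, hδδ, hδ1, hδC⟩ : ∃ δ : ℝ, 0 < δ ∧ δ ≤ δ₀ ∧ δ < 1 ∧
        ∀ t ∈ Ioo 0 δ, C ≤ c / 2 * t ^ (-ν) := by
      have h1 : Tendsto (fun t : ℝ => c / 2 * t ^ (-ν)) (𝓝[>] 0) atTop :=
        (tendsto_rpow_neg_nhdsGT_zero (neg_neg_of_pos hν)).const_mul_atTop (half_pos hc)
      obtain ⟨r, hr, hr'⟩ := (mem_nhdsGT_iff_exists_Ioo_subset' (show (0 : ℝ) < 1 by norm_num)).1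
        (h1.eventually_ge_atTop C)
      have hr0 : (0 : ℝ) < r := hr
      exact ⟨min (min r δ₀) (1 / 2), by positivity, (min_le_left _ _).trans (min_le_right _ _),
        (min_le_right _ _).trans_lt (by norm_num), fun t ht => hr' ⟨ht.1, ht.2.trans_le
          ((min_le_left _ _).trans (min_le_left _ _))⟩⟩
    have key := s.le_moment (d := d) (q := q) (R := fun L => v L ^ q * Real.log (v L)⁻¹)
      (E := fun L => (|∫ t, h L t ∂(gegenbauerMeasure d)| + C₁ * v L) ^ q)
      (φ := fun L u => (c / 2) ^ q * v L ^ q *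
        (Ioo (1 - δ) (1 - τ L)).indicator (fun u => (1 - u) ^ (-((d : ℝ) / 2))) u)
      (c := (c / 2) ^ q * (c' / (2 * ν))) (by positivity) hRnn ?_ ?_ (hE C₁ hC₁) ?_
    · refine IsBigO.of_bound ((c / 2) ^ q * (c' / (2 * ν)) / 2)⁻¹ ?_
      filter_upwards [key, hRnn] with L h1 h2
      rw [Real.norm_of_nonneg h2, ← div_eq_inv_mul, le_div_iff₀ (by positivity), mul_comm]
      exact h1.trans (Real.le_norm_self _)
    · filter_upwards [hτ] with L ⟨h1, _, _, _⟩
      refine Integrable.const_mul ?_ _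
      refine Integrable.of_bound ((by fun_prop : Measurable fun u : ℝ =>
        (1 - u) ^ (-((d : ℝ) / 2))).indicator measurableSet_Ioo).aestronglyMeasurable
        (τ L ^ (-((d : ℝ) / 2))) (ae_of_all _ fun u => ?_)
      rw [indicator_apply]
      split_ifs with hmem
      · have h2 : τ L ≤ 1 - u := by linarith [hmem.2]
        rw [Real.norm_of_nonneg (Real.rpow_nonneg (h1.le.trans h2) _)]
        exact Real.rpow_le_rpow_of_nonpos h1 h2 (by rw [neg_nonpos]; positivity)
      · rw [norm_zero]; exact Real.rpow_nonneg h1.le _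
    · filter_upwards [hτ, hτ0.eventually_lt_const hδ, s.v_pos,
        hlogtop.eventually_ge_atTop (2 * ν * Real.log δ⁻¹)] with L ⟨h1, h2, h3, h4⟩ h5 hv h6
      have h7 := hmass δ ⟨hδ, hδ1⟩ (τ L) ⟨h1, h5⟩
      have h8 : Real.log (τ L)⁻¹ = Real.log (v L)⁻¹ / ν := by rw [h4]; field_simp
      -- For large `L` the fixed `log δ⁻¹` is at most half of `log τ⁻¹ = log v⁻¹ / ν`; this is the
      -- `2` in the constant.
      have h9 : c' / (2 * ν) * Real.log (v L)⁻¹ ≤ c' * (Real.log (τ L)⁻¹ - Real.log δ⁻¹) := by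
        rw [h8, div_mul_eq_mul_div, mul_div_assoc]
        refine mul_le_mul_of_nonneg_left ?_ hc'.le
        have : Real.log δ⁻¹ ≤ Real.log (v L)⁻¹ / (2 * ν) := by
          rw [le_div_iff₀ (by positivity)]; linarith
        have e : Real.log (v L)⁻¹ / ν = 2 * (Real.log (v L)⁻¹ / (2 * ν)) := by field_simp
        rw [e]; linarith
      rw [integral_const_mul]
      calc (c / 2) ^ q * (c' / (2 * ν)) * (v L ^ q * Real.log (v L)⁻¹)
          = (c / 2) ^ q * v L ^ q * (c' / (2 * ν) * Real.log (v L)⁻¹) := by ring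
        _ ≤ _ := mul_le_mul_of_nonneg_left (h9.trans h7) (by positivity)
    · filter_upwards [hτ, hlow, s.pow_sub_ge (d := d) (q := q) hC₁ hneg, hm, s.v_pos]
        with L ⟨h1, h2, _, _⟩ h4 h5 h6 hv u hu
      by_cases hmem : u ∈ Ioo (1 - δ) (1 - τ L)
      · rw [indicator_of_mem hmem]
        have hu1 : 0 < 1 - u := by linarith [hu.2]
        have h7 := h4 u ⟨by linarith [hmem.1], hu.2⟩
        have h8 : v L * (1 - u) ^ (-ν) ≤ 1 := by
          rw [← h2, Real.rpow_neg hu1.le, ← div_eq_mul_inv, div_le_one (Real.rpow_pos_of_pos hu1 _)]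
          exact Real.rpow_le_rpow h1.le (by linarith [hmem.2]) hν.le
        rw [min_eq_right h8] at h7
        have h10 := mul_le_mul_of_nonneg_right (hδC (1 - u) ⟨hu1, by linarith [hmem.1]⟩) hv.le
        rw [Real.rpow_one] at h6
        have h11 := le_abs_self (∫ t, h L t ∂(gegenbauerMeasure d))
        have hup := Real.rpow_pos_of_pos hu1 (-ν)
        have h9 := pow_le_pow_left₀ (show 0 ≤ c / 2 * v L * (1 - u) ^ (-ν) by positivity)
          (show c / 2 * v L * (1 - u) ^ (-ν) ≤ h L u - ∫ t, h L t ∂(gegenbauerMeasure d) by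
            linarith) q
        have e : ((1 - u) ^ (-ν)) ^ q = (1 - u) ^ (-((d : ℝ) / 2)) := by
          rw [← Real.rpow_mul_natCast hu1.le, neg_mul, heq]
        rw [mul_pow, mul_pow, e] at h9
        have : 0 ≤ (|∫ t, h L t ∂(gegenbauerMeasure d)| + C₁ * v L) ^ q := by positivity
        linarith
      · rw [indicator_of_notMem hmem, mul_zero, zero_sub]
        exact h5 u hu

end IsProfile

/-! ### The law of the inner product on the sphere. -/

open scoped Pointwise in
/-- The cone over the part of the sphere where `⟪x, y⟫ ∈ B`. -/
theorem smul_image_inner_preimage {n : ℕ} (y : EuclideanSpace ℝ (Fin n)) (B : Set ℝ) :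
    Ioo (0 : ℝ) 1 • ((↑) '' {x : Sphere n | inner ℝ (x : EuclideanSpace ℝ (Fin n)) y ∈ B})
      = {x : EuclideanSpace ℝ (Fin n) | 0 < ‖x‖ ∧ ‖x‖ < 1 ∧ inner ℝ x y / ‖x‖ ∈ B} := by
  ext x
  simp only [Set.mem_smul, mem_image, mem_ofPred_eq]
  constructor
  · rintro ⟨r, hr, _, ⟨z, hz, rfl⟩, rfl⟩
    have h1 : ‖r • (z : EuclideanSpace ℝ (Fin n))‖ = r := by
      rw [norm_smul, Real.norm_of_nonneg hr.1.le, norm_eq_of_mem_sphere, mul_one]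
    rw [h1, real_inner_smul_left, mul_div_cancel_left₀ _ hr.1.ne']
    exact ⟨hr.1, hr.2, hz⟩
  · rintro ⟨h0, h1, hB⟩
    refine ⟨‖x‖, ⟨h0, h1⟩, ‖x‖⁻¹ • x, ⟨⟨‖x‖⁻¹ • x, ?_⟩, ?_, rfl⟩, ?_⟩
    · rw [mem_sphere_zero_iff_norm, norm_smul, norm_inv, norm_norm, inv_mul_cancel₀ h0.ne']
    · rw [real_inner_smul_left, ← div_eq_inv_mul]; exact hB
    · rw [smul_smul, mul_inv_cancel₀ h0.ne', one_smul]

theorem measurableSet_inner_mem {n : ℕ} (y : EuclideanSpace ℝ (Fin n)) {B : Set ℝ}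
    (hB : MeasurableSet B) :
    MeasurableSet {x : Sphere n | inner ℝ (x : EuclideanSpace ℝ (Fin n)) y ∈ B} := by
  have : Measurable fun x : Sphere n => inner ℝ (x : EuclideanSpace ℝ (Fin n)) y := by fun_prop
  exact this hB

theorem surface_inner_mem {n : ℕ} (y : EuclideanSpace ℝ (Fin n)) {B : Set ℝ}
    (hB : MeasurableSet B) :
    surface n {x : Sphere n | inner ℝ (x : EuclideanSpace ℝ (Fin n)) y ∈ B}
      = n * volume {x : EuclideanSpace ℝ (Fin n) | 0 < ‖x‖ ∧ ‖x‖ < 1 ∧ inner ℝ x y / ‖x‖ ∈ B} := by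
  rw [Measure.toSphere_apply' _ (measurableSet_inner_mem y hB), smul_image_inner_preimage,
    finrank_euclideanSpace_fin]

/-- Rotation invariance of the distribution of the inner product. -/
theorem volume_cone_eq {n : ℕ} {y z : EuclideanSpace ℝ (Fin n)} (h : ‖y‖ = ‖z‖) (B : Set ℝ) :
    volume {x : EuclideanSpace ℝ (Fin n) | 0 < ‖x‖ ∧ ‖x‖ < 1 ∧ inner ℝ x y / ‖x‖ ∈ B}
      = volume {x : EuclideanSpace ℝ (Fin n) | 0 < ‖x‖ ∧ ‖x‖ < 1 ∧ inner ℝ x z / ‖x‖ ∈ B} := by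
  -- The reflection in the hyperplane orthogonal to `y - z` exchanges the two vectors of equal norm.
  set R := (Submodule.span ℝ {y - z})ᗮ.reflection
  have hR : R y = z := Submodule.reflection_sub h
  have hmp : MeasurePreserving R.toMeasurableEquiv volume volume := R.measurePreserving
  rw [← hmp.measure_preimage_equiv {x | 0 < ‖x‖ ∧ ‖x‖ < 1 ∧ inner ℝ x z / ‖x‖ ∈ B}]
  congr 1
  ext x
  have e : inner ℝ (R x) z = inner ℝ x y := by rw [← hR, R.inner_map_map]
  have e2 : R.toMeasurableEquiv x = R x := rfl
  simp only [mem_preimage, mem_ofPred_eq, e2, e, R.norm_map]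

/-- Splitting off the first coordinate of a Euclidean space. -/
theorem lintegral_euclidean_succ (d : ℕ) (G : ℝ → ℝ → ENNReal) (hG : Measurable (Function.uncurry G)) :
    ∫⁻ x : EuclideanSpace ℝ (Fin (d + 1)), G (x 0) ‖x‖
      = ∫⁻ r : ℝ, ∫⁻ z : EuclideanSpace ℝ (Fin d), G r (√(r ^ 2 + ‖z‖ ^ 2)) := by
  have h1 := (volume_preserving_piFinSuccAbove (fun _ : Fin (d + 1) => ℝ) 0).comp
    (PiLp.volume_preserving_ofLp (Fin (d + 1)))
  have h2 := ((MeasurePreserving.id (volume : Measure ℝ)).prod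
    (PiLp.volume_preserving_toLp (Fin d))).comp h1
  have hmeas : Measurable fun p : ℝ × EuclideanSpace ℝ (Fin d) => G p.1 (√(p.1 ^ 2 + ‖p.2‖ ^ 2)) :=
    hG.comp (by fun_prop : Measurable fun p : ℝ × EuclideanSpace ℝ (Fin d) =>
      (p.1, √(p.1 ^ 2 + ‖p.2‖ ^ 2)))
  rw [← lintegral_prod _ hmeas.aemeasurable, ← h2.lintegral_comp hmeas]
  refine lintegral_congr fun x => ?_
  simp only [Function.comp_apply, Prod.map]
  congr 1
  have : ‖x‖ = √(‖x‖ ^ 2) := (Real.sqrt_sq (norm_nonneg x)).symm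
  rw [this, EuclideanSpace.real_norm_sq_eq, EuclideanSpace.real_norm_sq_eq, Fin.sum_univ_succ]
  rfl

/-- Integration of radial functions. -/
theorem lintegral_radial {d : ℕ} (hd : 1 ≤ d) (g : ℝ → ENNReal) (hg : Measurable g) :
    ∫⁻ z : EuclideanSpace ℝ (Fin d), g ‖z‖
      = ENNReal.ofReal (area d) * ∫⁻ ρ in Ioi (0 : ℝ), ENNReal.ofReal (ρ ^ (d - 1)) * g ρ := by
  have : Nonempty (Fin d) := ⟨⟨0, hd⟩⟩
  set μ := (volume : Measure (EuclideanSpace ℝ (Fin d)))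
  have hgm : Measurable fun ρ : Ioi (0 : ℝ) => g ρ := hg.comp measurable_subtype_coe
  calc ∫⁻ z, g ‖z‖ ∂μ = ∫⁻ z : ({(0)}ᶜ : Set (EuclideanSpace ℝ (Fin d))), g ‖z.1‖ ∂(μ.comap (↑)) := by
        rw [lintegral_subtype_comap (measurableSet_singleton _).compl fun z => g ‖z‖,
          restrict_compl_singleton]
    _ = ∫⁻ p, g p.2 ∂(μ.toSphere.prod (.volumeIoiPow (d - 1))) := by
        have h := μ.measurePreserving_homeomorphUnitSphereProd.lintegral_comp
          (hgm.comp measurable_snd)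
        simpa using h
    _ = μ.toSphere univ * ∫⁻ ρ : Ioi (0 : ℝ), g ρ ∂(.volumeIoiPow (d - 1)) := by
        refine (lintegral_prod (fun p : Sphere d × Ioi (0 : ℝ) => g p.2)
          (hgm.comp measurable_snd).aemeasurable).trans ?_
        exact (lintegral_const (μ := μ.toSphere)
          (∫⁻ ρ : Ioi (0 : ℝ), g ρ ∂(.volumeIoiPow (d - 1)))).trans (mul_comm _ _)
    _ = _ := by
        rw [area, Measure.real, ENNReal.ofReal_toReal (measure_ne_top _ _), Measure.volumeIoiPow,
          lintegral_withDensity_eq_lintegral_mul _ (by fun_prop) hgm,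
          ← lintegral_subtype_comap measurableSet_Ioi]
        rfl

/-- The substitution `u = cos θ` turns `sin^{d-1} θ dθ` into `(1 - u²)^{d/2-1} du`, one power of the
sine being spent on the Jacobian. -/
theorem lintegral_sin_pow {d : ℕ} (hd : 1 ≤ d) (B : Set ℝ) :
    ∫⁻ θ in Ioo 0 Real.pi, ENNReal.ofReal (Real.sin θ ^ (d - 1)) * B.indicator 1 (Real.cos θ)
      = ∫⁻ u in Ioo (-1) 1, ENNReal.ofReal ((1 - u ^ 2) ^ ((d : ℝ) / 2 - 1)) * B.indicator 1 u := by
  have himg : Real.cos '' Ioo 0 Real.pi = Ioo (-1) 1 := by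
    ext u
    refine ⟨?_, fun hu => ⟨Real.arccos u, ⟨Real.arccos_pos.2 hu.2, ?_⟩,
      Real.cos_arccos hu.1.le hu.2.le⟩⟩
    · rintro ⟨θ, hθ, rfl⟩
      have h1 := Real.cos_lt_cos_of_nonneg_of_le_pi le_rfl hθ.2.le hθ.1
      have h2 := Real.cos_lt_cos_of_nonneg_of_le_pi hθ.1.le le_rfl hθ.2
      rw [Real.cos_zero] at h1
      rw [Real.cos_pi] at h2
      exact ⟨h2, h1⟩
    · refine lt_of_le_of_ne (Real.arccos_le_pi u) fun h => ?_
      exact hu.1.not_ge (Real.arccos_eq_pi.1 h)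
  rw [← himg, lintegral_image_eq_lintegral_abs_deriv_mul measurableSet_Ioo
    (fun θ _ => (Real.hasDerivAt_cos θ).hasDerivWithinAt)
    (Real.injOn_cos.mono Ioo_subset_Icc_self)]
  refine setLIntegral_congr_fun measurableSet_Ioo fun θ hθ => ?_
  have hs : 0 < Real.sin θ := Real.sin_pos_of_mem_Ioo hθ
  rw [← mul_assoc, ← ENNReal.ofReal_mul (abs_nonneg _), abs_neg, abs_of_pos hs, ← Real.sin_sq,
    ← Real.rpow_natCast_mul hs.le]
  congr 2
  have e : ((2 : ℕ) : ℝ) * ((d : ℝ) / 2 - 1) = ((d - 1 : ℕ) : ℝ) - 1 := by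
    push_cast [Nat.cast_sub hd]; ring
  rw [e, Real.rpow_sub_one hs.ne', Real.rpow_natCast]
  field_simp

/-- The first coordinate and the norm `ρ` of the others are used as variables, with weight
`ρ^{d-1}`, and then written as `(t cos θ, t sin θ)`. The integral separates: the radius gives `∫₀¹
t^d dt = 1 / (d + 1)`, and the angle gives the integral of `sin^{d-1}`. -/
theorem volume_first_coord_cone {d : ℕ} (hd : 1 ≤ d) {B : Set ℝ} (hB : MeasurableSet B) :
    volume {x : EuclideanSpace ℝ (Fin (d + 1)) | 0 < ‖x‖ ∧ ‖x‖ < 1 ∧ x 0 / ‖x‖ ∈ B}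
      = ENNReal.ofReal (area d) * (((d + 1 : ℕ) : ENNReal)⁻¹ *
        ∫⁻ u in Ioo (-1) 1, ENNReal.ofReal ((1 - u ^ 2) ^ ((d : ℝ) / 2 - 1)) * B.indicator 1 u) := by
  set A : Set (ℝ × ℝ) := {p | 0 < p.2 ∧ p.2 < 1 ∧ p.1 / p.2 ∈ B} with hA
  have hAm : MeasurableSet A := by
    refine (measurableSet_lt measurable_const measurable_snd).inter
      ((measurableSet_lt measurable_snd measurable_const).inter ?_)
    exact (measurable_fst.div measurable_snd) hB
  set G : ℝ → ℝ → ENNReal := fun r s => A.indicator 1 (r, s) with hGdef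
  have hG : Measurable (Function.uncurry G) := measurable_one.indicator hAm
  have h1 : volume {x : EuclideanSpace ℝ (Fin (d + 1)) | 0 < ‖x‖ ∧ ‖x‖ < 1 ∧ x 0 / ‖x‖ ∈ B}
      = ∫⁻ x : EuclideanSpace ℝ (Fin (d + 1)), G (x 0) ‖x‖ := by
    have hm : Measurable fun x : EuclideanSpace ℝ (Fin (d + 1)) => (x 0, ‖x‖) := by fun_prop
    exact (lintegral_indicator_one (μ := volume) (hm hAm)).symm
  have hgm : ∀ r : ℝ, Measurable fun ρ : ℝ => G r (√(r ^ 2 + ρ ^ 2)) := fun r =>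
    hG.comp (by fun_prop : Measurable fun ρ : ℝ => (r, √(r ^ 2 + ρ ^ 2)))
  rw [h1, lintegral_euclidean_succ d G hG]
  simp only [fun r : ℝ => lintegral_radial hd _ (hgm r)]
  have hGm2 : Measurable fun p : ℝ × ℝ => G p.1 (√(p.1 ^ 2 + p.2 ^ 2)) :=
    hG.comp (by fun_prop : Measurable fun p : ℝ × ℝ => (p.1, √(p.1 ^ 2 + p.2 ^ 2)))
  set W : ℝ × ℝ → ENNReal := fun p => (Ioi (0 : ℝ)).indicator
    (fun ρ => ENNReal.ofReal (ρ ^ (d - 1)) * G p.1 (√(p.1 ^ 2 + ρ ^ 2))) p.2 with hW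
  have hWm : Measurable W := by
    have : W = (univ ×ˢ Ioi (0 : ℝ)).indicator
        fun p : ℝ × ℝ => ENNReal.ofReal (p.2 ^ (d - 1)) * G p.1 (√(p.1 ^ 2 + p.2 ^ 2)) := by
      ext p; simp [hW, indicator_apply]
    rw [this]
    exact ((by fun_prop : Measurable fun p : ℝ × ℝ => ENNReal.ofReal (p.2 ^ (d - 1))).mul
      hGm2).indicator (MeasurableSet.univ.prod measurableSet_Ioi)
  rw [lintegral_const_mul' _ _ ENNReal.ofReal_ne_top]
  congr 1
  simp only [← lintegral_indicator measurableSet_Ioi]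
  -- Polar coordinates cover the whole plane; the indicator of `ρ > 0` in `W` removes the angles `θ
  -- ≤ 0`.
  rw [← lintegral_prod W hWm.aemeasurable, ← Measure.volume_eq_prod, ← lintegral_comp_polarCoord_symm,
    polarCoord_target, Measure.volume_eq_prod, ← Measure.prod_restrict]
  have hint : ∀ᵐ p ∂((volume : Measure ℝ).restrict (Ioi 0)).prod
      ((volume : Measure ℝ).restrict (Ioo (-Real.pi) Real.pi)),
      ENNReal.ofReal p.1 • W (polarCoord.symm p)
        = (Iio (1 : ℝ)).indicator (fun t => ENNReal.ofReal (t ^ d)) p.1 *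
          (Ioo 0 Real.pi).indicator
            (fun θ => ENNReal.ofReal (Real.sin θ ^ (d - 1)) * B.indicator 1 (Real.cos θ)) p.2 := by
    rw [Measure.prod_restrict]
    filter_upwards [ae_restrict_mem (measurableSet_Ioi.prod measurableSet_Ioo)] with p hp
    obtain ⟨t, θ⟩ := p
    have ht : 0 < t := hp.1
    have hθ : θ ∈ Ioo (-Real.pi) Real.pi := hp.2
    simp only [polarCoord_symm_apply, hW, smul_eq_mul]
    by_cases hθ0 : 0 < θ
    · have hs : 0 < Real.sin θ := Real.sin_pos_of_mem_Ioo ⟨hθ0, hθ.2⟩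
      rw [indicator_of_mem (show t * Real.sin θ ∈ Ioi 0 from mul_pos ht hs),
        indicator_of_mem (show θ ∈ Ioo 0 Real.pi from ⟨hθ0, hθ.2⟩)]
      have e : √((t * Real.cos θ) ^ 2 + (t * Real.sin θ) ^ 2) = t := by
        rw [mul_pow, mul_pow, ← mul_add, Real.cos_sq_add_sin_sq, mul_one, Real.sqrt_sq ht.le]
      rw [e]
      have hGe : G (t * Real.cos θ) t = (Iio (1 : ℝ)).indicator 1 t * B.indicator 1 (Real.cos θ) := by
        have hmem : (t * Real.cos θ, t) ∈ A ↔ t < 1 ∧ Real.cos θ ∈ B := by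
          rw [hA, mem_ofPred_eq, mul_div_cancel_left₀ _ ht.ne']
          exact and_iff_right ht
        by_cases h3 : t < 1 <;> by_cases h4 : Real.cos θ ∈ B <;> simp [hGdef, indicator, hmem, h3, h4]
      have e3 : t * (t * Real.sin θ) ^ (d - 1) = t ^ d * Real.sin θ ^ (d - 1) := by
        rw [mul_pow, ← mul_assoc, ← pow_succ', Nat.sub_add_cancel hd]
      rw [hGe, ← mul_assoc, ← ENNReal.ofReal_mul ht.le, e3, ENNReal.ofReal_mul (by positivity)]
      simp only [indicator_apply, mem_Iio, Pi.one_apply]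
      split_ifs <;> simp [mul_assoc]
    · have hs : Real.sin θ ≤ 0 := Real.sin_nonpos_of_nonpos_of_neg_pi_le (not_lt.1 hθ0) hθ.1.le
      rw [indicator_of_notMem (show t * Real.sin θ ∉ Ioi 0 from
        not_lt.2 (mul_nonpos_of_nonneg_of_nonpos ht.le hs)),
        indicator_of_notMem (show θ ∉ Ioo 0 Real.pi from fun h => hθ0 h.1), mul_zero, mul_zero]
  rw [lintegral_congr_ae hint, lintegral_prod_mul]
  · have e1 : ∫⁻ t in Ioi (0 : ℝ), (Iio (1 : ℝ)).indicator (fun t => ENNReal.ofReal (t ^ d)) t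
        = ((d + 1 : ℕ) : ENNReal)⁻¹ := by
      rw [lintegral_indicator measurableSet_Iio, Measure.restrict_restrict measurableSet_Iio,
        inter_comm, Ioi_inter_Iio, setLIntegral_congr Ioo_ae_eq_Ioc,
        ← ofReal_integral_eq_lintegral_ofReal
          ((intervalIntegrable_iff_integrableOn_Ioc_of_le zero_le_one).1
            (intervalIntegral.intervalIntegrable_pow d)) ?_,
        ← intervalIntegral.integral_of_le zero_le_one, integral_pow]
      · rw [one_pow, zero_pow (by omega), sub_zero, one_div, ENNReal.ofReal_inv_of_pos (by positivity)]
        congr 1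
        rw [← Nat.cast_succ, ENNReal.ofReal_natCast]
      · filter_upwards [ae_restrict_mem measurableSet_Ioc] with t ht
        exact pow_nonneg ht.1.le d
    rw [e1, lintegral_indicator measurableSet_Ioo, Measure.restrict_restrict measurableSet_Ioo,
      inter_eq_left.2 (Ioo_subset_Ioo_left (by linarith [Real.pi_pos])), lintegral_sin_pow hd B]
  · exact ((by fun_prop : Measurable fun t : ℝ => ENNReal.ofReal (t ^ d)).indicator
      measurableSet_Iio).aemeasurable
  · exact (((by fun_prop : Measurable fun θ : ℝ => ENNReal.ofReal (Real.sin θ ^ (d - 1))).mul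
      ((measurable_one.indicator hB).comp Real.measurable_cos)).indicator
        measurableSet_Ioo).aemeasurable

theorem area_pos {n : ℕ} (hn : 1 ≤ n) : 0 < area n := by
  have : Nonempty (Fin n) := ⟨⟨0, hn⟩⟩
  have h : surface n univ ≠ 0 := Measure.measure_univ_ne_zero.2 (Measure.toSphere_ne_zero _)
  exact ENNReal.toReal_pos h (measure_ne_top _ _)

theorem area_ratio_pos {d : ℕ} (hd : 1 ≤ d) : 0 < area d / area (d + 1) :=
  div_pos (area_pos hd) (area_pos (by omega))

/-- The distribution of the inner product with a fixed point of the sphere. -/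
theorem map_inner_surface {d : ℕ} (hd : 1 ≤ d) (y : Sphere (d + 1)) :
    (surface (d + 1)).map (fun x : Sphere (d + 1) =>
        inner ℝ (x : EuclideanSpace ℝ (Fin (d + 1))) (y : EuclideanSpace ℝ (Fin (d + 1))))
      = ENNReal.ofReal (area (d + 1)) • gegenbauerMeasure d := by
  ext B hB
  have hm : Measurable fun x : Sphere (d + 1) =>
      inner ℝ (x : EuclideanSpace ℝ (Fin (d + 1))) (y : EuclideanSpace ℝ (Fin (d + 1))) := by fun_prop
  rw [Measure.map_apply hm hB]
  refine (surface_inner_mem _ hB).trans ?_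
  rw [volume_cone_eq (z := EuclideanSpace.single 0 1) (by simp)]
  simp only [EuclideanSpace.inner_single_right, conj_trivial, one_mul]
  rw [volume_first_coord_cone hd hB, Measure.smul_apply, smul_eq_mul, gegenbauerMeasure_eq,
    withDensity_apply _ hB, ← lintegral_indicator hB]
  have e : ∀ u, B.indicator (fun u => ENNReal.ofReal (gegenbauerDensity d u)) u
      = ENNReal.ofReal (area d / area (d + 1)) *
        (ENNReal.ofReal ((1 - u ^ 2) ^ ((d : ℝ) / 2 - 1)) * B.indicator 1 u) := fun u => by
    simp only [gegenbauerDensity, ENNReal.ofReal_mul (area_ratio_pos hd).le]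
    by_cases hu : u ∈ B <;> simp [hu]
  simp only [e]
  rw [lintegral_const_mul' _ _ ENNReal.ofReal_ne_top, ← mul_assoc (ENNReal.ofReal (area (d + 1))),
    ← ENNReal.ofReal_mul (area_nonneg _), mul_div_cancel₀ _ (area_pos (by omega)).ne', mul_left_comm,
    ← mul_assoc ((d + 1 : ℕ) : ENNReal), ENNReal.mul_inv_cancel (by simp) (by simp), one_mul]

/-- Comparing total masses in the push-forward identity gives the normalization without evaluating a
beta integral. -/
theorem isProbabilityMeasure_gegenbauer {d : ℕ} (hd : 1 ≤ d) :
    IsProbabilityMeasure (gegenbauerMeasure d) := by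
  have hp := area_pos (n := d + 1) (by omega)
  have h := congrArg (fun μ => μ univ) (map_inner_surface hd ⟨EuclideanSpace.single 0 1, by simp⟩)
  simp only [Measure.smul_apply, smul_eq_mul] at h
  rw [Measure.map_apply (by fun_prop) MeasurableSet.univ, preimage_univ] at h
  have e : surface (d + 1) univ = ENNReal.ofReal (area (d + 1)) := by
    rw [area, Measure.real, ENNReal.ofReal_toReal (measure_ne_top _ _)]
  rw [e] at h
  refine ⟨?_⟩
  have h2 : ENNReal.ofReal (area (d + 1)) ≠ 0 := by simpa using hp
  exact ((ENNReal.mul_right_inj h2 ENNReal.ofReal_ne_top).1 (by rw [mul_one]; exact h)).symm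

/-- Zonal functions integrate against `gegenbauerMeasure`. -/
theorem integral_inner_surface {d : ℕ} (hd : 1 ≤ d) (y : Sphere (d + 1)) {f : ℝ → ℝ}
    (hf : AEStronglyMeasurable f (gegenbauerMeasure d)) :
    ∫ x : Sphere (d + 1), f (inner ℝ (x : EuclideanSpace ℝ (Fin (d + 1)))
        (y : EuclideanSpace ℝ (Fin (d + 1)))) ∂(surface (d + 1))
      = area (d + 1) * ∫ u, f u ∂(gegenbauerMeasure d) := by
  have hm : Measurable fun x : Sphere (d + 1) =>
      inner ℝ (x : EuclideanSpace ℝ (Fin (d + 1))) (y : EuclideanSpace ℝ (Fin (d + 1))) := by fun_prop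
  have hmap := map_inner_surface hd y
  rw [← integral_map (f := f) hm.aemeasurable (by rw [hmap]; exact hf.smul_measure _), hmap,
    integral_smul_measure, ENNReal.toReal_ofReal (area_nonneg _), smul_eq_mul]

/-! ### The Gaussian space of a process. -/

section GaussianSpace

variable {Ω : Type*} [MeasurableSpace Ω] {P : Measure Ω} [IsProbabilityMeasure P]

omit [IsProbabilityMeasure P] in
theorem inner_toLp {f g : Ω → ℝ} (hf : MemLp f 2 P) (hg : MemLp g 2 P) :
    inner ℝ (hf.toLp f) (hg.toLp g) = ∫ ω, f ω * g ω ∂P := by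
  rw [L2.inner_def]
  refine integral_congr_ae ?_
  filter_upwards [hf.coeFn_toLp, hg.coeFn_toLp] with ω h1 h2
  rw [h1, h2]
  simp [mul_comm]

omit [IsProbabilityMeasure P] in
theorem norm_sq_Lp (Z : Lp ℝ 2 P) : ‖Z‖ ^ 2 = ∫ ω, Z ω ^ 2 ∂P := by
  rw [← real_inner_self_eq_norm_sq, L2.inner_def]
  refine integral_congr_ae (ae_of_all _ fun ω => ?_)
  simp [sq]

theorem integral_abs_le_norm (Z : Lp ℝ 2 P) : ∫ ω, |Z ω| ∂P ≤ ‖Z‖ := by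
  have h1 : MemLp (fun ω => |Z ω|) 2 P := (Lp.memLp Z).norm
  have h2 := variance_nonneg (fun ω => |Z ω|) P
  rw [variance_eq_sub h1] at h2
  have h3 : ∫ ω, ((fun ω => |Z ω|) ^ 2) ω ∂P = ‖Z‖ ^ 2 := by
    rw [norm_sq_Lp]; simp
  rw [h3] at h2
  exact le_of_sq_le_sq (by linarith) (norm_nonneg Z)

/-- The characteristic functional. -/
def charFunctional (P : Measure Ω) (Z : Lp ℝ 2 P) : ℂ := ∫ ω, Complex.exp (Complex.I * Z ω) ∂P

theorem norm_exp_I_mul_sub_le (a b : ℝ) :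
    ‖Complex.exp (Complex.I * a) - Complex.exp (Complex.I * b)‖ ≤ |a - b| := by
  have e : Complex.exp (Complex.I * a) - Complex.exp (Complex.I * b)
      = Complex.exp (b * Complex.I) * (Complex.exp (Complex.I * ((a - b : ℝ) : ℂ)) - 1) := by
    rw [mul_sub, ← Complex.exp_add, mul_one, mul_comm (b : ℂ)]; congr 2; push_cast; ring
  rw [e, norm_mul, Complex.norm_exp_ofReal_mul_I, one_mul]
  exact Real.norm_exp_I_mul_ofReal_sub_one_le

theorem integrable_exp_I_mul {f : Ω → ℝ} (hf : AEStronglyMeasurable f P) :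
    Integrable (fun ω => Complex.exp (Complex.I * f ω)) P := by
  refine Integrable.of_bound ?_ 1 (ae_of_all _ fun ω => ?_)
  · exact Complex.continuous_exp.comp_aestronglyMeasurable
      ((Complex.continuous_ofReal.comp_aestronglyMeasurable hf).const_mul _)
  · rw [mul_comm, Complex.norm_exp_ofReal_mul_I]

/-- As `x ↦ e^{ix}` is `1`-Lipschitz, the functional is `1`-Lipschitz for the `L¹` distance, hence
for the `L²` distance. -/
theorem continuous_charFunctional : Continuous (charFunctional P) := by
  refine (LipschitzWith.of_dist_le_mul (K := 1) fun Z W => ?_).continuous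
  rw [NNReal.coe_one, one_mul, dist_eq_norm, dist_eq_norm, charFunctional, charFunctional,
    ← integral_sub (integrable_exp_I_mul (Lp.aestronglyMeasurable Z))
      (integrable_exp_I_mul (Lp.aestronglyMeasurable W))]
  have hint : Integrable (fun ω => |(Z - W : Lp ℝ 2 P) ω|) P :=
    ((Lp.memLp (Z - W)).integrable one_le_two).abs
  refine (norm_integral_le_of_norm_le hint ?_).trans (integral_abs_le_norm _)
  filter_upwards [Lp.coeFn_sub Z W] with ω h
  rw [h]
  exact norm_exp_I_mul_sub_le _ _

theorem charFunctional_eq_of_hasGaussianLaw {Z : Lp ℝ 2 P} (h : HasGaussianLaw Z P)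
    (h0 : ∫ ω, Z ω ∂P = 0) : charFunctional P Z = Complex.exp (-(‖Z‖ ^ 2 / 2 : ℝ)) := by
  have h1 := congrArg (fun μ => charFun μ 1) h.map_eq_gaussianReal
  simp only [charFun_gaussianReal] at h1
  rw [charFun_apply_real, integral_map h.aemeasurable (by fun_prop)] at h1
  have hvar : Var[Z; P] = ‖Z‖ ^ 2 := by
    rw [variance_eq_sub (Lp.memLp Z), h0, norm_sq_Lp]; simp
  rw [charFunctional]
  refine Eq.trans (integral_congr_ae (ae_of_all _ fun ω => ?_)) (h1.trans ?_)
  · simp only; congr 1; push_cast; ring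
  · rw [h0, hvar, Real.coe_toNNReal _ (sq_nonneg _)]
    congr 1; push_cast; ring

variable {ι : Type*} {T : ι → Ω → ℝ}

/-- Every element of the Gaussian space of a centred Gaussian process is centred Gaussian. -/
theorem charFunctional_of_mem_closure (hT : IsGaussianProcess T P) (hm : ∀ i, ∫ ω, T i ω ∂P = 0)
    (h2 : ∀ i, MemLp (T i) 2 P) {Z : Lp ℝ 2 P}
    (hZ : Z ∈ (Submodule.span ℝ (range fun i => (h2 i).toLp (T i))).topologicalClosure) :
    charFunctional P Z = Complex.exp (-(‖Z‖ ^ 2 / 2 : ℝ)) := by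
  have hclosed : IsClosed {Z : Lp ℝ 2 P | charFunctional P Z = Complex.exp (-(‖Z‖ ^ 2 / 2 : ℝ))} :=
    isClosed_eq continuous_charFunctional (by fun_prop)
  -- Both sides are continuous in `Z`, so finite linear combinations suffice; these are Gaussian by
  -- the definition of the process.
  refine closure_minimal (fun Z hZ => ?_) hclosed hZ
  obtain ⟨c, rfl⟩ := Finsupp.mem_span_range_iff_exists_finsupp.1 hZ
  set Z := c.sum fun i a => a • (h2 i).toLp (T i) with hZdef
  have hae : Z =ᵐ[P] fun ω => ∑ i ∈ c.support, c i • T i ω := by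
    have h1 : ∀ᵐ ω ∂P, ∀ i ∈ c.support, (h2 i).toLp (T i) ω = T i ω :=
      (ae_ball_iff c.support.countable_toSet).2 fun i _ => (h2 i).coeFn_toLp
    have h3 : ∀ᵐ ω ∂P, ∀ i ∈ c.support,
        (c i • (h2 i).toLp (T i) : Lp ℝ 2 P) ω = (c i • ⇑((h2 i).toLp (T i))) ω :=
      (ae_ball_iff c.support.countable_toSet).2 fun i _ => Lp.coeFn_smul _ _
    have h4 := Lp.coeFn_fun_finsetSum c.support fun i => c i • (h2 i).toLp (T i)
    filter_upwards [h1, h3, h4] with ω h1 h3 h4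
    rw [hZdef, Finsupp.sum, h4]
    exact Finset.sum_congr rfl fun i hi => by rw [h3 i hi, Pi.smul_apply, h1 i hi]
  have hlaw : HasGaussianLaw (fun ω => ∑ i ∈ c.support, c i • T i ω) P :=
    (hT.smul c).hasGaussianLaw_fun_sum
  refine charFunctional_eq_of_hasGaussianLaw (hlaw.congr hae.symm) ?_
  rw [integral_congr_ae hae, integral_finsetSum (f := fun i ω => c i • T i ω) _
    fun i _ => ((h2 i).integrable one_le_two).smul (c i)]
  simp only [integral_smul, hm, smul_zero, Finset.sum_const_zero]

end GaussianSpace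

/-! ### Hermite polynomials of a correlated Gaussian pair. -/

section JointLaw

variable {Ω : Type*} [MeasurableSpace Ω] {P : Measure Ω} [IsProbabilityMeasure P]

theorem charFunDual_stdGaussian_pair (ρ r : ℝ) (L : StrongDual ℝ (ℝ × ℝ)) :
    charFunDual ((stdGaussian.prod stdGaussian).map fun p : ℝ × ℝ => (p.1, ρ * p.1 + r * p.2)) L
      = Complex.exp (-(((L (1, 0) + L (0, 1) * ρ) ^ 2 + (L (0, 1) * r) ^ 2) / 2 : ℝ)) := by
  have hL : ∀ p : ℝ × ℝ, L p = p.1 * L (1, 0) + p.2 * L (0, 1) := fun p => by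
    conv_lhs => rw [show p = p.1 • ((1, 0) : ℝ × ℝ) + p.2 • ((0, 1) : ℝ × ℝ) by ext <;> simp]
    rw [map_add, map_smul, map_smul, smul_eq_mul, smul_eq_mul]
  have hg : ∀ t : ℝ, ∫ z, Complex.exp (t * z * Complex.I) ∂stdGaussian
      = Complex.exp (-(t ^ 2 / 2 : ℝ)) := fun t => by
    rw [← charFun_apply_real, charFun_gaussianReal]
    congr 1; push_cast; ring
  rw [charFunDual_apply, integral_map (by fun_prop) (by fun_prop)]
  set a := L (1, 0) + L (0, 1) * ρ
  set b := L (0, 1) * r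
  have e : ∀ p : ℝ × ℝ, Complex.exp (L (p.1, ρ * p.1 + r * p.2) * Complex.I)
      = Complex.exp (a * p.1 * Complex.I) * Complex.exp (b * p.2 * Complex.I) := fun p => by
    rw [hL, ← Complex.exp_add]; congr 1; simp only [a, b]; push_cast; ring
  simp only [e]
  rw [integral_prod_mul (fun z : ℝ => Complex.exp (a * z * Complex.I))
    fun z : ℝ => Complex.exp (b * z * Complex.I), hg, hg, ← Complex.exp_add]
  congr 1; push_cast; ring

/-- A pair with the characteristic function of a standard Gaussian pair of correlation `ρ`. -/
theorem map_pair_eq {X Y : Ω → ℝ} (hX : AEMeasurable X P) (hY : AEMeasurable Y P) {ρ : ℝ}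
    (hρ : |ρ| ≤ 1) (h : ∀ s t : ℝ, ∫ ω, Complex.exp (Complex.I * (s * X ω + t * Y ω : ℝ)) ∂P
      = Complex.exp (-((s ^ 2 + 2 * ρ * s * t + t ^ 2) / 2 : ℝ))) :
    P.map (fun ω => (X ω, Y ω)) = (stdGaussian.prod stdGaussian).map
      fun p : ℝ × ℝ => (p.1, ρ * p.1 + √(1 - ρ ^ 2) * p.2) := by
  have : IsProbabilityMeasure (P.map fun ω => (X ω, Y ω)) :=
    Measure.isProbabilityMeasure_map (hX.prodMk hY)
  have : IsProbabilityMeasure ((stdGaussian.prod stdGaussian).map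
      fun p : ℝ × ℝ => (p.1, ρ * p.1 + √(1 - ρ ^ 2) * p.2)) :=
    Measure.isProbabilityMeasure_map (by fun_prop)
  refine Measure.ext_of_charFunDual ?_
  ext L
  rw [charFunDual_stdGaussian_pair, charFunDual_apply, integral_map (hX.prodMk hY) (by fun_prop)]
  have hL : ∀ p : ℝ × ℝ, L p = p.1 * L (1, 0) + p.2 * L (0, 1) := fun p => by
    conv_lhs => rw [show p = p.1 • ((1, 0) : ℝ × ℝ) + p.2 • ((0, 1) : ℝ × ℝ) by ext <;> simp]
    rw [map_add, map_smul, map_smul, smul_eq_mul, smul_eq_mul]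
  refine Eq.trans (integral_congr_ae (ae_of_all _ fun ω => ?_)) ((h (L (1, 0)) (L (0, 1))).trans ?_)
  · simp only; rw [hL]; congr 1; push_cast; ring
  · have hr : √(1 - ρ ^ 2) ^ 2 = 1 - ρ ^ 2 :=
      Real.sq_sqrt (by have := (sq_le_one_iff_abs_le_one ρ).2 hρ; linarith)
    congr 3
    rw [mul_pow (L (0, 1)) (√(1 - ρ ^ 2)), hr]; ring

/-- The pair has the law of `(Z₁, ρ Z₁ + √(1 - ρ²) Z₂)`. Integrating out `Z₂` turns `H_q` into `ρ^q
H_q(Z₁)`, and orthogonality does the rest. -/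
theorem integral_H_mul_H_pair {X Y : Ω → ℝ} (hX : AEMeasurable X P) (hY : AEMeasurable Y P) {ρ : ℝ}
    (hρ : |ρ| ≤ 1) (h : ∀ s t : ℝ, ∫ ω, Complex.exp (Complex.I * (s * X ω + t * Y ω : ℝ)) ∂P
      = Complex.exp (-((s ^ 2 + 2 * ρ * s * t + t ^ 2) / 2 : ℝ))) (p q : ℕ) :
    ∫ ω, H p (X ω) * H q (Y ω) ∂P = if p = q then (q.factorial : ℝ) * ρ ^ q else 0 := by
  have hr : ρ ^ 2 + √(1 - ρ ^ 2) ^ 2 = 1 := by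
    rw [Real.sq_sqrt (by have := (sq_le_one_iff_abs_le_one ρ).2 hρ; linarith)]; ring
  have hc : Continuous fun p' : ℝ × ℝ => H p p'.1 * H q p'.2 :=
    ((continuous_H p).comp continuous_fst).mul ((continuous_H q).comp continuous_snd)
  have hlaw := map_pair_eq hX hY hρ h
  have e1 : ∫ ω, H p (X ω) * H q (Y ω) ∂P
      = ∫ z, H p z.1 * H q (ρ * z.1 + √(1 - ρ ^ 2) * z.2) ∂(stdGaussian.prod stdGaussian) := by
    rw [← integral_map (f := fun p' : ℝ × ℝ => H p p'.1 * H q p'.2) (hX.prodMk hY)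
      hc.aestronglyMeasurable, hlaw, integral_map (by fun_prop) hc.aestronglyMeasurable]
  have hint : Integrable (fun z : ℝ × ℝ => H p z.1 * H q (ρ * z.1 + √(1 - ρ ^ 2) * z.2))
      (stdGaussian.prod stdGaussian) := by
    have h1 : MemLp (fun z : ℝ × ℝ => H p z.1) 2 (stdGaussian.prod stdGaussian) :=
      (memLp_H p).comp_measurePreserving measurePreserving_fst
    have h2 : MemLp (fun z : ℝ × ℝ => H q (ρ * z.1 + √(1 - ρ ^ 2) * z.2)) 2
        (stdGaussian.prod stdGaussian) :=
      (memLp_H q).comp_measurePreserving (measurePreserving_rotation hr)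
    exact h1.integrable_mul h2
  rw [e1, integral_prod _ hint]
  simp only [integral_const_mul, integral_H_affine hr]
  have e2 : ∀ x, H p x * (ρ ^ q * H q x) = ρ ^ q * (H p x * H q x) := fun x => by ring
  simp only [e2, integral_const_mul, integral_H_mul_H]
  split_ifs <;> ring

theorem memLp_H_comp {X Y : Ω → ℝ} (hX : AEMeasurable X P) (hY : AEMeasurable Y P) {ρ : ℝ}
    (hρ : |ρ| ≤ 1) (h : ∀ s t : ℝ, ∫ ω, Complex.exp (Complex.I * (s * X ω + t * Y ω : ℝ)) ∂P
      = Complex.exp (-((s ^ 2 + 2 * ρ * s * t + t ^ 2) / 2 : ℝ))) (q : ℕ) :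
    MemLp (fun ω => H q (X ω)) 2 P := by
  have h1 := congrArg (Measure.map Prod.fst) (map_pair_eq hX hY hρ h)
  rw [AEMeasurable.map_map_of_aemeasurable measurable_fst.aemeasurable (hX.prodMk hY),
    Measure.map_map measurable_fst (by fun_prop)] at h1
  have h2 : P.map X = stdGaussian := by
    refine h1.trans ?_
    exact (measurePreserving_fst (μ := stdGaussian) (ν := stdGaussian)).map_eq
  have h3 := memLp_H q
  rw [← h2] at h3
  exact (memLp_map_measure_iff (continuous_H q).aestronglyMeasurable hX).1 h3

end JointLaw

/-! ### Integrals of fields with constant second moment. -/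

section SecondOrderField

variable {Ω X : Type*} [MeasurableSpace Ω] [MeasurableSpace X] {P : Measure Ω}
  [IsProbabilityMeasure P] {σ : Measure X} [IsFiniteMeasure σ] {S : X → Ω → ℝ} {c : ℝ}

/-- A jointly measurable field with constant second moment is square integrable on the product. -/
theorem integrable_sq_field (hS : Measurable (Function.uncurry S)) (h2 : ∀ x, MemLp (S x) 2 P)
    (hc : ∀ x, ∫ ω, S x ω ^ 2 ∂P = c) :
    Integrable (fun p : X × Ω => S p.1 p.2 ^ 2) (σ.prod P) := by
  have hm : Measurable fun p : X × Ω => S p.1 p.2 ^ 2 := hS.pow_const 2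
  rw [integrable_prod_iff hm.aestronglyMeasurable]
  refine ⟨ae_of_all _ fun x => (h2 x).integrable_sq, ?_⟩
  have : (fun x => ∫ ω, ‖S x ω ^ 2‖ ∂P) = fun _ => c := by
    ext x; rw [← hc x]; simp
  simp only [this]
  exact integrable_const c

theorem integrable_field_mul (hS : Measurable (Function.uncurry S)) (h2 : ∀ x, MemLp (S x) 2 P)
    (hc : ∀ x, ∫ ω, S x ω ^ 2 ∂P = c) {W : Ω → ℝ} (hW : MemLp W 2 P) :
    Integrable (fun p : X × Ω => S p.1 p.2 * W p.2) (σ.prod P) := by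
  have h1 := integrable_sq_field (σ := σ) hS h2 hc
  have h3 : Integrable (fun p : X × Ω => W p.2 ^ 2) (σ.prod P) := hW.integrable_sq.comp_snd σ
  refine (h1.add h3).mono' (hS.aestronglyMeasurable.mul hW.aestronglyMeasurable.comp_snd)
    (ae_of_all _ fun p => ?_)
  simp only [Pi.add_apply]
  rw [Real.norm_eq_abs, abs_le]
  constructor <;> nlinarith [sq_nonneg (S p.1 p.2 + W p.2), sq_nonneg (S p.1 p.2 - W p.2),
    sq_nonneg (S p.1 p.2), sq_nonneg (W p.2)]

theorem integral_field_mul (hS : Measurable (Function.uncurry S)) (h2 : ∀ x, MemLp (S x) 2 P)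
    (hc : ∀ x, ∫ ω, S x ω ^ 2 ∂P = c) {W : Ω → ℝ} (hW : MemLp W 2 P) :
    ∫ ω, (∫ x, S x ω ∂σ) * W ω ∂P = ∫ x, ∫ ω, S x ω * W ω ∂P ∂σ := by
  simp only [← integral_mul_const]
  exact (integral_integral_swap (f := fun x ω => S x ω * W ω)
    (integrable_field_mul hS h2 hc hW)).symm

omit [IsProbabilityMeasure P] in
theorem sq_integral_le {f : X → ℝ} (hσ : 0 < σ.real univ) (hf : MemLp f 2 σ) :
    (∫ x, f x ∂σ) ^ 2 ≤ σ.real univ * ∫ x, f x ^ 2 ∂σ := by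
  set m := (∫ x, f x ∂σ) / σ.real univ with hm
  have h0 : 0 ≤ ∫ x, (f x - m) ^ 2 ∂σ := integral_nonneg fun x => sq_nonneg _
  have e : ∀ x, (f x - m) ^ 2 = f x ^ 2 - 2 * m * f x + m ^ 2 := fun x => by ring
  have hi := (hf.integrable one_le_two).const_mul (2 * m)
  simp only [e] at h0
  rw [integral_add (f := fun x => f x ^ 2 - 2 * m * f x) (hf.integrable_sq.sub hi)
      (integrable_const _), integral_sub hf.integrable_sq hi, integral_const_mul, integral_const, smul_eq_mul] at h0
  have e2 : ∫ x, f x ∂σ = m * σ.real univ := by rw [hm]; field_simp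
  rw [e2] at h0 ⊢
  have := mul_nonneg hσ.le h0
  nlinarith

theorem memLp_integral_field (hσ : 0 < σ.real univ) (hS : Measurable (Function.uncurry S))
    (h2 : ∀ x, MemLp (S x) 2 P) (hc : ∀ x, ∫ ω, S x ω ^ 2 ∂P = c) :
    MemLp (fun ω => ∫ x, S x ω ∂σ) 2 P := by
  have h1 := integrable_sq_field (σ := σ) hS h2 hc
  have hm : StronglyMeasurable fun ω => ∫ x, S x ω ∂σ :=
    (hS.stronglyMeasurable.comp_measurable measurable_swap).integral_prod_right'
  rw [memLp_two_iff_integrable_sq hm.aestronglyMeasurable]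
  refine (h1.integral_prod_right.const_mul (σ.real univ)).mono' (hm.pow 2).aestronglyMeasurable ?_
  filter_upwards [h1.prod_left_ae] with ω hω
  rw [Real.norm_of_nonneg (sq_nonneg _)]
  refine sq_integral_le hσ ((memLp_two_iff_integrable_sq ?_).2 hω)
  exact (hS.comp (measurable_id.prodMk measurable_const)).aestronglyMeasurable

theorem integral_sq_integral_field (hσ : 0 < σ.real univ) (hS : Measurable (Function.uncurry S))
    (h2 : ∀ x, MemLp (S x) 2 P) (hc : ∀ x, ∫ ω, S x ω ^ 2 ∂P = c) :
    ∫ ω, (∫ x, S x ω ∂σ) ^ 2 ∂P = ∫ x, ∫ y, ∫ ω, S y ω * S x ω ∂P ∂σ ∂σ := by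
  simp only [sq]
  rw [integral_field_mul hS h2 hc (memLp_integral_field hσ hS h2 hc)]
  refine integral_congr_ae (ae_of_all _ fun x => ?_)
  simp only [← integral_field_mul hS h2 hc (h2 x), mul_comm (S x _)]

/-- The integral of a centred Gaussian field belongs to the Gaussian space of the field. -/
theorem integral_mem_closure (hσ : 0 < σ.real univ) (hS : Measurable (Function.uncurry S))
    (h2 : ∀ x, MemLp (S x) 2 P) (hc : ∀ x, ∫ ω, S x ω ^ 2 ∂P = c) :
    (memLp_integral_field hσ hS h2 hc).toLp _ ∈
      (Submodule.span ℝ (range fun x => (h2 x).toLp (S x))).topologicalClosure := by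
  -- By Fubini, whatever is orthogonal to all values of the field is orthogonal to its integral.
  -- This avoids approximation by Riemann sums.
  rw [← Submodule.orthogonal_orthogonal_eq_closure, Submodule.mem_orthogonal]
  intro W hW
  have h0 : ∀ x, ∫ ω, S x ω * W ω ∂P = 0 := fun x => by
    have h := (Submodule.mem_orthogonal _ _).1 hW _ (Submodule.subset_span (mem_range_self x))
    rw [← Lp.toLp_coeFn W (Lp.memLp W), inner_toLp] at h
    exact h
  rw [← Lp.toLp_coeFn W (Lp.memLp W), inner_toLp]
  simp only [mul_comm (W _)]
  rw [integral_field_mul hS h2 hc (Lp.memLp W)]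
  simp [h0]

end SecondOrderField

/-! ### Covariance and chaotic components of the normalized field. -/

theorem IsPGF.aestronglyMeasurable_iterate {κ : ℝ → ℝ} {p : ℕ → ℝ} (h : IsPGF κ p) (d L : ℕ) :
    AEStronglyMeasurable κ^[L] (gegenbauerMeasure d) := by
  rw [gegenbauerMeasure_eq]
  exact (((h.iterate_continuousOn L).mono Ioo_subset_Icc_self).aestronglyMeasurable
    measurableSet_Ioo).mono_ac (withDensity_absolutelyContinuous _ _)

theorem IsPGF.integrable_iterate {κ : ℝ → ℝ} {p : ℕ → ℝ} (h : IsPGF κ p) {d : ℕ} (hd : 1 ≤ d)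
    (L : ℕ) : Integrable κ^[L] (gegenbauerMeasure d) := by
  have := isProbabilityMeasure_gegenbauer hd
  refine (integrable_const (1 : ℝ)).mono' (h.aestronglyMeasurable_iterate d L) ?_
  filter_upwards [ae_gegenbauer_mem d] with u hu
  exact abs_le.2 (h.iterate_mem (Ioo_subset_Icc_self hu) L)

/-- On `(-1, 1)` the iterates stay strictly below `1`, so their mean does too. The normalization of
the field is therefore not degenerate. -/
theorem IsPGF.C₀_lt_one {κ : ℝ → ℝ} {p : ℕ → ℝ} (h : IsPGF κ p) (hD : D κ 1 ≠ 0) {d : ℕ}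
    (hd : 1 ≤ d) (L : ℕ) : C₀ d κ L < 1 := by
  have := isProbabilityMeasure_gegenbauer hd
  have hi := h.integrable_iterate hd L
  have hpos : ∀ᵐ u ∂(gegenbauerMeasure d), 0 < 1 - κ^[L] u := by
    filter_upwards [ae_gegenbauer_mem d] with u hu
    linarith [(abs_lt.1 (h.iterate_abs_lt_one hD (abs_lt.2 hu) L)).2]
  have h0 : 0 ≤ ∫ u, (1 - κ^[L] u) ∂(gegenbauerMeasure d) :=
    integral_nonneg_of_ae (hpos.mono fun _ hu => hu.le)
  have h1 : ∫ u, (1 - κ^[L] u) ∂(gegenbauerMeasure d) ≠ 0 := fun he => by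
    rw [integral_eq_zero_iff_of_nonneg_ae (hpos.mono fun _ hu => hu.le)
      ((integrable_const 1).sub hi)] at he
    obtain ⟨u, hu, hu'⟩ := (hpos.and he).exists
    exact hu.ne' hu'
  have h2 := lt_of_le_of_ne h0 h1.symm
  rw [integral_sub (integrable_const 1) hi] at h2
  simpa [C₀] using h2

namespace IsNNGF

section Covariance

variable {Ω : Type*} [MeasurableSpace Ω] {P : Measure Ω} {κ : ℝ → ℝ}
  {p : ℕ → ℝ} {d L : ℕ} {T : Sphere (d + 1) → Ω → ℝ}

theorem memLp (hT : IsNNGF P κ d L T) (x : Sphere (d + 1)) : MemLp (T x) 2 P :=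
  (hT.gaussian.hasGaussianLaw_eval x).memLp_two

theorem second_moment (hT : IsNNGF P κ d L T) (h : IsPGF κ p) (x : Sphere (d + 1)) :
    ∫ ω, T x ω ^ 2 ∂P = 1 := by
  simp only [sq]
  rw [hT.cov, real_inner_self_eq_norm_sq, norm_eq_of_mem_sphere, one_pow]
  exact Function.iterate_fixed h.map_one L

theorem measurable_normalizedField (hT : IsNNGF P κ d L T) :
    Measurable (Function.uncurry (normalizedField κ d L T)) := by
  have hm : StronglyMeasurable fun ω => ∫ x, T x ω ∂(surface (d + 1)) :=
    (hT.measurable.stronglyMeasurable.comp_measurable measurable_swap).integral_prod_right'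
  exact (hT.measurable.sub ((hm.measurable.comp measurable_snd).const_mul _)).div_const _

theorem measurable_H_normalizedField (hT : IsNNGF P κ d L T) (q : ℕ) :
    Measurable (Function.uncurry fun x ω => H q (normalizedField κ d L T x ω)) :=
  (continuous_H q).measurable.comp hT.measurable_normalizedField

variable [IsProbabilityMeasure P]

theorem memLp_integral (hT : IsNNGF P κ d L T) (h : IsPGF κ p) (hd : 1 ≤ d) :
    MemLp (fun ω => ∫ y, T y ω ∂(surface (d + 1))) 2 P :=
  memLp_integral_field (area_pos (by omega)) hT.measurable hT.memLp (hT.second_moment h)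

/-- The covariance is zonal, so the correlation of the field with its integral does not depend on
the point. -/
theorem integral_integral_mul (hT : IsNNGF P κ d L T) (h : IsPGF κ p) (hd : 1 ≤ d)
    (x : Sphere (d + 1)) :
    ∫ ω, (∫ y, T y ω ∂(surface (d + 1))) * T x ω ∂P = area (d + 1) * C₀ d κ L := by
  rw [integral_field_mul hT.measurable hT.memLp (hT.second_moment h) (hT.memLp x)]
  simp only [hT.cov]
  exact integral_inner_surface hd x (h.aestronglyMeasurable_iterate d L)

theorem integral_integral_sq (hT : IsNNGF P κ d L T) (h : IsPGF κ p) (hd : 1 ≤ d) :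
    ∫ ω, (∫ y, T y ω ∂(surface (d + 1))) ^ 2 ∂P = area (d + 1) ^ 2 * C₀ d κ L := by
  rw [integral_sq_integral_field (area_pos (by omega)) hT.measurable hT.memLp (hT.second_moment h)]
  simp only [hT.cov]
  have e : ∀ x : Sphere (d + 1), ∫ y : Sphere (d + 1), κ^[L] (inner ℝ
      (y : EuclideanSpace ℝ (Fin (d + 1))) (x : EuclideanSpace ℝ (Fin (d + 1))))
      ∂(surface (d + 1)) = area (d + 1) * C₀ d κ L := fun x =>
    integral_inner_surface hd x (h.aestronglyMeasurable_iterate d L)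
  simp only [e, integral_const, smul_eq_mul]
  change area (d + 1) * _ = _
  ring

theorem memLp_normalizedField (hT : IsNNGF P κ d L T) (h : IsPGF κ p) (hd : 1 ≤ d)
    (x : Sphere (d + 1)) : MemLp (normalizedField κ d L T x) 2 P := by
  have := ((hT.memLp x).sub ((hT.memLp_integral h hd).const_mul (area (d + 1))⁻¹)).const_mul
    (√(1 - C₀ d κ L))⁻¹
  refine this.congr_norm ?_ (ae_of_all _ fun ω => ?_) 
  · have e : normalizedField κ d L T x = fun ω => (√(1 - C₀ d κ L))⁻¹ *
      (T x - fun ω => (area (d + 1))⁻¹ * ∫ y, T y ω ∂(surface (d + 1))) ω := by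
      ext ω; simp only [normalizedField, Pi.sub_apply]; rw [div_eq_inv_mul]
    rw [e]; exact this.aestronglyMeasurable
  · simp only [normalizedField, Pi.sub_apply]; rw [div_eq_inv_mul]

/-- The correlation of the normalized field. -/
theorem integral_normalizedField_mul (hT : IsNNGF P κ d L T) (h : IsPGF κ p) (hD : D κ 1 ≠ 0)
    (hd : 1 ≤ d) (x y : Sphere (d + 1)) :
    ∫ ω, normalizedField κ d L T x ω * normalizedField κ d L T y ω ∂P
      = (κ^[L] (inner ℝ (x : EuclideanSpace ℝ (Fin (d + 1)))
          (y : EuclideanSpace ℝ (Fin (d + 1)))) - C₀ d κ L) / (1 - C₀ d κ L) := by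
  have hA : 0 < area (d + 1) := area_pos (by omega)
  have hC : 0 < 1 - C₀ d κ L := by linarith [h.C₀_lt_one hD hd L]
  have hr := Real.mul_self_sqrt hC.le
  have hM := hT.memLp_integral h hd
  set M : Ω → ℝ := fun ω => ∫ y, T y ω ∂(surface (d + 1)) with hMdef
  have e : ∀ ω, normalizedField κ d L T x ω * normalizedField κ d L T y ω
      = (1 - C₀ d κ L)⁻¹ * (T x ω * T y ω - (area (d + 1))⁻¹ * (M ω * T x ω)
        - (area (d + 1))⁻¹ * (M ω * T y ω) + (area (d + 1))⁻¹ ^ 2 * M ω ^ 2) := fun ω => by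
    simp only [normalizedField, hMdef]
    rw [div_mul_div_comm, hr, div_eq_inv_mul]
    ring
  simp only [e]
  have i1 : Integrable (fun ω => T x ω * T y ω) P := (hT.memLp x).integrable_mul (hT.memLp y)
  have i2 : ∀ x, Integrable (fun ω => (area (d + 1))⁻¹ * (M ω * T x ω)) P := fun x =>
    (hM.integrable_mul (hT.memLp x)).const_mul _
  have i3 : Integrable (fun ω => (area (d + 1))⁻¹ ^ 2 * M ω ^ 2) P := hM.integrable_sq.const_mul _
  rw [integral_const_mul,
    integral_add (f := fun ω => T x ω * T y ω - (area (d + 1))⁻¹ * (M ω * T x ω)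
      - (area (d + 1))⁻¹ * (M ω * T y ω)) ((i1.sub (i2 x)).sub (i2 y)) i3,
    integral_sub (f := fun ω => T x ω * T y ω - (area (d + 1))⁻¹ * (M ω * T x ω))
      (i1.sub (i2 x)) (i2 y), integral_sub i1 (i2 x), integral_const_mul,
    integral_const_mul, integral_const_mul, hT.cov, hT.integral_integral_mul h hd,
    hT.integral_integral_mul h hd, hT.integral_integral_sq h hd]
  field_simp
  ring

theorem integral_normalizedField_sq (hT : IsNNGF P κ d L T) (h : IsPGF κ p) (hD : D κ 1 ≠ 0)
    (hd : 1 ≤ d) (x : Sphere (d + 1)) : ∫ ω, normalizedField κ d L T x ω ^ 2 ∂P = 1 := by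
  have hC : 0 < 1 - C₀ d κ L := by linarith [h.C₀_lt_one hD hd L]
  simp only [sq]
  rw [hT.integral_normalizedField_mul h hD hd, real_inner_self_eq_norm_sq, norm_eq_of_mem_sphere,
    one_pow, Function.iterate_fixed h.map_one L, div_self hC.ne']

theorem integral_normalizedField_comb_sq (hT : IsNNGF P κ d L T) (h : IsPGF κ p) (hD : D κ 1 ≠ 0)
    (hd : 1 ≤ d) (x y : Sphere (d + 1)) (s t : ℝ) :
    ∫ ω, (s * normalizedField κ d L T x ω + t * normalizedField κ d L T y ω) ^ 2 ∂P
      = s ^ 2 + 2 * ((κ^[L] (inner ℝ (x : EuclideanSpace ℝ (Fin (d + 1)))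
          (y : EuclideanSpace ℝ (Fin (d + 1)))) - C₀ d κ L) / (1 - C₀ d κ L)) * s * t + t ^ 2 := by
  set X := normalizedField κ d L T x with hX
  set Y := normalizedField κ d L T y with hY
  have mX : MemLp X 2 P := hT.memLp_normalizedField h hd x
  have mY : MemLp Y 2 P := hT.memLp_normalizedField h hd y
  have e : ∀ ω, (s * X ω + t * Y ω) ^ 2
      = s ^ 2 * X ω ^ 2 + 2 * s * t * (X ω * Y ω) + t ^ 2 * Y ω ^ 2 := fun ω => by ring
  have i1 : Integrable (fun ω => s ^ 2 * X ω ^ 2) P := mX.integrable_sq.const_mul _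
  have i2 : Integrable (fun ω => 2 * s * t * (X ω * Y ω)) P := (mX.integrable_mul mY).const_mul _
  have i3 : Integrable (fun ω => t ^ 2 * Y ω ^ 2) P := mY.integrable_sq.const_mul _
  simp only [e]
  rw [integral_add (f := fun ω => s ^ 2 * X ω ^ 2 + 2 * s * t * (X ω * Y ω)) (i1.add i2) i3,
    integral_add i1 i2, integral_const_mul, integral_const_mul,
    integral_const_mul, hT.integral_normalizedField_sq h hD hd,
    hT.integral_normalizedField_sq h hD hd, hT.integral_normalizedField_mul h hD hd]
  ring

/-- The second moments of `X + Y` and `X - Y` are nonnegative, and both variables have unit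
variance. -/
theorem abs_correlation_le_one (hT : IsNNGF P κ d L T) (h : IsPGF κ p) (hD : D κ 1 ≠ 0)
    (hd : 1 ≤ d) (x y : Sphere (d + 1)) :
    |(κ^[L] (inner ℝ (x : EuclideanSpace ℝ (Fin (d + 1)))
          (y : EuclideanSpace ℝ (Fin (d + 1)))) - C₀ d κ L) / (1 - C₀ d κ L)| ≤ 1 := by
  have h1 := hT.integral_normalizedField_comb_sq h hD hd x y 1 1
  have h2 := hT.integral_normalizedField_comb_sq h hD hd x y 1 (-1)
  have p1 := integral_nonneg (μ := P)
    (f := fun ω => (1 * normalizedField κ d L T x ω + 1 * normalizedField κ d L T y ω) ^ 2)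
    fun ω => sq_nonneg _
  have p2 := integral_nonneg (μ := P)
    (f := fun ω => (1 * normalizedField κ d L T x ω + -1 * normalizedField κ d L T y ω) ^ 2)
    fun ω => sq_nonneg _
  rw [abs_le]
  constructor <;> linarith

/-- Every linear combination of two values of the normalized field lies in the closed span of `T`,
so it is centred Gaussian and its second moment determines the characteristic function. -/
theorem charFun_normalizedField_pair (hT : IsNNGF P κ d L T) (h : IsPGF κ p) (hD : D κ 1 ≠ 0)
    (hd : 1 ≤ d) (x y : Sphere (d + 1)) (s t : ℝ) :
    ∫ ω, Complex.exp (Complex.I *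
        (s * normalizedField κ d L T x ω + t * normalizedField κ d L T y ω : ℝ)) ∂P
      = Complex.exp (-((s ^ 2 + 2 * ((κ^[L] (inner ℝ (x : EuclideanSpace ℝ (Fin (d + 1)))
          (y : EuclideanSpace ℝ (Fin (d + 1)))) - C₀ d κ L) / (1 - C₀ d κ L)) * s * t
          + t ^ 2) / 2 : ℝ)) := by
  have hA : 0 < (surface (d + 1)).real univ := area_pos (by omega)
  have hM := hT.memLp_integral h hd
  set K := (Submodule.span ℝ (range fun x => (hT.memLp x).toLp (T x))).topologicalClosure with hK
  have hMK : hM.toLp _ ∈ K :=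
    integral_mem_closure hA hT.measurable hT.memLp (hT.second_moment h)
  have hTK : ∀ x, (hT.memLp x).toLp (T x) ∈ K := fun x =>
    Submodule.le_topologicalClosure _ (Submodule.subset_span (mem_range_self x))
  set r := (√(1 - C₀ d κ L))⁻¹ with hr
  set Z : Lp ℝ 2 P := s • r • ((hT.memLp x).toLp (T x) - (area (d + 1))⁻¹ • hM.toLp _)
    + t • r • ((hT.memLp y).toLp (T y) - (area (d + 1))⁻¹ • hM.toLp _) with hZ
  have hZK : Z ∈ K := by
    have hx : ∀ x, (hT.memLp x).toLp (T x) - (area (d + 1))⁻¹ • hM.toLp _ ∈ K := fun x =>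
      K.sub_mem (hTK x) (K.smul_mem _ hMK)
    exact K.add_mem (K.smul_mem _ (K.smul_mem _ (hx x))) (K.smul_mem _ (K.smul_mem _ (hx y)))
  have hae : Z =ᵐ[P] fun ω =>
      s * normalizedField κ d L T x ω + t * normalizedField κ d L T y ω := by
    rw [hZ]
    simp only [← MemLp.toLp_const_smul, ← MemLp.toLp_sub, ← MemLp.toLp_add]
    refine (MemLp.coeFn_toLp _).trans (ae_of_all _ fun ω => ?_)
    simp only [Pi.add_apply, Pi.smul_apply, Pi.sub_apply, smul_eq_mul, normalizedField, hr,
      div_eq_inv_mul]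
  have key := charFunctional_of_mem_closure hT.gaussian hT.mean hT.memLp hZK
  have e1 : charFunctional P Z = ∫ ω, Complex.exp (Complex.I *
        (s * normalizedField κ d L T x ω + t * normalizedField κ d L T y ω : ℝ)) ∂P := by
    refine integral_congr_ae ?_
    filter_upwards [hae] with ω hω
    rw [hω]
  have e2 : ‖Z‖ ^ 2 = s ^ 2 + 2 * ((κ^[L] (inner ℝ (x : EuclideanSpace ℝ (Fin (d + 1)))
          (y : EuclideanSpace ℝ (Fin (d + 1)))) - C₀ d κ L) / (1 - C₀ d κ L)) * s * t + t ^ 2 := by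
    rw [norm_sq_Lp, ← hT.integral_normalizedField_comb_sq h hD hd]
    refine integral_congr_ae ?_
    filter_upwards [hae] with ω hω
    rw [hω]
  rw [← e1, key, e2]

theorem integral_H_mul_H (hT : IsNNGF P κ d L T) (h : IsPGF κ p) (hD : D κ 1 ≠ 0)
    (hd : 1 ≤ d) (x y : Sphere (d + 1)) (m q : ℕ) :
    ∫ ω, H m (normalizedField κ d L T x ω) * H q (normalizedField κ d L T y ω) ∂P
      = if m = q then (q.factorial : ℝ) * ((κ^[L] (inner ℝ (x : EuclideanSpace ℝ (Fin (d + 1)))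
          (y : EuclideanSpace ℝ (Fin (d + 1)))) - C₀ d κ L) / (1 - C₀ d κ L)) ^ q else 0 :=
  integral_H_mul_H_pair (hT.memLp_normalizedField h hd x).aestronglyMeasurable.aemeasurable
    (hT.memLp_normalizedField h hd y).aestronglyMeasurable.aemeasurable
    (hT.abs_correlation_le_one h hD hd x y) (hT.charFun_normalizedField_pair h hD hd x y) m q

theorem memLp_H_normalizedField (hT : IsNNGF P κ d L T) (h : IsPGF κ p) (hD : D κ 1 ≠ 0)
    (hd : 1 ≤ d) (q : ℕ) (x : Sphere (d + 1)) :
    MemLp (fun ω => H q (normalizedField κ d L T x ω)) 2 P :=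
  memLp_H_comp (hT.memLp_normalizedField h hd x).aestronglyMeasurable.aemeasurable
    (hT.memLp_normalizedField h hd x).aestronglyMeasurable.aemeasurable
    (hT.abs_correlation_le_one h hD hd x x) (hT.charFun_normalizedField_pair h hD hd x x) q

theorem integral_H_sq (hT : IsNNGF P κ d L T) (h : IsPGF κ p) (hD : D κ 1 ≠ 0)
    (hd : 1 ≤ d) (q : ℕ) (x : Sphere (d + 1)) :
    ∫ ω, H q (normalizedField κ d L T x ω) ^ 2 ∂P = q.factorial := by
  have hC : 0 < 1 - C₀ d κ L := by linarith [h.C₀_lt_one hD hd L]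
  simp only [sq]
  rw [hT.integral_H_mul_H h hD hd, if_pos rfl, real_inner_self_eq_norm_sq, norm_eq_of_mem_sphere,
    one_pow, Function.iterate_fixed h.map_one L, div_self hC.ne', one_pow, mul_one]

theorem memLp_chaosComponent (hT : IsNNGF P κ d L T) (h : IsPGF κ p) (hD : D κ 1 ≠ 0)
    (hd : 1 ≤ d) (φ : ℝ → ℝ) (q : ℕ) : MemLp (chaosComponent κ d L T φ q) 2 P :=
  (memLp_integral_field (area_pos (by omega)) (hT.measurable_H_normalizedField q)
    (hT.memLp_H_normalizedField h hD hd q) (hT.integral_H_sq h hD hd q)).const_mul _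

/-- The component is centred, because `H_q` is orthogonal to `H_0`. Its second moment is a double
integral of `q! ρ^q` over the sphere, and the inner integral of this zonal function does not depend
on the outer point. -/
theorem variance_chaosComponent (hT : IsNNGF P κ d L T) (h : IsPGF κ p) (hD : D κ 1 ≠ 0)
    (hd : 1 ≤ d) (φ : ℝ → ℝ) {q : ℕ} (hq : q ≠ 0) :
    variance (chaosComponent κ d L T φ q) P = hermiteCoeff φ q ^ 2 * (q.factorial *
      area (d + 1) ^ 2 * ∫ u, ((κ^[L] u - C₀ d κ L) / (1 - C₀ d κ L)) ^ q ∂(gegenbauerMeasure d)) := by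
  have hA : 0 < (surface (d + 1)).real univ := area_pos (by omega)
  have hm := hT.measurable_H_normalizedField q
  have h2 := hT.memLp_H_normalizedField h hD hd q
  have hc := hT.integral_H_sq h hD hd q
  have hmean : ∫ ω, (∫ x, H q (normalizedField κ d L T x ω) ∂(surface (d + 1))) ∂P = 0 := by
    have := integral_field_mul (σ := surface (d + 1)) hm h2 hc (memLp_const (1 : ℝ))
    simp only [mul_one] at this
    rw [this]
    refine integral_eq_zero_of_ae (ae_of_all _ fun x => ?_)
    have h0 := hT.integral_H_mul_H h hD hd x x q 0
    rw [if_neg hq] at h0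
    simpa [H_zero] using h0
  have e : chaosComponent κ d L T φ q = fun ω => hermiteCoeff φ q *
      ∫ x, H q (normalizedField κ d L T x ω) ∂(surface (d + 1)) := rfl
  rw [e, variance_const_mul, variance_eq_sub (memLp_integral_field hA hm h2 hc), hmean]
  simp only [Pi.pow_apply]
  rw [integral_sq_integral_field hA hm h2 hc]
  have e2 : ∀ x : Sphere (d + 1), ∫ y : Sphere (d + 1), ∫ ω, H q (normalizedField κ d L T y ω)
      * H q (normalizedField κ d L T x ω) ∂P ∂(surface (d + 1)) = q.factorial * (area (d + 1) *
        ∫ u, ((κ^[L] u - C₀ d κ L) / (1 - C₀ d κ L)) ^ q ∂(gegenbauerMeasure d)) := fun x => by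
    simp only [hT.integral_H_mul_H h hD hd, if_true]
    rw [integral_const_mul]
    congr 1
    refine integral_inner_surface hd x
      (f := fun u => ((κ^[L] u - C₀ d κ L) / (1 - C₀ d κ L)) ^ q) ?_
    simp only [div_eq_mul_inv]
    exact (((h.aestronglyMeasurable_iterate d L).sub aestronglyMeasurable_const).mul_const _).pow q
  simp only [e2, integral_const, smul_eq_mul]
  change _ * (area (d + 1) * _ - _) = _
  ring

end Covariance

end IsNNGF

/-! ### Variance asymptotics. -/

section Variance

variable {κ : ℝ → ℝ} {p : ℕ → ℝ} {d : ℕ}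

theorem IsPGF.one_sub_C₀ (h : IsPGF κ p) (hD : D κ 1 ≠ 0) (hd : 1 ≤ d) (L : ℕ) :
    1 - C₀ d κ L
      = (1 - κ^[L] 0) * (1 - ∫ t, profile κ L t ∂(gegenbauerMeasure d)) := by
  have := isProbabilityMeasure_gegenbauer hd
  have hpos := h.one_sub_iterate_zero_pos hD L
  simp only [profile]
  rw [integral_div, integral_sub (h.integrable_iterate hd L) (integrable_const _),
    integral_const, probReal_univ, one_smul, C₀]
  field_simp
  ring

/-- Subtracting the mean and normalizing to the value `1` at `1` is insensitive to a prior affine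
change of `κ_L`. -/
theorem IsPGF.normalized_eq (h : IsPGF κ p) (hD : D κ 1 ≠ 0) (hd : 1 ≤ d) (L : ℕ) (u : ℝ) :
    (κ^[L] u - C₀ d κ L) / (1 - C₀ d κ L)
      = (profile κ L u - ∫ t, profile κ L t ∂(gegenbauerMeasure d))
        / (1 - ∫ t, profile κ L t ∂(gegenbauerMeasure d)) := by
  have hpos := h.one_sub_iterate_zero_pos hD L
  have h1 := h.one_sub_C₀ hD hd L
  have h2 : κ^[L] u - C₀ d κ L = (1 - κ^[L] 0) *
      (profile κ L u - ∫ t, profile κ L t ∂(gegenbauerMeasure d)) := by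
    have e : (1 - κ^[L] 0) * profile κ L u = κ^[L] u - κ^[L] 0 := by
      rw [profile, mul_div_cancel₀ _ hpos.ne']
    rw [mul_sub, e]
    linarith
  rw [h1, h2, mul_div_mul_left _ _ hpos.ne']

/-- The variance of the chaotic components through the centred moments of the profile. -/
theorem IsNNGF.variance_eq_moment {Ω : Type*} [MeasurableSpace Ω] {P : Measure Ω}
    [IsProbabilityMeasure P] {L : ℕ} {T : Sphere (d + 1) → Ω → ℝ} (hT : IsNNGF P κ d L T)
    (h : IsPGF κ p) (hD : D κ 1 ≠ 0) (hd : 1 ≤ d) (φ : ℝ → ℝ) {q : ℕ} (hq : q ≠ 0) :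
    variance (chaosComponent κ d L T φ q) P
      = hermiteCoeff φ q ^ 2 * (q.factorial * area (d + 1) ^ 2)
        * ((1 - ∫ t, profile κ L t ∂(gegenbauerMeasure d)) ^ q)⁻¹
        * ∫ u, (profile κ L u - ∫ t, profile κ L t ∂(gegenbauerMeasure d)) ^ q
            ∂(gegenbauerMeasure d) := by
  rw [hT.variance_chaosComponent h hD hd φ hq]
  simp only [h.normalized_eq hD hd, div_pow]
  rw [integral_div]
  ring

end Variance

section Asymptotics

variable {κ : ℝ → ℝ} {p : ℕ → ℝ} {ν β₀ : ℝ} {v b w : ℕ → ℝ} {β : ℝ → ℝ} {d : ℕ}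
  {Ω : Type*} [MeasurableSpace Ω] {P : Measure Ω} [IsProbabilityMeasure P]
  {T : ℕ → Sphere (d + 1) → Ω → ℝ}

theorem tendsto_inv_one_sub_mean_pow (h : IsPGF κ p) (hD : D κ 1 ≠ 0)
    (r : RenormLimit κ ν β₀ v b w β) (hd : 1 ≤ d) (q : ℕ) :
    Tendsto (fun L => ((1 - ∫ t, profile κ L t ∂(gegenbauerMeasure d)) ^ q)⁻¹) atTop (𝓝 1) := by
  have := isProbabilityMeasure_gegenbauer hd
  have h1 := (((h.isProfile hD r).mean_tendsto hd).const_sub 1).pow q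
  simpa using h1.inv₀ (by simp)

/-- Centring removes the shift by `β 0` that the profile introduced. -/
theorem moment_limit_eq_beth (hd : 1 ≤ d) (hβ : Integrable β (gegenbauerMeasure d)) (q : ℕ) :
    ∫ u, ((β u - β 0) / β₀ - ∫ t, (β t - β 0) / β₀ ∂(gegenbauerMeasure d)) ^ q
      ∂(gegenbauerMeasure d) = beth d β₀ β q := by
  have := isProbabilityMeasure_gegenbauer hd
  rw [integral_div, integral_sub hβ (integrable_const _), integral_const, probReal_univ, one_smul]
  have e : ∀ u, ((β u - β 0) / β₀ - ((∫ t, β t ∂(gegenbauerMeasure d)) - β 0) / β₀) ^ q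
      = 1 / β₀ ^ q * centered d β u ^ q := fun u => by
    rw [← sub_div, div_pow, centered]; ring
  simp only [e, integral_const_mul]
  rfl

theorem variance_chaosComponent_tendsto (h : IsPGF κ p) (hD : D κ 1 ≠ 0)
    (r : RenormLimit κ ν β₀ v b w β) (hd : 1 ≤ d) (hT : ∀ L, IsNNGF P κ d L (T L)) (φ : ℝ → ℝ)
    {q : ℕ} (hq : 1 ≤ q) (hdq : (q : ℝ) < d / (2 * ν)) :
    MemLp β q (gegenbauerMeasure d) ∧
      Tendsto (fun L => variance (chaosComponent κ d L (T L) φ q) P / v L ^ q) atTop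
        (𝓝 (beth d β₀ β q * area (d + 1) ^ 2 * (q.factorial : ℝ) * hermiteCoeff φ q ^ 2)) := by
  have := isProbabilityMeasure_gegenbauer hd
  have hν := r.nu_pos
  have hdq' : ν * q < (d : ℝ) / 2 := by
    rw [lt_div_iff₀ (by positivity)] at hdq
    linarith
  obtain ⟨hg, hlim⟩ := (h.isProfile hD r).moment_tendsto hq hdq'
  have hβ : MemLp β q (gegenbauerMeasure d) := by
    refine ((hg.const_mul β₀).add (memLp_const (β 0))).ae_eq (ae_of_all _ fun u => ?_)
    simp only [Pi.add_apply]
    rw [mul_div_cancel₀ _ r.beta0_pos.ne']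
    ring
  refine ⟨hβ, ?_⟩
  rw [moment_limit_eq_beth hd (hβ.integrable (by exact_mod_cast hq))] at hlim
  have h1 := ((tendsto_inv_one_sub_mean_pow h hD r hd q).mul hlim).const_mul
    (hermiteCoeff φ q ^ 2 * (q.factorial * area (d + 1) ^ 2))
  convert h1 using 1
  · ext L
    rw [(hT L).variance_eq_moment h hD hd φ (by omega)]
    ring
  · congr 1; ring

/-- The factor in front of the moment tends to a nonzero constant, since the mean of the profile
tends to `0` and `φ_q ≠ 0`. -/
theorem variance_chaosComponent_isTheta_moment (h : IsPGF κ p) (hD : D κ 1 ≠ 0)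
    (r : RenormLimit κ ν β₀ v b w β) (hd : 1 ≤ d) (hT : ∀ L, IsNNGF P κ d L (T L)) {φ : ℝ → ℝ}
    {q : ℕ} (hq : q ≠ 0) (hφ : hermiteCoeff φ q ≠ 0) :
    (fun L => variance (chaosComponent κ d L (T L) φ q) P) =Θ[atTop]
      fun L => ∫ u, (profile κ L u - ∫ t, profile κ L t ∂(gegenbauerMeasure d)) ^ q
        ∂(gegenbauerMeasure d) := by
  have hA : 0 < area (d + 1) := area_pos (by omega)
  have hc : hermiteCoeff φ q ^ 2 * (q.factorial * area (d + 1) ^ 2) ≠ 0 := by positivity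
  have h1 := (tendsto_inv_one_sub_mean_pow h hD r hd q).const_mul
    (hermiteCoeff φ q ^ 2 * (q.factorial * area (d + 1) ^ 2))
  rw [mul_one] at h1
  have h2 := ((isEquivalent_const_iff_tendsto hc).2 h1).isTheta
  simp only [(hT _).variance_eq_moment h hD hd φ hq]
  have h3 := h2.mul (isTheta_refl (fun L => ∫ u, (profile κ L u -
    ∫ t, profile κ L t ∂(gegenbauerMeasure d)) ^ q ∂(gegenbauerMeasure d)) atTop)
  exact h3.trans ((isTheta_const_mul_left hc).2 (isTheta_refl _ _))

/-- Either the order is even, or the profile is bounded below by a multiple of the speed. -/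
theorem exists_even_or_profile_ge (h : IsPGF κ p) (hD : D κ 1 ≠ 0)
    (r : RenormLimit κ ν β₀ v b w β) {q : ℕ}
    (hodd : (∀ u ∈ Icc (-1 : ℝ) 1, κ (-u) = -κ u) → Even q) :
    ∃ C : ℝ, 0 ≤ C ∧ (Even q ∨
      ∀ᶠ L in atTop, ∀ u ∈ Ioo (-1 : ℝ) 1, -(C * v L) ≤ profile κ L u) := by
  by_cases ho : ∀ u ∈ Icc (-1 : ℝ) 1, κ (-u) = -κ u
  · exact ⟨0, le_rfl, Or.inl (hodd ho)⟩
  · obtain ⟨C, hC, hge⟩ := h.profile_ge hD r ho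
    exact ⟨C, hC, Or.inr hge⟩

end Asymptotics

end NNGF

end

theorem corollary4p4 (σ : ℝ → ℝ) (hσ : NNGF.IsActivation σ)
    (ν β₀ : ℝ) (v b w : ℕ → ℝ) (hreg : NNGF.Regime (NNGF.kernel σ) ν β₀ v b w) :
    ∃ β : ℝ → ℝ,
      (∀ u ∈ Set.Ioo (-1 : ℝ) 1,
        Filter.Tendsto (fun L : ℕ => ((NNGF.kernel σ)^[L] u - b L) / w L)
          Filter.atTop (nhds (β u))) ∧
      ∀ (d : ℕ), 1 ≤ d →
      ∀ (Ω : Type*) [MeasurableSpace Ω] (P : MeasureTheory.Measure Ω)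
        [MeasureTheory.IsProbabilityMeasure P]
        (T : ℕ → NNGF.Sphere (d + 1) → Ω → ℝ),
        (∀ L, NNGF.IsNNGF P (NNGF.kernel σ) d L (T L)) →
      ∀ (φ : ℝ → ℝ), MeasureTheory.MemLp φ 2 NNGF.stdGaussian →
      ∀ (q : ℕ), 2 ≤ q →
        (∀ L, MeasureTheory.MemLp (NNGF.chaosComponent (NNGF.kernel σ) d L (T L) φ q) 2 P) ∧
        ((q : ℝ) < d / (2 * ν) →
          MeasureTheory.MemLp β q (NNGF.gegenbauerMeasure d) ∧
          ∃ ε : ℕ → ℝ, Filter.Tendsto ε Filter.atTop (nhds 0) ∧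
            ∀ᶠ L : ℕ in Filter.atTop,
              ProbabilityTheory.variance
                  (NNGF.chaosComponent (NNGF.kernel σ) d L (T L) φ q) P =
                v L ^ q *
                  (NNGF.beth d β₀ β q * NNGF.area (d + 1) ^ 2 * (q.factorial : ℝ) *
                    NNGF.hermiteCoeff φ q ^ 2 + ε L)) ∧
        (NNGF.hermiteCoeff φ q ≠ 0 →
          ((∀ u ∈ Set.Icc (-1 : ℝ) 1, NNGF.kernel σ (-u) = -NNGF.kernel σ u) → Even q) →
          ((q : ℝ) = d / (2 * ν) →
            (fun L : ℕ => ProbabilityTheory.variance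
                (NNGF.chaosComponent (NNGF.kernel σ) d L (T L) φ q) P)
              =Θ[Filter.atTop] fun L : ℕ => v L ^ q * Real.log (v L)⁻¹) ∧
          ((d : ℝ) / (2 * ν) < q →
            (fun L : ℕ => ProbabilityTheory.variance
                (NNGF.chaosComponent (NNGF.kernel σ) d L (T L) φ q) P)
              =Θ[Filter.atTop] fun L : ℕ => v L ^ ((d : ℝ) / (2 * ν)))) := by
  have h := hσ.isPGF
  obtain ⟨hD, β, r⟩ := h.exists_renormLimit hreg
  refine ⟨β, r.limit, fun d hd Ω _ P _ T hT φ _ q hq =>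
    ⟨fun L => (hT L).memLp_chaosComponent h hD hd φ q, fun hdq => ?_, fun hφ hodd => ?_⟩⟩
  · obtain ⟨hβ, hlim⟩ := NNGF.variance_chaosComponent_tendsto h hD r hd hT φ (by omega) hdq
    have h0 := hlim.sub_const (NNGF.beth d β₀ β q * NNGF.area (d + 1) ^ 2 *
      (q.factorial : ℝ) * NNGF.hermiteCoeff φ q ^ 2)
    rw [sub_self] at h0
    -- The remainder `ε` is the variance divided by `v L ^ q`, minus its limit; the identity holds
    -- as soon as `v L > 0`.
    refine ⟨hβ, _, h0, ?_⟩
    filter_upwards [r.v_pos] with L hv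
    rw [add_sub_cancel, mul_div_cancel₀ _ (pow_pos hv q).ne']
  · have := NNGF.isProbabilityMeasure_gegenbauer hd
    obtain ⟨C, hC, hneg⟩ := NNGF.exists_even_or_profile_ge h hD r hodd
    have hΘ := NNGF.variance_chaosComponent_isTheta_moment h hD r hd hT (by omega) hφ
    have hs := h.isProfile hD r
    exact ⟨fun hdq => hΘ.trans
        (hs.moment_isTheta_log hd (NNGF.area_ratio_pos hd) hq hdq hC hneg),
      fun hdq => hΘ.trans (hs.moment_isTheta hd (NNGF.area_ratio_pos hd) hq hdq hC hneg)⟩
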